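/- Let $n,m,N\ge 1$ be integers and let $M$ be the number of multi-indices $\alpha\in\mathbb N^n$ with $|\alpha|=m$. Write $\mathbb R^{n+1}_+=\{(t,x):t>0,\ x\in\mathbb R^n\}$ and, for a $\mathbb C^N$-valued function $f$, $\nabla^m f=(\partial^\alpha f_i)_{|\alpha|=m,\,1\le i\le N}$ (spatial derivatives in the sense of distributions), with $|\nabla^m f|^2=\sum_{\alpha,i}|\partial^\alpha f_i|^2$. Let $A=(a^{i,j}_{\alpha,\beta})_{|\alpha|=|\beta|=m,\,1\le i,j\le N}:\mathbb R^{n+1}_+\to\mathbb C^{NM\times NM}$ be measurable and let $\lambda,\Lambda>0$ be such that the operator norm of $A(t,x)$ on $\mathbb C^{NM}$ is at most $\Lambda$ for a.e. $(t,x)$, and such that for a.e. $t>0$ $$\mathrm{Re}\int_{\mathbb R^n}\sum_{\alpha,\beta,i,j} a^{i,j}_{\alpha,\beta}(t,x)\,\partial^\beta f_j(x)\,\overline{\partial^\alpha f_i(x)}\,dx\ \ge\ \lambda\|\nabla^m f\|_{L^2(\mathbb R^n)}^2$$ for all $f\in\mathscr D'(\mathbb R^n;\mathbb C^N)$ with $\nabla^m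 f\in L^2(\mathbb R^n)$. A global weak solution of $\partial_t u=(-1)^{m+1}\mathrm{div}_m A\nabla^m u$ is a function $u\in L^2_{loc}(0,\infty;H^m_{loc}(\mathbb R^n;\mathbb C^N))$ with $$\int_{\mathbb R^{n+1}_+}\sum_i u_i\,\overline{\partial_t\phi_i}\,dx\,dt=\int_{\mathbb R^{n+1}_+}\sum_{\alpha,\beta,i,j} a^{i,j}_{\alpha,\beta}\,\partial^\beta u_j\,\overline{\partial^\alpha\phi_i}\,dx\,dt\qquad\text{for all }\phi\in\mathscr C_c^\infty(\mathbb R^{n+1}_+;\mathbb C^N).$$ A function $u_0\in L^1_{loc}(\mathbb R^n;\mathbb C^N)$ is called the trace of $u$ if $u$ has a representative in $\mathscr C((0,\infty);L^2_{loc}(\mathbb R^n))$ and, for this representative, $\lim_{t\to0}\|u(t,\cdot)-u_0\|_{L^1(K)}=0$ for every compact $K\subseteq\mathbb R^n$. Let $X=\{u\in\mathscr D'(\mathbb R^{n+1}_+;\mathbb C^N):\nabla^m u\in L^2(\mathbb R^{n+1}_+)\}$ with seminorm $\|u\|_X=\|\nabla^m u\|_{L^2(\mathbb R^{n+1}_+)}$.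 Theorem. The Cauchy problem is well-posed for data in $L^2(\mathbb R^n;\mathbb C^N)$ and solutions in $X$. That is: (i) every global weak solution $u\in X$ has a trace $u_0\in L^1_{loc}$; (ii) for every $u_0\in L^2$ there is one and, up to null sets, only one global weak solution $u\in X$ with trace $u_0$; (iii) there is a constant $C>0$ with $\|u\|_X\le C\|u_0\|_{L^2}$ for all $u_0\in L^2$ and the corresponding solution $u\in X$. Moreover, for every $u_0\in L^2$ the unique global weak solution $u\in X$ with trace $u_0$ satisfies (up to modification on a null set) $u\in\mathscr C([0,\infty);L^2(\mathbb R^n))$ with $u(0)=u_0$ and $\lim_{t\to\infty}\|u(t,\cdot)\|_{L^2}=0$; $u\in L^2(0,T;H^m(\mathbb R^n))$ for every $T>0$; the function $t\mapsto\|u(t,\cdot)\|_{L^2}$ is non-increasing on $[0,\infty)$; and $$\|u_0\|_{L^2}=\|u\|_{L^\infty(0,\infty;L^2)}\le\sqrt{2\Lambda}\,\|\nabla^m u\|_{L^2(0,\infty;L^2)}\le\sqrt{\Lambda/\lambda}\,\|u_0\|_{L^2}.$$ -/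

import Mathlib

open MeasureTheory Set Filter Topology
open scoped ENNReal NNReal ContDiff

noncomputable section

namespace ParabolicCauchy

/-- The space `ℝⁿ` with its Euclidean norm and Lebesgue measure. -/
abbrev Sp (n : ℕ) : Type := EuclideanSpace ℝ (Fin n)

/-- The state space `ℂ^N`. -/
abbrev St (N : ℕ) : Type := EuclideanSpace ℂ (Fin N)

/-- Multi-indices `α ∈ ℕⁿ` of length exactly `m`. -/
abbrev MultiIndex (n m : ℕ) : Type :=
  {α : Fin n → ℕ // α ∈ Finset.piAntidiag (Finset.univ : Finset (Fin n)) m}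

/-- Values of a gradient of order `m`: families `(ξ_α^i)` with `|α| = m` and `1 ≤ i ≤ N`,
with the Euclidean norm `|ξ|² = ∑_{α,i} |ξ_α^i|²`. -/
abbrev Grad (n m N : ℕ) : Type := EuclideanSpace ℂ (MultiIndex n m × Fin N)

/-- The coordinate directions of `ℝⁿ`. -/
def dir (n : ℕ) (i : Fin n) : Sp n := EuclideanSpace.single i 1

/-- The spatial coordinate directions of `ℝ × ℝⁿ`. -/
def spaceDir (n : ℕ) (i : Fin n) : ℝ × Sp n := (0, dir n i)

/-- The parabolic half-space `{(t, x) : t > 0}`. -/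
def halfSpace (n : ℕ) : Set (ℝ × Sp n) := Ioi 0 ×ˢ univ

section Derivatives

variable {E F : Type*} [NormedAddCommGroup E] [NormedSpace ℝ E]
  [NormedAddCommGroup F] [NormedSpace ℝ F]

/-- The classical derivative `∂^α φ` of a smooth function, where `∂_i` is the derivative in the
direction `e i`. -/
def multiDeriv {n : ℕ} (e : Fin n → E) (α : Fin n → ℕ) (φ : E → F) : E → F :=
  (List.finRange n).foldr (fun i ψ => (fun χ p => fderiv ℝ χ p (e i))^[α i] ψ) φ

/-- `φ ∈ C_c^∞(Q)`. -/
def IsTestFunction (Q : Set E) (φ : E → F) : Prop :=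
  ContDiff ℝ ∞ φ ∧ HasCompactSupport φ ∧ tsupport φ ⊆ Q

/-- `∂^α u = g` in the sense of distributions on the open set `Q`, with `u` and `g` locally
integrable on `Q`; `∂_i` is the derivative in the direction `e i`. -/
def HasWeakDerivOn [MeasureSpace E] {n : ℕ} (e : Fin n → E) (Q : Set E) (α : Fin n → ℕ)
    (u g : E → F) : Prop :=
  LocallyIntegrableOn u Q ∧ LocallyIntegrableOn g Q ∧
    ∀ φ : E → ℝ, IsTestFunction Q φ →
      ∫ p in Q, multiDeriv e α φ p • u p = (-1 : ℝ) ^ (∑ i, α i) • ∫ p in Q, φ p • g p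

open scoped Classical in
/-- The weak derivative `∂^α u` on `Q`, which is unique almost everywhere on `Q` when it exists
(and is set to `0` when it does not). -/
def weakDeriv [MeasureSpace E] {n : ℕ} (e : Fin n → E) (Q : Set E) (α : Fin n → ℕ)
    (u : E → F) : E → F :=
  if h : ∃ g, HasWeakDerivOn e Q α u g then h.choose else 0

/-- The full gradient `∇^m u = (∂^α u_i)_{|α| = m, i}` on `Q` of a `ℂ^N`-valued function. -/
def weakGrad [MeasureSpace E] {n N : ℕ} (e : Fin n → E) (Q : Set E) (m : ℕ)
    (u : E → St N) : E → Grad n m N :=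
  fun p => WithLp.toLp 2 fun a => weakDeriv e Q a.1.1 u p a.2

/-- The classical gradient `∇^m φ = (∂^α φ_i)_{|α| = m, i}` of a smooth `ℂ^N`-valued function. -/
def classicalGrad {n N : ℕ} (e : Fin n → E) (m : ℕ) (φ : E → St N) : E → Grad n m N :=
  fun p => WithLp.toLp 2 fun a => multiDeriv e a.1.1 φ p a.2

/-- `∇^m u ∈ L²(Q)`, in the sense of distributions on `Q`. -/
def HasL2Grad [MeasureSpace E] {n N : ℕ} (e : Fin n → E) (Q : Set E) (m : ℕ)
    (u : E → St N) : Prop :=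
  ∀ α : MultiIndex n m, ∃ g, HasWeakDerivOn e Q α.1 u g ∧ MemLp g 2 (volume.restrict Q)

end Derivatives

/-- The form `∑ a_{α,β}^{i,j} ξ_β^j conj(η_α^i)` of a coefficient matrix; the entry
`a_{α,β}^{i,j}` is `M (α, i) (β, j)`. -/
def coeffForm {n m N : ℕ} (M : Matrix (MultiIndex n m × Fin N) (MultiIndex n m × Fin N) ℂ)
    (ξ η : Grad n m N) : ℂ :=
  ∑ a, ∑ b, M a b * ξ b * starRingEnd ℂ (η a)

/-- Coefficients `A(t,x)` of a system of order `2m` on the half-space. -/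
abbrev Coeff (n m N : ℕ) : Type :=
  ℝ × Sp n → Matrix (MultiIndex n m × Fin N) (MultiIndex n m × Fin N) ℂ

/-- The ellipticity estimates with constants `lam`, `Lam`: the coefficients are measurable, the
matrix `A(t,x)` has operator norm at most `Lam` on `ℂ^{NM}` for almost every `(t,x)`, and for
almost every `t > 0` the strong Gårding inequality holds for all `f` with `∇^m f ∈ L²(ℝⁿ)`.
(A distribution whose derivatives of order `m` are in `L²` is a locally integrable function.) -/
structure IsElliptic {n m N : ℕ} (A : Coeff n m N) (lam Lam : ℝ) : Prop where
  measurable : ∀ a b, AEStronglyMeasurable (fun p => A p a b) (volume.restrict (halfSpace n))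
  upper : ∀ᵐ p ∂(volume.restrict (halfSpace n)), ∀ ξ η : Grad n m N,
    ‖coeffForm (A p) ξ η‖ ≤ Lam * ‖ξ‖ * ‖η‖
  garding : ∀ᵐ t ∂(volume.restrict (Ioi (0 : ℝ))), ∀ f : Sp n → St N,
    LocallyIntegrable f → HasL2Grad (dir n) univ m f →
      lam * ∫ x, ‖weakGrad (dir n) univ m f x‖ ^ 2 ≤
        (∫ x, coeffForm (A (t, x)) (weakGrad (dir n) univ m f x)
          (weakGrad (dir n) univ m f x)).re

/-- `u ∈ L²_loc(0,∞; H^m_loc(ℝⁿ))`: all spatial derivatives of `u` of order at most `m` are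
square integrable on compact subsets of the half-space. -/
def MemL2HmLoc {n N : ℕ} (m : ℕ) (u : ℝ × Sp n → St N) : Prop :=
  ∀ γ : Fin n → ℕ, ∑ i, γ i ≤ m → ∃ g, HasWeakDerivOn (spaceDir n) (halfSpace n) γ u g ∧
    ∀ K : Set (ℝ × Sp n), IsCompact K → K ⊆ halfSpace n → MemLp g 2 (volume.restrict K)

/-- `u ∈ L²(0,T; H^m(ℝⁿ))`: all spatial derivatives of `u` of order at most `m` belong to
`L²((0,T) × ℝⁿ)`. -/
def MemL2Hm {n N : ℕ} (m : ℕ) (T : ℝ) (u : ℝ × Sp n → St N) : Prop :=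
  ∀ γ : Fin n → ℕ, ∑ i, γ i ≤ m →
    ∃ g, HasWeakDerivOn (spaceDir n) (Ioo 0 T ×ˢ univ) γ u g ∧
      MemLp g 2 (volume.restrict (Ioo 0 T ×ˢ univ))

/-- The spatial gradient `∇^m u` on the half-space. -/
def spatialGrad {n N : ℕ} (m : ℕ) (u : ℝ × Sp n → St N) : ℝ × Sp n → Grad n m N :=
  weakGrad (spaceDir n) (halfSpace n) m u

/-- Global weak solutions of `∂_t u = (-1)^{m+1} div_m A ∇^m u`. -/
def IsGlobalWeakSolution {n m N : ℕ} (A : Coeff n m N) (u : ℝ × Sp n → St N) : Prop :=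
  MemL2HmLoc m u ∧
    ∀ φ : ℝ × Sp n → St N, IsTestFunction (halfSpace n) φ →
      ∫ p in halfSpace n, ∑ i, u p i * starRingEnd ℂ (fderiv ℝ φ p (1, 0) i) =
        ∫ p in halfSpace n, coeffForm (A p) (spatialGrad m u p) (classicalGrad (spaceDir n) m φ p)

/-- `v` is the representative of `u` in `C((0,∞); L²_loc(ℝⁿ))`, which gives the meaning of
`u(t,·)` for every `t > 0`. -/
def IsContinuousRep {n N : ℕ} (u : ℝ × Sp n → St N) (v : ℝ → Sp n → St N) : Prop :=
  (∀ᵐ t ∂(volume.restrict (Ioi (0 : ℝ))), v t =ᵐ[volume] fun x => u (t, x)) ∧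
    ∀ K : Set (Sp n), IsCompact K → ∀ t : ℝ, 0 < t →
      MemLp (v t) 2 (volume.restrict K) ∧
        Tendsto (fun s => eLpNorm (v s - v t) 2 (volume.restrict K)) (𝓝 t) (𝓝 0)

/-- `u₀ ∈ L¹_loc(ℝⁿ)` is the trace of `u` at `t = 0`: `u(t,·) → u₀` in `L¹(K)` as `t → 0`, for
every compact `K`. -/
def HasTrace {n N : ℕ} (u : ℝ × Sp n → St N) (u₀ : Sp n → St N) : Prop :=
  LocallyIntegrable u₀ ∧ ∃ v, IsContinuousRep u v ∧
    ∀ K : Set (Sp n), IsCompact K →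
      Tendsto (fun t => eLpNorm (v t - u₀) 1 (volume.restrict K)) (𝓝[>] 0) (𝓝 0)

/-- `u ∈ X` is a global weak solution with trace `u₀`. -/
def SolvesCauchy {n m N : ℕ} (A : Coeff n m N) (X : Set (ℝ × Sp n → St N))
    (u₀ : Sp n → St N) (u : ℝ × Sp n → St N) : Prop :=
  IsGlobalWeakSolution A u ∧ u ∈ X ∧ HasTrace u u₀

/-- Well-posedness of the Cauchy problem for the pair `(Y, X)` of classes of functions with
seminorms `normY`, `normX`: every weak solution in `X` has a trace, every initial datum in `Y` has
one and only one solution in `X` (up to null sets), and the solution is controlled by its datum. -/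
def IsWellPosed {n m N : ℕ} (A : Coeff n m N)
    (Y : Set (Sp n → St N)) (normY : (Sp n → St N) → ℝ≥0∞)
    (X : Set (ℝ × Sp n → St N)) (normX : (ℝ × Sp n → St N) → ℝ≥0∞) : Prop :=
  (∀ u ∈ X, IsGlobalWeakSolution A u → ∃ u₀, HasTrace u u₀) ∧
  (∀ u₀ ∈ Y, ∃ u, SolvesCauchy A X u₀ u ∧
    ∀ u', SolvesCauchy A X u₀ u' → u' =ᵐ[volume.restrict (halfSpace n)] u) ∧
  (∃ C : ℝ≥0, 0 < C ∧ ∀ u₀ ∈ Y, ∀ u, SolvesCauchy A X u₀ u → normX u ≤ C * normY u₀)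

/-- The data space `L²(ℝⁿ; ℂ^N)`. -/
def dataL2 (n N : ℕ) : Set (Sp n → St N) := {f | MemLp f 2 volume}

/-- The `L²(ℝⁿ)` norm. -/
def normL2 {n N : ℕ} (f : Sp n → St N) : ℝ≥0∞ := eLpNorm f 2 volume

/-- The energy class of those `u` on the half-space with `∇^m u ∈ L²` there. (Weak solutions are
locally integrable functions, so that only such members of the class play a role.) -/
def energyClass (n m N : ℕ) : Set (ℝ × Sp n → St N) :=
  {u | LocallyIntegrableOn u (halfSpace n) ∧ HasL2Grad (spaceDir n) (halfSpace n) m u}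

/-- The seminorm `‖∇^m u‖_{L²(L²)}` of the energy class. -/
def normGrad {n N : ℕ} (m : ℕ) (u : ℝ × Sp n → St N) : ℝ≥0∞ :=
  eLpNorm (spatialGrad m u) 2 (volume.restrict (halfSpace n))

/-- The norm `‖u‖_{L^∞(0,∞; L²(ℝⁿ))}`. -/
def normLinftyL2 {n N : ℕ} (u : ℝ × Sp n → St N) : ℝ≥0∞ :=
  essSup (fun t => normL2 fun x => u (t, x)) (volume.restrict (Ioi (0 : ℝ)))

end ParabolicCauchy

end

open ParabolicCauchy

noncomputable section

set_option linter.unusedSectionVars false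
set_option linter.unusedVariables false

namespace ParabolicCauchy

/-! ### Calculus for primitives of integrable vector-valued curves. -/

section TimeCalculus

/-! Everything is transported to the Fourier side in `x`. Let `ρ(ξ) ≥ 0` be the length of the symbol
of `∇^m`, and let `R` (`riesz`) be the isometry of `L²` into `L²` gradients with symbol `sym α / ρ`.
If `C(t)` is the Fourier transform of `u(t,·)` and `d = ρ C`, then `∇^m u = R d` and `‖∇^m u‖ =
‖d‖`, and the equation becomes `C' = -ρ h` with `h = R† A R d` (`energyOp`). The Gårding inequality
says `Re ⟨h, d⟩ ≥ lam ‖d‖²`, and boundedness of `A` gives `Re ⟨h, d⟩ ≤ Lam ‖d‖²`.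

A solution in the energy class provides only `d` in `L²(0,∞; L²)`; neither `u` nor `C` is known to
be in `L²`. The bounded multipliers `a = ρ²/(1+ρ²)`, `b = 1/(1+ρ²)`, `σ = ρ/(1+ρ²)` (`MultSystem`,
`rhoSystem`) avoid the unbounded `ρ`: the equation reads `(b d)' = -a h`, so `Y = b d` is a
primitive, and `C` should be `σ⁻¹ Y`. Since `a b = σ²`, a bounded multiplier `q` gives `‖q Y(t)‖² =
2 ∫_t^∞ Re ⟨q σ h, q σ d⟩`; there is no term at infinity because `‖q Y‖²` is integrable. For
differences of approximations `Q k` of `σ⁻¹` the right side is small uniformly in `t`, so `Q k Y`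
converges uniformly to a continuous curve `C` with `‖C(t)‖² = 2 ∫_t^∞ Re ⟨h, d⟩`
(`MultSystem.exists_isSolution`). This identity carries the theorem: it gives continuity up to `t =
0`, decay at infinity, monotonicity, and `2 lam ‖d‖² ≤ ‖C(0)‖² ≤ 2 Lam ‖d‖²`. It also gives
uniqueness, because the difference of two solutions solves the same equation with zero initial
value.

Existence is Lions' representation theorem (`exists_inner_eq_of_bound`,
`MultSystem.exists_weak_solution`): the dual operator `w ↦ T† a w - b w'` on curves is bounded below
through coercivity, and its boundary term at `0` controls the functional that encodes the datum.

It remains to translate. A weak solution has a gradient in the range of `R`, since derivatives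
commute (`riesz_rieszAdj_gradCurve`), and satisfies `(b d)' = -a h`
(`integral_deriv_smul_energyCurve`); conversely the function with slices `𝓕⁻¹ C(t)` is a weak
solution (`IsEnergySolution.isGlobalWeakSolution`). Two solutions with the same gradient differ by a
function `q(x)` all of whose derivatives of order `m` vanish (`IsGlobalWeakSolution.exists_eq_add`).
Hence the trace is `𝓕⁻¹ C(0) + q`; if it is in `L²`, then so is `q`, and `q = 0` because its Fourier
transform is carried by the origin. -/

theorem absolutelyContinuousOnInterval_of_dist_le {X Y : Type*} [PseudoMetricSpace X]
    [PseudoMetricSpace Y] {f : ℝ → X} {g : ℝ → Y} {a b C : ℝ}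
    (h : ∀ s ∈ uIcc a b, ∀ t ∈ uIcc a b, dist (f s) (f t) ≤ C * dist (g s) (g t))
    (hg : AbsolutelyContinuousOnInterval g a b) : AbsolutelyContinuousOnInterval f a b := by
  have h2 : Tendsto (fun E : ℕ × (ℕ → ℝ × ℝ) =>
      C * ∑ i ∈ Finset.range E.1, dist (g (E.2 i).1) (g (E.2 i).2))
      (AbsolutelyContinuousOnInterval.totalLengthFilter ⊓
        𝓟 (AbsolutelyContinuousOnInterval.disjWithin a b)) (𝓝 0) := by
    simpa using Tendsto.const_mul C hg
  refine squeeze_zero' (Eventually.of_forall fun E => by positivity) ?_ h2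
  have : ∀ᶠ E in AbsolutelyContinuousOnInterval.totalLengthFilter ⊓
        𝓟 (AbsolutelyContinuousOnInterval.disjWithin a b),
      E ∈ AbsolutelyContinuousOnInterval.disjWithin a b :=
    mem_inf_of_right (mem_principal_self _)
  filter_upwards [this] with E hE
  rw [Finset.mul_sum]
  exact Finset.sum_le_sum fun i hi => h _ (hE.1 i hi).1 _ (hE.1 i hi).2

variable {E F G : Type*} [NormedAddCommGroup E] [NormedSpace ℝ E] [CompleteSpace E]
  [NormedAddCommGroup F] [NormedSpace ℝ F] [CompleteSpace F]
  [NormedAddCommGroup G] [NormedSpace ℝ G] [CompleteSpace G]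

theorem intervalIntegrable_bilin (B : E →L[ℝ] F →L[ℝ] G) {f : ℝ → E} {g : ℝ → F} {a b : ℝ}
    (hf : IntervalIntegrable f volume a b) (hg : ContinuousOn g (uIcc a b)) :
    IntervalIntegrable (fun t => B (f t) (g t)) volume a b := by
  obtain ⟨M, hM⟩ := isCompact_uIcc.exists_bound_of_continuousOn hg
  have hgm : AEStronglyMeasurable g (volume.restrict (uIoc a b)) :=
    (hg.mono uIoc_subset_uIcc).aestronglyMeasurable measurableSet_uIoc
  rw [intervalIntegrable_iff] at hf ⊢
  refine Integrable.mono' (hf.norm.const_mul (‖B‖ * M))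
    (B.aestronglyMeasurable_comp₂ hf.aestronglyMeasurable hgm) ?_
  filter_upwards [ae_restrict_mem measurableSet_uIoc] with t ht
  calc ‖B (f t) (g t)‖ ≤ ‖B‖ * ‖f t‖ * ‖g t‖ := B.le_opNorm₂ _ _
    _ ≤ ‖B‖ * ‖f t‖ * M := by gcongr; exact hM t (uIoc_subset_uIcc ht)
    _ = ‖B‖ * M * ‖f t‖ := by ring

theorem continuousOn_of_eq_integral {f f' : ℝ → E} {a b : ℝ} (hab : a ≤ b)
    (hf' : IntervalIntegrable f' volume a b)
    (hf : ∀ t ∈ Icc a b, f t = f a + ∫ s in a..t, f' s) : ContinuousOn f (Icc a b) := by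
  have h1 : ContinuousOn (fun t => f a + ∫ s in a..t, f' s) (Icc a b) := by
    have := intervalIntegral.continuousOn_primitive_interval' hf' left_mem_uIcc
    rw [uIcc_of_le hab] at this
    exact continuousOn_const.add this
  exact h1.congr hf

theorem ae_hasDerivAt_of_eq_integral {f f' : ℝ → E} {a b : ℝ} (hab : a ≤ b)
    (hf' : IntervalIntegrable f' volume a b)
    (hf : ∀ t ∈ Icc a b, f t = f a + ∫ s in a..t, f' s) :
    ∀ᵐ t, t ∈ Ioo a b → HasDerivAt f (f' t) t := by
  filter_upwards [hf'.ae_hasDerivAt_integral] with t ht htI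
  have h1 := ht (by rw [uIcc_of_le hab]; exact Ioo_subset_Icc_self htI) a left_mem_uIcc
  refine (h1.const_add (f a)).congr_of_eventuallyEq ?_
  filter_upwards [Ioo_mem_nhds htI.1 htI.2] with s hs using hf s (Ioo_subset_Icc_self hs)

/-- One scalar primitive of a common majorant `n` controls the increments of several curves at once,
which is what an absolute continuity estimate for their products needs. -/
theorem norm_sub_le_dist_integral {v v' : ℝ → E} {n : ℝ → ℝ} {a b : ℝ}
    (hv' : IntervalIntegrable v' volume a b) (hni : IntervalIntegrable n volume a b)
    (hv : ∀ t ∈ Icc a b, v t = v a + ∫ s in a..t, v' s) (hle : ∀ t, ‖v' t‖ ≤ n t)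
    {s t : ℝ} (hs : s ∈ Icc a b) (ht : t ∈ Icc a b) (hst : s ≤ t) :
    ‖v t - v s‖ ≤ dist (∫ x in a..s, n x) (∫ x in a..t, n x) := by
  have hab : a ≤ b := hs.1.trans hs.2
  have sub : ∀ s ∈ Icc a b, ∀ t ∈ Icc a b, uIcc s t ⊆ uIcc a b := by
    intro s hs t ht
    rw [uIcc_of_le hab]; exact uIcc_subset_Icc hs ht
  have i1 : ∀ x ∈ Icc a b, IntervalIntegrable v' volume a x := fun x hx =>
    hv'.mono_set (sub a (left_mem_Icc.2 hab) x hx)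
  have i2 : ∀ x ∈ Icc a b, IntervalIntegrable n volume a x := fun x hx =>
    hni.mono_set (sub a (left_mem_Icc.2 hab) x hx)
  rw [hv t ht, hv s hs, add_sub_add_left_eq_sub,
    intervalIntegral.integral_interval_sub_left (i1 t ht) (i1 s hs), dist_comm, Real.dist_eq,
    intervalIntegral.integral_interval_sub_left (i2 t ht) (i2 s hs)]
  refine le_trans ?_ (le_abs_self _)
  refine (intervalIntegral.norm_integral_le_integral_norm hst).trans ?_
  exact intervalIntegral.integral_mono_on hst (hv'.mono_set (sub s hs t ht)).norm
    (hni.mono_set (sub s hs t ht)) (fun x _ => hle x)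

/-- Integration by parts for a bounded bilinear map and two primitives of integrable functions. -/
theorem integral_bilin_deriv (B : E →L[ℝ] F →L[ℝ] G) {f f' : ℝ → E} {g g' : ℝ → F} {a b : ℝ}
    (hab : a ≤ b) (hf' : IntervalIntegrable f' volume a b)
    (hg' : IntervalIntegrable g' volume a b)
    (hf : ∀ t ∈ Icc a b, f t = f a + ∫ s in a..t, f' s)
    (hg : ∀ t ∈ Icc a b, g t = g a + ∫ s in a..t, g' s) :
    ∫ t in a..b, (B (f' t) (g t) + B (f t) (g' t)) = B (f b) (g b) - B (f a) (g a) := by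
  have fc := continuousOn_of_eq_integral hab hf' hf
  have gc := continuousOn_of_eq_integral hab hg' hg
  have hk1 : IntervalIntegrable (fun t => B (f' t) (g t)) volume a b :=
    intervalIntegrable_bilin B hf' (by rwa [uIcc_of_le hab])
  have hk2 : IntervalIntegrable (fun t => B (f t) (g' t)) volume a b :=
    intervalIntegrable_bilin B.flip hg' (by rwa [uIcc_of_le hab])
  set k := fun t => B (f' t) (g t) + B (f t) (g' t) with hk
  have hki : IntervalIntegrable k volume a b := hk1.add hk2
  set n : ℝ → ℝ := fun t => ‖f' t‖ + ‖g' t‖ + ‖k t‖ with hn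
  have hni : IntervalIntegrable n volume a b := (hf'.norm.add hg'.norm).add hki.norm
  obtain ⟨M, hM⟩ := isCompact_Icc.exists_bound_of_continuousOn fc
  obtain ⟨M', hM'⟩ := isCompact_Icc.exists_bound_of_continuousOn gc
  have hM0 : 0 ≤ M := (norm_nonneg _).trans (hM a (left_mem_Icc.2 hab))
  have hM0' : 0 ≤ M' := (norm_nonneg _).trans (hM' a (left_mem_Icc.2 hab))
  -- The product rule holds only at almost every time. The defect `h` is absolutely continuous with
  -- derivative zero almost everywhere, hence constant.
  set h : ℝ → G := fun t => B (f t) (g t) - ∫ s in a..t, k s with hh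
  have hac : AbsolutelyContinuousOnInterval h a b := by
    refine absolutelyContinuousOnInterval_of_dist_le (C := ‖B‖ * M' + ‖B‖ * M + 1)
      (g := fun t => ∫ x in a..t, n x) ?_
      (hni.absolutelyContinuousOnInterval_intervalIntegral left_mem_uIcc)
    rw [uIcc_of_le hab]
    have main : ∀ s ∈ Icc a b, ∀ t ∈ Icc a b, s ≤ t → dist (h s) (h t) ≤
        (‖B‖ * M' + ‖B‖ * M + 1) * dist (∫ x in a..s, n x) (∫ x in a..t, n x) := by
      intro s hs t ht hst
      have e1 := norm_sub_le_dist_integral hf' hni hf (fun t => by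
        have := norm_nonneg (g' t); have := norm_nonneg (k t); simp only [hn]; linarith) hs ht hst
      have e2 := norm_sub_le_dist_integral hg' hni hg (fun t => by
        have := norm_nonneg (f' t); have := norm_nonneg (k t); simp only [hn]; linarith) hs ht hst
      have e3 := norm_sub_le_dist_integral (v := fun t => ∫ x in a..t, k x) hki hni (fun t _ => by simp) (fun t => by
        have := norm_nonneg (f' t); have := norm_nonneg (g' t); simp only [hn]; linarith) hs ht hst
      have e4 : h t - h s = B (f t - f s) (g t) + B (f s) (g t - g s)
          - ((∫ x in a..t, k x) - ∫ x in a..s, k x) := by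
        simp only [hh, map_sub, sub_apply]; abel
      set D := dist (∫ x in a..s, n x) (∫ x in a..t, n x)
      rw [dist_comm, dist_eq_norm, e4]
      calc _ ≤ ‖B (f t - f s) (g t)‖ + ‖B (f s) (g t - g s)‖ +
            ‖(∫ x in a..t, k x) - ∫ x in a..s, k x‖ :=
            (norm_sub_le _ _).trans (by gcongr; exact norm_add_le _ _)
        _ ≤ ‖B‖ * D * M' + ‖B‖ * M * D + D := by
            gcongr
            · refine (B.le_opNorm₂ _ _).trans ?_
              gcongr
              exact hM' t ht
            · refine (B.le_opNorm₂ _ _).trans ?_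
              gcongr
              exact hM s hs
        _ = _ := by ring
    intro s hs t ht
    rcases le_total s t with hst | hst
    · exact main s hs t ht hst
    · rw [dist_comm, dist_comm (∫ x in a..s, n x)]; exact main t ht s hs hst
  obtain ⟨c, hc⟩ := hac.const_of_ae_hasDerivAt_zero (by
    have n1 : ∀ᵐ t : ℝ, t ≠ a := by simp [ae_iff, measure_singleton]
    have n2 : ∀ᵐ t : ℝ, t ≠ b := by simp [ae_iff, measure_singleton]
    filter_upwards [ae_hasDerivAt_of_eq_integral hab hf' hf,
      ae_hasDerivAt_of_eq_integral hab hg' hg, hki.ae_hasDerivAt_integral, n1, n2]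
      with t h1 h2 h3 h4 h5 ht
    have ht' : t ∈ Ioo a b := by
      rw [uIcc_of_le hab] at ht
      exact ⟨lt_of_le_of_ne ht.1 (Ne.symm h4), lt_of_le_of_ne ht.2 h5⟩
    have d1 := B.hasFDerivAt_of_bilinear (h1 ht').hasFDerivAt (h2 ht').hasFDerivAt
    have d2 := d1.hasDerivAt.sub (h3 ht a left_mem_uIcc)
    refine d2.congr_deriv ?_
    simp [hk, add_comm, ContinuousLinearMap.precompR, ContinuousLinearMap.precompL])
  have h1 := hc b right_mem_uIcc
  have h2 := hc a left_mem_uIcc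
  simp only [hh, intervalIntegral.integral_same, sub_zero] at h1 h2
  rw [h2, ← h1]; abel

theorem exists_isTestFunction_integral_eq_one :
    ∃ θ : ℝ → ℝ, IsTestFunction (Ioi 0) θ ∧ ∫ t, θ t = 1 := by
  let f : ContDiffBump (2 : ℝ) := ⟨1 / 2, 1, by norm_num, by norm_num⟩
  refine ⟨f.normed volume, ⟨f.contDiff_normed, f.hasCompactSupport_normed, ?_⟩, f.integral_normed⟩
  rw [f.tsupport_normed_eq]
  intro x hx
  rw [Metric.mem_closedBall, Real.dist_eq] at hx
  have : f.rOut = 1 := rfl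
  rw [this, abs_le] at hx
  simp only [mem_Ioi]; linarith [hx.1]

theorem IsTestFunction.continuous {E F : Type*} [NormedAddCommGroup E] [NormedSpace ℝ E]
    [NormedAddCommGroup F] [NormedSpace ℝ F] {Q : Set E} {φ : E → F} (h : IsTestFunction Q φ) :
    Continuous φ := h.1.continuous

/-- A test function on the half-line vanishes off a compact interval. -/
theorem IsTestFunction.exists_Icc {θ : ℝ → ℝ} (h : IsTestFunction (Ioi 0) θ) :
    ∃ a b, 0 < a ∧ a < b ∧ tsupport θ ⊆ Icc a b := by
  rcases (tsupport θ).eq_empty_or_nonempty with he | hne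
  · exact ⟨1, 2, by norm_num, by norm_num, by simp [he]⟩
  · have hc : IsCompact (tsupport θ) := h.2.1
    obtain ⟨a, ha, ha'⟩ := hc.exists_isLeast hne
    obtain ⟨b, hb, hb'⟩ := hc.exists_isGreatest hne
    refine ⟨a, b + 1, h.2.2 ha, by linarith [ha' hb], fun x hx => ⟨ha' hx, by linarith [hb' hx]⟩⟩

/-- Vanishing mean is exactly what makes the primitive vanish to the right of the support. -/
theorem IsTestFunction.primitive {θ : ℝ → ℝ} (h : IsTestFunction (Ioi 0) θ)
    (h0 : ∫ t, θ t = 0) :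
    IsTestFunction (Ioi 0) (fun t => ∫ s in (0 : ℝ)..t, θ s) ∧
      ∀ t, HasDerivAt (fun t => ∫ s in (0 : ℝ)..t, θ s) (θ t) t := by
  have hd : ∀ t, HasDerivAt (fun t => ∫ s in (0 : ℝ)..t, θ s) (θ t) t := fun t =>
    intervalIntegral.integral_hasDerivAt_right (h.continuous.intervalIntegrable _ _)
      h.continuous.stronglyMeasurable.stronglyMeasurableAtFilter h.continuous.continuousAt
  obtain ⟨a, b, ha, hab, hs⟩ := h.exists_Icc
  have hz : ∀ t, t ∉ Icc a b → θ t = 0 := fun t ht =>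
    image_eq_zero_of_notMem_tsupport fun h' => ht (hs h')
  have hsupp : tsupport (fun t => ∫ s in (0 : ℝ)..t, θ s) ⊆ Icc a b := by
    refine closure_minimal ?_ isClosed_Icc
    intro t ht
    by_contra hc
    apply ht
    rcases lt_or_ge t a with h1 | h1
    · apply intervalIntegral.integral_zero_ae
      refine Eventually.of_forall fun s hs => hz s fun h' => ?_
      have : s ≤ max 0 t := by
        rw [uIoc] at hs; exact hs.2
      have := h'.1
      have : max 0 t < a := max_lt ha h1
      linarith
    · have h2 : b < t := by
        by_contra h3; exact hc ⟨h1, not_lt.1 h3⟩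
      change ∫ s in (0 : ℝ)..t, θ s = 0
      rw [← h0, intervalIntegral.integral_of_le (by linarith)]
      refine setIntegral_eq_integral_of_forall_compl_eq_zero fun s hs => hz s fun h' => hs ?_
      exact ⟨by linarith [h'.1], by linarith [h'.2]⟩
  refine ⟨⟨?_, HasCompactSupport.of_support_subset_isCompact isCompact_Icc
    ((subset_tsupport _).trans hsupp), hsupp.trans fun x hx => lt_of_lt_of_le ha hx.1⟩, hd⟩
  rw [contDiff_infty_iff_deriv]
  refine ⟨fun t => (hd t).differentiableAt, ?_⟩
  have : deriv (fun t => ∫ s in (0 : ℝ)..t, θ s) = θ := funext fun t => (hd t).deriv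
  rw [this]; exact h.1

theorem integral_smul_eq_setIntegral_Ioi {θ : ℝ → ℝ} (h : tsupport θ ⊆ Ioi 0) (y : ℝ → E) :
    ∫ t, θ t • y t = ∫ t in Ioi 0, θ t • y t := by
  symm
  refine setIntegral_eq_integral_of_forall_compl_eq_zero fun s hs => ?_
  rw [image_eq_zero_of_notMem_tsupport fun h' => hs (h h'), zero_smul]

theorem IsTestFunction.deriv {θ : ℝ → ℝ} {Q : Set ℝ} (h : IsTestFunction Q θ) :
    IsTestFunction Q (deriv θ) :=
  ⟨(contDiff_infty_iff_deriv.1 h.1).2, h.2.1.deriv, (tsupport_deriv_subset).trans h.2.2⟩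

theorem IsTestFunction.integrable_smul {Y : Type*} [NormedAddCommGroup Y] [NormedSpace ℝ Y]
    [MeasurableSpace Y] [BorelSpace Y] {Q : Set Y} [SecondCountableTopology Y]
    [LocallyCompactSpace Y] {μ : Measure Y}
    {θ : Y → ℝ} (h : IsTestFunction Q θ) (hQ : IsOpen Q) {y : Y → E}
    (hy : LocallyIntegrableOn y Q μ) :
    Integrable (fun t => θ t • y t) μ := by
  have h1 : IntegrableOn y (tsupport θ) μ :=
    (hy.mono_set h.2.2).integrableOn_isCompact h.2.1
  have h2 : IntegrableOn (fun t => θ t • y t) (tsupport θ) μ :=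
    h1.continuousOn_smul h.continuous.continuousOn h.2.1
  rw [← integrableOn_iff_integrable_of_support_subset (s := tsupport θ)]
  · exact h2
  · intro t ht
    apply subset_tsupport
    intro h0; apply ht; simp [h0]

/-- The lemma of du Bois-Reymond: a function on the half-line with a weak derivative that is
integrable up to `0` is a primitive. -/
theorem exists_eq_add_integral_of_weak_deriv {y z : ℝ → E} (hy : LocallyIntegrableOn y (Ioi 0))
    (hz : ∀ T, 0 ≤ T → IntervalIntegrable z volume 0 T)
    (h : ∀ θ : ℝ → ℝ, IsTestFunction (Ioi 0) θ →
      ∫ t in Ioi 0, deriv θ t • y t = - ∫ t in Ioi 0, θ t • z t) :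
    ∃ c, ∀ᵐ t ∂(volume.restrict (Ioi (0 : ℝ))), y t = c + ∫ s in (0 : ℝ)..t, z s := by
  set Z : ℝ → E := fun t => ∫ s in (0 : ℝ)..t, z s with hZ
  have hZc : ContinuousOn Z (Ioi 0) := by
    intro t ht
    have ht : 0 < t := ht
    have := continuousOn_of_eq_integral (f := Z) (f' := z) (a := 0) (b := t + 1) (by linarith)
      (hz _ (by linarith)) (fun s _ => by simp [hZ])
    exact (this.continuousAt (Icc_mem_nhds ht (by linarith))).continuousWithinAt
  have hZl : LocallyIntegrableOn Z (Ioi 0) := hZc.locallyIntegrableOn measurableSet_Ioi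
  have hel : LocallyIntegrableOn (fun t => y t - Z t) (Ioi 0) := hy.sub hZl
  -- Subtracting the primitive `Z` of `z` reduces the claim to weak derivative zero.
  have h1 : ∀ θ : ℝ → ℝ, IsTestFunction (Ioi 0) θ → ∫ t, deriv θ t • (y t - Z t) = 0 := by
    intro θ hθ
    obtain ⟨a, b, ha, hab, hs⟩ := hθ.exists_Icc
    have hz0 : ∀ t, t ∉ Icc a b → θ t = 0 := fun t ht =>
      image_eq_zero_of_notMem_tsupport fun h' => ht (hs h')
    have hz1 : ∀ t, t ∉ Icc a b → deriv θ t = 0 := fun t ht =>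
      image_eq_zero_of_notMem_tsupport fun h' => ht (hs (tsupport_deriv_subset h'))
    have hb : (0 : ℝ) ≤ b + 1 := by linarith
    have red : ∀ (η : ℝ → ℝ) (w : ℝ → E), (∀ t, t ∉ Icc a b → η t = 0) →
        ∫ t, η t • w t = ∫ t in (0 : ℝ)..(b + 1), η t • w t := by
      intro η w hη
      rw [intervalIntegral.integral_of_le hb]
      symm
      refine setIntegral_eq_integral_of_forall_compl_eq_zero fun s hs => ?_
      rw [hη s (fun h' => hs ⟨by linarith [h'.1], by linarith [h'.2]⟩), zero_smul]
    have ibp := integral_bilin_deriv (ContinuousLinearMap.lsmul ℝ ℝ : ℝ →L[ℝ] E →L[ℝ] E)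
      (f := θ) (f' := deriv θ) (g := Z) (g' := z) hb
      (hθ.deriv.continuous.intervalIntegrable _ _) (hz _ hb)
      (fun t _ => by
        rw [intervalIntegral.integral_deriv_eq_sub
          (fun x _ => hθ.1.differentiable (by simp) x)
          (hθ.deriv.continuous.intervalIntegrable _ _)]; abel)
      (fun t _ => by simp [hZ])
    have i1 : IntervalIntegrable (fun t => deriv θ t • Z t) volume 0 (b + 1) :=
      (hθ.deriv.integrable_smul isOpen_Ioi hZl).intervalIntegrable
    have i2 : IntervalIntegrable (fun t => θ t • z t) volume 0 (b + 1) :=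
      (hz _ hb).continuousOn_smul hθ.continuous.continuousOn
    simp only [ContinuousLinearMap.lsmul_apply] at ibp
    rw [intervalIntegral.integral_add i1 i2,
      hz0 (b + 1) (fun h' => by linarith [h'.2]), hz0 0 (fun h' => by linarith [h'.1]),
      ← red _ _ hz1, ← red _ _ hz0] at ibp
    simp only [zero_smul, sub_zero] at ibp
    simp only [smul_sub]
    rw [integral_sub (hθ.deriv.integrable_smul isOpen_Ioi hy)
      (hθ.deriv.integrable_smul isOpen_Ioi hZl), integral_smul_eq_setIntegral_Ioi hθ.deriv.2.2,
      h θ hθ, ← integral_smul_eq_setIntegral_Ioi hθ.2.2, eq_neg_of_add_eq_zero_left ibp]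
    simp
  obtain ⟨θ₀, hθ₀, hθ₀1⟩ := exists_isTestFunction_integral_eq_one
  set c := ∫ t, θ₀ t • (y t - Z t) with hc
  refine ⟨c, ?_⟩
  have h2 : ∀ᵐ t, t ∈ Ioi (0 : ℝ) → (y t - Z t) - c = 0 := by
    refine IsOpen.ae_eq_zero_of_integral_contDiff_smul_eq_zero isOpen_Ioi
      (hel.sub ((continuousOn_const).locallyIntegrableOn measurableSet_Ioi)) ?_
    intro θ t1 t2 t3
    have hθ : IsTestFunction (Ioi 0) θ := ⟨t1, t2, t3⟩
    -- Correcting `θ` by a multiple of `θ₀` gives mean zero, hence the derivative of a test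
    -- function, which `y - Z` does not see. So `y - Z` pairs with `θ` like the constant `c`.
    have hη : IsTestFunction (Ioi 0) (fun t => θ t - (∫ s, θ s) * θ₀ t) := by
      refine ⟨hθ.1.sub (contDiff_const.mul hθ₀.1), hθ.2.1.sub hθ₀.2.1.mul_left, ?_⟩
      refine (tsupport_sub _ _).trans (union_subset hθ.2.2 ?_)
      exact (tsupport_mul_subset_right).trans hθ₀.2.2
    have iθ : Integrable θ := hθ.continuous.integrable_of_hasCompactSupport hθ.2.1
    have iθ₀ : Integrable θ₀ := hθ₀.continuous.integrable_of_hasCompactSupport hθ₀.2.1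
    obtain ⟨p1, p2⟩ := hη.primitive (by
      rw [integral_sub iθ (iθ₀.const_mul _), integral_const_mul, hθ₀1]; ring)
    have p3 := h1 _ p1
    simp only [fun t => (p2 t).deriv, sub_smul, mul_smul] at p3
    have e0 : Integrable (fun t => (∫ s, θ s) • θ₀ t • (y t - Z t)) :=
      (hθ₀.integrable_smul isOpen_Ioi hel).smul _
    rw [integral_sub (hθ.integrable_smul isOpen_Ioi hel) e0, integral_smul, ← hc] at p3
    simp only [smul_sub] at p3 ⊢
    have e1 : Integrable (fun t => θ t • (y t - Z t)) := hθ.integrable_smul isOpen_Ioi hel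
    simp only [smul_sub] at e1
    rw [integral_sub e1 (iθ.smul_const c), integral_smul_const]
    exact p3
  rw [ae_restrict_iff' measurableSet_Ioi]
  filter_upwards [h2] with t ht htI
  have := ht htI
  rw [sub_eq_zero] at this
  rw [← this]; abel

end TimeCalculus

/-! ### The abstract evolution equation and its energy identity. -/

section Abstract

variable {α : Type*} [MeasurableSpace α] {μ : Measure α}
variable {H : Type*} [NormedAddCommGroup H] [InnerProductSpace ℂ H] [CompleteSpace H]

theorem integrable_norm_sq {E : Type*} [NormedAddCommGroup E] {f : α → E} (hf : MemLp f 2 μ) :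
    Integrable (fun t => ‖f t‖ ^ 2) μ :=
  (memLp_two_iff_integrable_sq_norm hf.1).1 hf

theorem integrable_inner {f g : α → H} (hf : MemLp f 2 μ) (hg : MemLp g 2 μ) :
    Integrable (fun t => inner ℂ (f t) (g t)) μ := by
  refine Integrable.mono' ((integrable_norm_sq hf).add (integrable_norm_sq hg))
    (hf.1.inner hg.1) (Eventually.of_forall fun t => ?_)
  refine (norm_inner_le_norm (f t) (g t)).trans ?_
  simp only [Pi.add_apply]
  nlinarith [sq_nonneg (‖f t‖ - ‖g t‖), sq_nonneg (‖f t‖), sq_nonneg (‖g t‖)]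

theorem integrable_re_inner {f g : α → H} (hf : MemLp f 2 μ) (hg : MemLp g 2 μ) :
    Integrable (fun t => (inner ℂ (f t) (g t)).re) μ :=
  (integrable_inner hf hg).re

variable (H) in
/-- The real part of the inner product as a bounded real bilinear map. -/
def reInner : H →L[ℝ] H →L[ℝ] ℝ :=
  LinearMap.mkContinuous₂
    (LinearMap.mk₂ ℝ (fun x y : H => (inner ℂ x y).re)
      (fun x y z => by rw [inner_add_left, Complex.add_re])
      (fun c x y => by rw [← Complex.coe_smul, inner_smul_left]; simp)
      (fun x y z => by rw [inner_add_right, Complex.add_re])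
      (fun c x y => by rw [← Complex.coe_smul, inner_smul_right]; simp)) 1
    (fun x y => by
      rw [LinearMap.mk₂_apply, one_mul, Real.norm_eq_abs]
      exact (Complex.abs_re_le_norm _).trans (norm_inner_le_norm x y))

@[simp]
theorem reInner_apply (x y : H) : reInner H x y = (inner ℂ x y).re := rfl

variable (H) in
/-- Commuting self-adjoint operators modelling multiplication by `ρ²/(1+ρ²)`, `1/(1+ρ²)` and
`ρ/(1+ρ²)` for some `ρ ≥ 0`, and by an approximation `Q k` of `(1+ρ²)/ρ`. -/
structure MultSystem where
  a : H →L[ℂ] H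
  b : H →L[ℂ] H
  σ : H →L[ℂ] H
  Q : ℕ → H →L[ℂ] H
  a_sa : ∀ x y, inner ℂ (a x) y = inner ℂ x (a y)
  b_sa : ∀ x y, inner ℂ (b x) y = inner ℂ x (b y)
  σ_sa : ∀ x y, inner ℂ (σ x) y = inner ℂ x (σ y)
  Q_sa : ∀ k x y, inner ℂ (Q k x) y = inner ℂ x (Q k y)
  ab : ∀ x, a (b x) = σ (σ x)
  ba : ∀ x, b (a x) = σ (σ x)
  Qa : ∀ k x, Q k (a x) = a (Q k x)
  Qσ : ∀ k x, Q k (σ x) = σ (Q k x)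
  bσ : ∀ x, b (σ x) = σ (b x)
  b_inj : ∀ x, b x = 0 → x = 0
  σ_inj : ∀ x, σ x = 0 → x = 0
  P_le : ∀ k x, ‖Q k (σ x)‖ ≤ ‖x‖
  P_tendsto : ∀ x, Tendsto (fun k => Q k (σ x)) atTop (𝓝 x)

namespace MultSystem

variable (M : MultSystem H)

/-- This is `a b = σ²`. It turns the pairing of the derivative `-a h` of `Y` with `Y = b d` into a
symmetric pairing of `h` and `d`. -/
theorem inner_a_b {q : H →L[ℂ] H} (q_sa : ∀ x y, inner ℂ (q x) y = inner ℂ x (q y))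
    (qa : ∀ x, q (M.a x) = M.a (q x)) (qσ : ∀ x, q (M.σ x) = M.σ (q x)) (x y : H) :
    inner ℂ (q (M.a x)) (q (M.b y)) = inner ℂ (q (M.σ x)) (q (M.σ y)) := by
  rw [q_sa, M.a_sa, q_sa (M.σ x), M.σ_sa, ← qa, ← qa, M.ab, ← qσ, ← qσ]

/-- The energy identity for the regularisation by `q`. -/
theorem norm_sq_eq_integral {q : H →L[ℂ] H} (q_sa : ∀ x y, inner ℂ (q x) y = inner ℂ x (q y))
    (qa : ∀ x, q (M.a x) = M.a (q x)) (qσ : ∀ x, q (M.σ x) = M.σ (q x))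
    {d h Y : ℝ → H} {c : H} (hd : MemLp d 2 (volume.restrict (Ioi 0)))
    (hh : MemLp h 2 (volume.restrict (Ioi 0)))
    (hY : ∀ t, Y t = c - ∫ s in (0 : ℝ)..t, M.a (h s))
    (hYd : ∀ᵐ t ∂(volume.restrict (Ioi (0 : ℝ))), Y t = M.b (d t)) {t : ℝ} (ht : 0 ≤ t) :
    ‖q (Y t)‖ ^ 2 = 2 * ∫ s in Ioi t, (inner ℂ (q (M.σ (h s))) (q (M.σ (d s)))).re := by
  set κ : ℝ → ℝ := fun s => (inner ℂ (q (M.σ (h s))) (q (M.σ (d s)))).re with hκ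
  have hκi : IntegrableOn κ (Ioi 0) :=
    integrable_re_inner ((q.comp M.σ).comp_memLp' hh) ((q.comp M.σ).comp_memLp' hd)
  have hah : ∀ s T : ℝ, 0 ≤ s → s ≤ T → IntervalIntegrable (fun s => M.a (h s)) volume s T := by
    intro s T hs hT
    rw [intervalIntegrable_iff_integrableOn_Ioc_of_le hT]
    have h1 : MemLp (fun s => M.a (h s)) 2 (volume.restrict (Ioc s T)) :=
      (M.a.comp_memLp' hh).mono_measure
        (Measure.restrict_mono (fun x hx => lt_of_le_of_lt hs hx.1) le_rfl)
    exact h1.integrable (by norm_num)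
  have key : ∀ T, t ≤ T → ‖q (Y T)‖ ^ 2 = ‖q (Y t)‖ ^ 2 - 2 * ∫ s in t..T, κ s := by
    intro T hT
    have hi := hah t T ht hT
    have hi' : IntervalIntegrable (fun s => - q (M.a (h s))) volume t T := by
      rw [intervalIntegrable_iff] at hi ⊢
      exact (q.integrable_comp hi).neg
    have e : ∀ s ∈ Icc t T, q (Y s) = q (Y t) + ∫ r in t..s, - q (M.a (h r)) := by
      intro s hs
      rw [intervalIntegral.integral_neg, ContinuousLinearMap.intervalIntegral_comp_comm q
        (hah t s ht hs.1), hY, hY t, map_sub, map_sub,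
        ← intervalIntegral.integral_add_adjacent_intervals (hah 0 t le_rfl ht) (hah t s ht hs.1),
        map_add]
      abel
    have := integral_bilin_deriv (reInner H) hT hi' hi' e e
    simp only [reInner_apply] at this
    have e2 : ∫ s in t..T, ((inner ℂ (-q (M.a (h s))) (q (Y s))).re +
        (inner ℂ (q (Y s)) (-q (M.a (h s)))).re) = ∫ s in t..T, (-2) * κ s := by
      refine intervalIntegral.integral_congr_ae ?_
      rw [ae_restrict_iff' measurableSet_Ioi] at hYd
      filter_upwards [hYd] with s hs hsI
      rw [uIoc_of_le hT] at hsI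
      rw [hs (lt_of_le_of_lt ht hsI.1), ← inner_conj_symm (q (M.b (d s))), Complex.conj_re,
        inner_neg_left, M.inner_a_b q_sa qa qσ, Complex.neg_re]
      simp only [hκ]; ring
    rw [e2, intervalIntegral.integral_const_mul] at this
    have n1 : ∀ x : H, (inner ℂ x x).re = ‖x‖ ^ 2 := fun x => inner_self_eq_norm_sq (𝕜 := ℂ) x
    rw [n1, n1] at this
    linarith
  have hlim : Tendsto (fun T => ‖q (Y T)‖ ^ 2) atTop
      (𝓝 (‖q (Y t)‖ ^ 2 - 2 * ∫ s in Ioi t, κ s)) := by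
    have := intervalIntegral_tendsto_integral_Ioi t (hκi.mono_set (Ioi_subset_Ioi ht)) tendsto_id
    refine ((this.const_mul 2).const_sub (‖q (Y t)‖ ^ 2)).congr' ?_
    filter_upwards [eventually_ge_atTop t] with T hT
    rw [key T hT]; rfl
  -- A function that is integrable near infinity and has a limit there has limit zero; integrability
  -- comes from `Y = b d` almost everywhere.
  have hint : IntegrableOn (fun T => ‖q (Y T)‖ ^ 2) (Ioi 0) := by
    refine (integrable_norm_sq ((q.comp M.b).comp_memLp' hd)).congr ?_
    filter_upwards [hYd] with s hs
    simp [hs]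
  have h0 := IntegrableAtFilter.eq_zero_of_tendsto (μ := volume)
    ⟨Ioi 0, Ioi_mem_atTop 0, hint⟩ (fun s hs => by
      obtain ⟨r, hr⟩ := mem_atTop_sets.1 hs
      exact top_unique (by rw [← Real.volume_Ici (a := r)]; exact measure_mono hr)) hlim
  linarith

/-- The hypothesis is `C' = -ρ h`, `d = ρ C`, multiplied by `σ` and written without `C`. The curve
`σ C` is a primitive by du Bois-Reymond, and `C` is recovered as the limit of `Q k (σ C)`. -/
theorem exists_isSolution {d h : ℝ → H} (hd : MemLp d 2 (volume.restrict (Ioi 0)))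
    (hh : MemLp h 2 (volume.restrict (Ioi 0)))
    (hw : ∀ θ : ℝ → ℝ, IsTestFunction (Ioi 0) θ →
      ∫ t in Ioi 0, deriv θ t • M.b (d t) = ∫ t in Ioi 0, θ t • M.a (h t)) :
    ∃ C : ℝ → H, ContinuousOn C (Ici 0) ∧
      (∀ᵐ t ∂(volume.restrict (Ioi (0 : ℝ))), M.σ (C t) = M.b (d t)) ∧
      (∀ t, 0 ≤ t → M.σ (C t) = M.σ (C 0) - ∫ s in (0 : ℝ)..t, M.a (h s)) ∧
      ∀ t, 0 ≤ t → ‖C t‖ ^ 2 = 2 * ∫ s in Ioi t, (inner ℂ (h s) (d s)).re := by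
  have hbd := M.b.comp_memLp' hd
  have hah := M.a.comp_memLp' hh
  have hah' : ∀ T : ℝ, 0 ≤ T → IntervalIntegrable (fun s => M.a (h s)) volume 0 T := by
    intro T hT
    rw [intervalIntegrable_iff_integrableOn_Ioc_of_le hT]
    have h1 : MemLp (fun s => M.a (h s)) 2 (volume.restrict (Ioc 0 T)) :=
      hah.mono_measure (Measure.restrict_mono (fun x hx => hx.1) le_rfl)
    exact h1.integrable (by norm_num)
  obtain ⟨c, hc⟩ := exists_eq_add_integral_of_weak_deriv (y := fun t => M.b (d t))
    (z := fun t => - M.a (h t))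
    (by
      refine (locallyIntegrableOn_iff isOpen_Ioi.isLocallyClosed).2 fun K hK hKc => ?_
      have hK2 : MemLp (fun t => M.b (d t)) 2 (volume.restrict K) :=
        hbd.mono_measure (Measure.restrict_mono hK le_rfl)
      have : IsFiniteMeasure (volume.restrict K) := ⟨by simpa using hKc.measure_lt_top⟩
      exact hK2.integrable one_le_two)
    (fun T hT => (hah' T hT).neg) (fun θ hθ => by
      rw [hw θ hθ, ← integral_neg]; simp)
  set Y : ℝ → H := fun t => c - ∫ s in (0 : ℝ)..t, M.a (h s) with hY
  have hYd : ∀ᵐ t ∂(volume.restrict (Ioi (0 : ℝ))), Y t = M.b (d t) := by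
    filter_upwards [hc] with t ht
    rw [ht, hY]; simp [sub_eq_add_neg]
  have hYc : ContinuousOn Y (Ici 0) := by
    intro t ht
    have ht : 0 ≤ t := ht
    have h1 := continuousOn_of_eq_integral (f := Y) (f' := fun s => - M.a (h s)) (a := 0)
      (b := t + 1) (by linarith) (hah' _ (by linarith)).neg (fun s _ => by
        simp [hY, sub_eq_add_neg])
    refine (h1 t ⟨ht, by linarith⟩).mono_of_mem_nhdsWithin ?_
    rw [← Ici_inter_Iic]
    exact inter_mem self_mem_nhdsWithin (mem_nhdsWithin_of_mem_nhds (Iic_mem_nhds (by linarith)))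
  set P : ℕ → H → H := fun k x => M.Q k (M.σ x) with hP
  -- The error `δ k` does not depend on the time. It dominates every tail of the energy integral, so
  -- convergence is uniform on `[0,∞)`.
  set δ : ℕ → ℝ := fun k => ∫ s in Ioi 0, (‖P k (h s) - h s‖ ^ 2 + ‖P k (d s) - d s‖ ^ 2) with hδ
  have hPm : ∀ k {f : ℝ → H}, MemLp f 2 (volume.restrict (Ioi 0)) →
      MemLp (fun s => P k (f s)) 2 (volume.restrict (Ioi 0)) := fun k f hf =>
    ((M.Q k).comp M.σ).comp_memLp' hf
  have hPd : ∀ k x, ‖P k x - x‖ ^ 2 ≤ 4 * ‖x‖ ^ 2 := by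
    intro k x
    have h1 : ‖P k x - x‖ ≤ 2 * ‖x‖ := (norm_sub_le _ _).trans (by linarith [M.P_le k x])
    calc _ ≤ (2 * ‖x‖) ^ 2 := by gcongr
      _ = _ := by ring
  have hδi : ∀ k, IntegrableOn (fun s => ‖P k (h s) - h s‖ ^ 2 + ‖P k (d s) - d s‖ ^ 2) (Ioi 0) :=
    fun k => (integrable_norm_sq ((hPm k hh).sub hh)).add (integrable_norm_sq ((hPm k hd).sub hd))
  have hδ0 : Tendsto δ atTop (𝓝 0) := by
    have : Tendsto δ atTop (𝓝 (∫ s in Ioi (0 : ℝ), (0 : ℝ))) := by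
      refine tendsto_integral_of_dominated_convergence
        (fun s => 4 * ‖h s‖ ^ 2 + 4 * ‖d s‖ ^ 2) (fun k => (hδi k).1)
        (((integrable_norm_sq hh).const_mul 4).add ((integrable_norm_sq hd).const_mul 4))
        (fun k => Eventually.of_forall fun s => ?_) (Eventually.of_forall fun s => ?_)
      · rw [Real.norm_of_nonneg (by positivity)]
        exact add_le_add (hPd k _) (hPd k _)
      · have e1 : ∀ x : H, Tendsto (fun k => ‖P k x - x‖ ^ 2) atTop (𝓝 0) := fun x => by
          have := ((M.P_tendsto x).sub_const x).norm.pow 2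
          simpa using this
        simpa using (e1 (h s)).add (e1 (d s))
    simpa using this
  have hδnn : ∀ k, 0 ≤ δ k := fun k => integral_nonneg fun s => by positivity
  have hcauchy : ∀ k j t, 0 ≤ t → ‖M.Q k (Y t) - M.Q j (Y t)‖ ^ 2 ≤ 2 * δ k + 2 * δ j := by
    intro k j t ht
    -- The energy identity is linear in nothing but allows any self-adjoint `q` commuting with `a`
    -- and `σ`, in particular a difference of two approximations.
    have := M.norm_sq_eq_integral (q := M.Q k - M.Q j)
      (fun x y => by simp only [sub_apply, inner_sub_left, inner_sub_right, M.Q_sa])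
      (fun x => by simp only [sub_apply, M.Qa, map_sub])
      (fun x => by simp only [sub_apply, M.Qσ, map_sub]) hd hh (fun t => rfl) hYd ht
    simp only [sub_apply] at this
    rw [this]
    have hi : ∀ k j, IntegrableOn (fun s => (inner ℂ (P k (h s) - P j (h s))
        (P k (d s) - P j (d s))).re) (Ioi 0) := fun k j =>
      integrable_re_inner ((hPm k hh).sub (hPm j hh)) ((hPm k hd).sub (hPm j hd))
    have h2 : ∫ s in Ioi t, (inner ℂ (P k (h s) - P j (h s)) (P k (d s) - P j (d s))).re ≤
        ∫ s in Ioi t, ((‖P k (h s) - h s‖ ^ 2 + ‖P k (d s) - d s‖ ^ 2) +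
          (‖P j (h s) - h s‖ ^ 2 + ‖P j (d s) - d s‖ ^ 2)) := by
      refine setIntegral_mono ((hi k j).mono_set (Ioi_subset_Ioi ht))
        (((hδi k).add (hδi j)).mono_set (Ioi_subset_Ioi ht)) fun s => ?_
      refine (re_inner_le_norm (𝕜 := ℂ) _ _).trans ?_
      have e1 : ∀ x : H, ‖P k x - P j x‖ ≤ ‖P k x - x‖ + ‖P j x - x‖ := fun x => by
        have : P k x - P j x = (P k x - x) - (P j x - x) := by abel
        rw [this]; exact norm_sub_le _ _
      have e2 := e1 (h s)
      have e3 := e1 (d s)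
      have n1 := norm_nonneg (P k (h s) - P j (h s))
      have n2 := norm_nonneg (P k (d s) - P j (d s))
      nlinarith [sq_nonneg (‖P k (h s) - P j (h s)‖ - ‖P k (d s) - P j (d s)‖),
        sq_nonneg (‖P k (h s) - h s‖ - ‖P j (h s) - h s‖),
        sq_nonneg (‖P k (d s) - d s‖ - ‖P j (d s) - d s‖)]
    have h3 : ∫ s in Ioi t, ((‖P k (h s) - h s‖ ^ 2 + ‖P k (d s) - d s‖ ^ 2) +
          (‖P j (h s) - h s‖ ^ 2 + ‖P j (d s) - d s‖ ^ 2)) ≤ δ k + δ j := by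
      rw [hδ]; simp only
      rw [← integral_add (hδi k) (hδi j)]
      exact setIntegral_mono_set ((hδi k).add (hδi j))
        (Eventually.of_forall fun s => by simp only [Pi.zero_apply]; positivity)
        (Ioi_subset_Ioi ht).eventuallyLE
    simp only [hP] at h2 h3
    linarith
  have hex : ∀ t, ∃ x, 0 ≤ t → Tendsto (fun k => M.Q k (Y t)) atTop (𝓝 x) := by
    intro t
    by_cases ht : 0 ≤ t
    · have : CauchySeq (fun k => M.Q k (Y t)) := by
        rw [Metric.cauchySeq_iff]
        intro ε hε
        have : ∀ᶠ k in atTop, δ k < ε ^ 2 / 4 := hδ0.eventually_lt_const (by positivity)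
        obtain ⟨N, hN⟩ := eventually_atTop.1 this
        refine ⟨N, fun k hk j hj => ?_⟩
        rw [dist_eq_norm]
        refine lt_of_pow_lt_pow_left₀ 2 hε.le ?_
        linarith [hcauchy k j t ht, hN k hk, hN j hj]
      obtain ⟨x, hx⟩ := cauchySeq_tendsto_of_complete this
      exact ⟨x, fun _ => hx⟩
    · exact ⟨0, fun h => absurd h ht⟩
  choose C hC using hex
  have hCk : ∀ k t, 0 ≤ t → ‖C t - M.Q k (Y t)‖ ^ 2 ≤ 2 * δ k := by
    intro k t ht
    have h1 : Tendsto (fun j => ‖M.Q j (Y t) - M.Q k (Y t)‖ ^ 2) atTop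
        (𝓝 (‖C t - M.Q k (Y t)‖ ^ 2)) := ((hC t ht).sub_const _).norm.pow 2
    have h2 : Tendsto (fun j => 2 * δ j + 2 * δ k) atTop (𝓝 (2 * 0 + 2 * δ k)) :=
      (hδ0.const_mul 2).add_const _
    have := le_of_tendsto_of_tendsto' h1 h2 (fun j => hcauchy j k t ht)
    linarith
  have hσC : ∀ t, 0 ≤ t → M.σ (C t) = Y t := by
    intro t ht
    have h1 := (M.σ.continuous.tendsto _).comp (hC t ht)
    refine tendsto_nhds_unique h1 ((M.P_tendsto (Y t)).congr fun k => ?_)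
    exact M.Qσ k _
  refine ⟨C, ?_, ?_, ?_, ?_⟩
  · have hu : TendstoUniformlyOn (fun k t => M.Q k (Y t)) C atTop (Ici 0) := by
      rw [Metric.tendstoUniformlyOn_iff]
      intro ε hε
      have : ∀ᶠ k in atTop, δ k < ε ^ 2 / 2 := hδ0.eventually_lt_const (by positivity)
      filter_upwards [this] with k hk t ht
      rw [dist_eq_norm]
      refine lt_of_pow_lt_pow_left₀ 2 hε.le ?_
      linarith [hCk k t ht]
    exact hu.continuousOn (Frequently.of_forall fun k => (M.Q k).continuous.comp_continuousOn hYc)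
  · rw [ae_restrict_iff' measurableSet_Ioi] at hYd ⊢
    filter_upwards [hYd] with t ht h0
    rw [hσC t (le_of_lt h0), ht h0]
  · intro t ht
    rw [hσC t ht, hσC 0 le_rfl]; simp [hY]
  · intro t ht
    have h1 : Tendsto (fun k => ‖M.Q k (Y t)‖ ^ 2) atTop (𝓝 (‖C t‖ ^ 2)) := (hC t ht).norm.pow 2
    refine tendsto_nhds_unique h1 ?_
    have h2 : ∀ k, ‖M.Q k (Y t)‖ ^ 2 = 2 * ∫ s in Ioi t, (inner ℂ (P k (h s)) (P k (d s))).re :=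
      fun k => M.norm_sq_eq_integral (M.Q_sa k) (M.Qa k) (M.Qσ k) hd hh (fun t => rfl) hYd ht
    simp only [h2]
    refine Tendsto.const_mul 2 ?_
    have hss : volume.restrict (Ioi t) ≤ volume.restrict (Ioi (0 : ℝ)) :=
      Measure.restrict_mono (Ioi_subset_Ioi ht) le_rfl
    refine tendsto_integral_of_dominated_convergence (fun s => ‖h s‖ ^ 2 + ‖d s‖ ^ 2)
      (fun k => ((integrable_re_inner (hPm k hh) (hPm k hd)).mono_measure hss).1)
      (((integrable_norm_sq hh).add (integrable_norm_sq hd)).mono_measure hss)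
      (fun k => Eventually.of_forall fun s => ?_) (Eventually.of_forall fun s => ?_)
    · refine (Complex.abs_re_le_norm _).trans ((norm_inner_le_norm _ _).trans ?_)
      have e1 := M.P_le k (h s)
      have e2 := M.P_le k (d s)
      have n1 := norm_nonneg (P k (h s))
      have n2 := norm_nonneg (P k (d s))
      have := mul_le_mul e1 e2 n2 (norm_nonneg _)
      simp only [hP] at this ⊢
      nlinarith [sq_nonneg (‖h s‖ - ‖d s‖), sq_nonneg ‖h s‖, sq_nonneg ‖d s‖]
    · exact (Complex.continuous_re.tendsto _).comp
        ((M.P_tendsto (h s)).inner (M.P_tendsto (d s)))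

end MultSystem

end Abstract

/-! ### Existence by Lions' representation theorem. -/

section Lions

/-- Lebesgue measure on the time axis `(0, ∞)`. -/
abbrev halfLine : Measure ℝ := volume.restrict (Ioi (0 : ℝ))

theorem integrable_smul_of_memLp {α E : Type*} [MeasurableSpace α] {μ : Measure α}
    [NormedAddCommGroup E] [NormedSpace ℝ E] {θ : α → ℝ} {f : α → E} (hθ : MemLp θ 2 μ)
    (hf : MemLp f 2 μ) : Integrable (fun t => θ t • f t) μ :=
  memLp_one_iff_integrable.1 (hf.smul hθ)

/-- The representation theorem of Lions: a linear functional controlled by a linear map into a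
Hilbert space is represented through that map. -/
theorem exists_inner_eq_of_bound {V 𝓗 : Type*} [AddCommGroup V] [Module ℂ V]
    [NormedAddCommGroup 𝓗] [InnerProductSpace ℂ 𝓗] [CompleteSpace 𝓗] (K : V →ₗ[ℂ] 𝓗)
    (l : V →ₗ[ℂ] ℂ) (C : ℝ) (h : ∀ v, ‖l v‖ ≤ C * ‖K v‖) :
    ∃ d : 𝓗, ∀ v, inner ℂ d (K v) = l v := by
  -- The bound forces `l` to vanish on the kernel of `K`, so `l ∘ s` is independent of the linear
  -- section `s` and is bounded on the range. It is then extended to the whole space and represented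
  -- by a vector.
  obtain ⟨s, hs⟩ := K.rangeRestrict.exists_rightInverse_of_surjective K.range_rangeRestrict
  have hs' : ∀ y, K (s y) = y := fun y => congrArg Subtype.val (LinearMap.congr_fun hs y)
  let f : LinearMap.range K →L[ℂ] ℂ := (l ∘ₗ s).mkContinuous C fun y => by
    have := h (s y)
    rw [hs'] at this
    exact this
  obtain ⟨g, hg, -⟩ := exists_extension_norm_eq (LinearMap.range K) f
  refine ⟨(InnerProductSpace.toDual ℂ 𝓗).symm g, fun v => ?_⟩
  rw [InnerProductSpace.toDual_symm_apply]
  have h1 := hg (K.rangeRestrict v)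
  change g (K v) = l (s (K.rangeRestrict v)) at h1
  rw [h1, ← sub_eq_zero, ← map_sub, ← norm_le_zero_iff]
  refine (h _).trans ?_
  rw [map_sub, hs']
  simp

variable {H : Type*} [NormedAddCommGroup H] [InnerProductSpace ℂ H] [CompleteSpace H]

variable (H) in
/-- Continuously differentiable curves with compact support. -/
def curves : Submodule ℂ (ℝ → H) where
  carrier := {w | ContDiff ℝ 1 w ∧ HasCompactSupport w}
  add_mem' h1 h2 := ⟨h1.1.add h2.1, h1.2.add h2.2⟩
  zero_mem' := ⟨contDiff_const, HasCompactSupport.zero⟩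
  smul_mem' c _ h := ⟨contDiff_const.smul h.1, h.2.comp_left (g := fun x => c • x) (smul_zero c)⟩

theorem curves_memLp {w : ℝ → H} (h : w ∈ curves H) : MemLp w 2 halfLine :=
  (h.1.continuous.memLp_of_hasCompactSupport h.2).restrict _

theorem curves_deriv_memLp {w : ℝ → H} (h : w ∈ curves H) :
    MemLp (deriv w) 2 halfLine :=
  ((h.1.continuous_deriv le_rfl).memLp_of_hasCompactSupport h.2.deriv).restrict _

variable (H) in
def curvesToLp : curves H →ₗ[ℂ] Lp H 2 halfLine where
  toFun w := (curves_memLp w.2).toLp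
  map_add' _ _ := rfl
  map_smul' _ _ := rfl

variable (H) in
def curvesDerivToLp : curves H →ₗ[ℂ] Lp H 2 halfLine where
  toFun w := (curves_deriv_memLp w.2).toLp
  map_add' w η := by
    rw [← MemLp.toLp_add]
    congr 1
    funext t
    exact deriv_add (w.2.1.differentiable (by simp) t) (η.2.1.differentiable (by simp) t)
  map_smul' c w := by
    rw [RingHom.id_apply, ← MemLp.toLp_const_smul]
    congr 1
    funext t
    exact deriv_const_smul c (w.2.1.differentiable (by simp) t)

namespace MultSystem

variable (M : MultSystem H)

/-- Since `a b = σ²`, the integrand is half the derivative of `‖σ w‖²`, and compact support leaves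
only the boundary term at `0`. -/
theorem energy_curves {w : ℝ → H} (h : w ∈ curves H) :
    ∫ t in Ioi (0 : ℝ), (inner ℂ (M.a (w t)) (M.b (deriv w t))).re = - ‖M.σ (w 0)‖ ^ 2 / 2 := by
  have hd : ∀ t, HasDerivAt w (deriv w t) t := fun t =>
    (h.1.differentiable (by simp) t).hasDerivAt
  have h1 : ∀ t, HasDerivAt (fun t => reInner H (M.σ (w t)) (M.σ (w t)))
      (2 * (inner ℂ (M.a (w t)) (M.b (deriv w t))).re) t := by
    intro t
    have e := ((M.σ.restrictScalars ℝ).hasFDerivAt.comp_hasDerivAt t (hd t)).hasFDerivAt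
    have := ((reInner H).hasFDerivAt_of_bilinear e e).hasDerivAt
    refine this.congr_deriv ?_
    simp only [ContinuousLinearMap.precompR, ContinuousLinearMap.precompL]
    rw [M.a_sa, M.ab, ← M.σ_sa]
    simp
    rw [← inner_conj_symm (M.σ (deriv w t)), Complex.conj_re]
    ring
  have hc : ContDiff ℝ 1 (fun t => reInner H (M.σ (w t)) (M.σ (w t))) := by
    have e : ContDiff ℝ 1 (fun t => M.σ (w t)) := (M.σ.restrictScalars ℝ).contDiff.comp h.1
    exact ((reInner H).contDiff.comp e).clm_apply e
  have hs : HasCompactSupport (fun t => reInner H (M.σ (w t)) (M.σ (w t))) :=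
    h.2.comp_left (g := fun x => reInner H (M.σ x) (M.σ x)) (by simp)
  have := hs.integral_Ioi_deriv_eq hc 0
  simp only [fun t => (h1 t).deriv] at this
  rw [integral_const_mul, reInner_apply] at this
  have n1 : (inner ℂ (M.σ (w 0)) (M.σ (w 0))).re = ‖M.σ (w 0)‖ ^ 2 :=
    inner_self_eq_norm_sq (𝕜 := ℂ) _
  rw [n1] at this
  linarith

/-- Lions' theorem for `K w = T† a w - b w'` and `l w = ⟨u₀, σ w(0)⟩`: the real part of `⟨a w, K w⟩`
dominates `lam ‖a w‖²` together with half of `‖σ w(0)‖²`. Test functions need not vanish at `0`, and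
this is how the datum enters. -/
theorem exists_weak_solution {lam : ℝ} (hlam : 0 < lam)
    (T : Lp H 2 halfLine →L[ℂ] Lp H 2 halfLine)
    (hT : ∀ W, lam * ‖M.a.compLpL 2 _ W‖ ^ 2 ≤
      (inner ℂ (T (M.a.compLpL 2 _ W)) (M.a.compLpL 2 _ W)).re) (u₀ : H) :
    ∃ d : Lp H 2 halfLine, ∀ θ : ℝ → ℝ, IsTestFunction univ θ →
      ∫ t in Ioi 0, deriv θ t • M.b (d t) =
        (∫ t in Ioi 0, θ t • M.a (T d t)) - θ 0 • M.σ u₀ := by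
  set aL := M.a.compLpL 2 halfLine
  set bL := M.b.compLpL 2 halfLine
  let K : curves H →ₗ[ℂ] Lp H 2 halfLine :=
    (ContinuousLinearMap.adjoint T ∘L aL).toLinearMap ∘ₗ curvesToLp H -
      bL.toLinearMap ∘ₗ curvesDerivToLp H
  let l : curves H →ₗ[ℂ] ℂ := (innerSL ℂ u₀ ∘L M.σ).toLinearMap ∘ₗ
    LinearMap.proj 0 ∘ₗ (curves H).subtype
  have hl : ∀ w, l w = inner ℂ u₀ (M.σ (w.1 0)) := fun w => rfl
  have hK : ∀ w, K w = ContinuousLinearMap.adjoint T (aL (curvesToLp H w)) -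
    bL (curvesDerivToLp H w) := fun w => rfl
  have hen : ∀ w : curves H, (inner ℂ (aL (curvesToLp H w)) (bL (curvesDerivToLp H w))).re =
      - ‖M.σ (w.1 0)‖ ^ 2 / 2 := by
    intro w
    rw [← M.energy_curves w.2, L2.inner_def]
    have e : (∫ t, inner ℂ (aL (curvesToLp H w) t) (bL (curvesDerivToLp H w) t) ∂halfLine).re =
        ∫ t, (inner ℂ (aL (curvesToLp H w) t) (bL (curvesDerivToLp H w) t)).re ∂halfLine :=
      (integral_re (𝕜 := ℂ) (L2.integrable_inner (𝕜 := ℂ) _ _)).symm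
    rw [e]
    refine integral_congr_ae ?_
    filter_upwards [M.a.coeFn_compLpL (curvesToLp H w), M.b.coeFn_compLpL (curvesDerivToLp H w),
      (curves_memLp w.2).coeFn_toLp, (curves_deriv_memLp w.2).coeFn_toLp] with t h1 h2 h3 h4
    have h3' : curvesToLp H w t = w.1 t := h3
    have h4' : curvesDerivToLp H w t = deriv w.1 t := h4
    simp only [aL, bL]
    rw [h1, h2, h3', h4']
  have hcoer : ∀ w : curves H, lam * ‖aL (curvesToLp H w)‖ ^ 2 + ‖M.σ (w.1 0)‖ ^ 2 / 2 ≤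
      ‖aL (curvesToLp H w)‖ * ‖K w‖ := by
    intro w
    refine le_trans ?_ (re_inner_le_norm (𝕜 := ℂ) (aL (curvesToLp H w)) (K w))
    rw [hK, inner_sub_right, ContinuousLinearMap.adjoint_inner_right]
    have h1 := hT (curvesToLp H w)
    have h2 := hen w
    have : RCLike.re (inner ℂ (T (aL (curvesToLp H w))) (aL (curvesToLp H w)) -
      inner ℂ (aL (curvesToLp H w)) (bL (curvesDerivToLp H w))) =
      (inner ℂ (T (aL (curvesToLp H w))) (aL (curvesToLp H w))).re -
      (inner ℂ (aL (curvesToLp H w)) (bL (curvesDerivToLp H w))).re := by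
      simp
    rw [this, h2]
    linarith
  -- With `s = ‖σ w(0)‖`, coercivity reads `lam x² + s²/2 ≤ x y`. Hence `lam x ≤ y`, and then `s² ≤
  -- 2 x y ≤ (2/lam) y²`.
  obtain ⟨d, hd⟩ := exists_inner_eq_of_bound K l (‖u₀‖ * √(2 / lam)) (by
    intro w
    have h1 := hcoer w
    set x := ‖aL (curvesToLp H w)‖
    set y := ‖K w‖
    have hx : 0 ≤ x := norm_nonneg _
    have hy : 0 ≤ y := norm_nonneg _
    have hxy : lam * x ≤ y := by
      rcases hx.eq_or_lt with h0 | h0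
      · rw [← h0]; simpa using hy
      · have : x * (lam * x) ≤ x * y := by nlinarith [sq_nonneg ‖M.σ (w.1 0)‖]
        exact le_of_mul_le_mul_left this h0
    have h2 : ‖M.σ (w.1 0)‖ ^ 2 ≤ 2 / lam * y ^ 2 := by
      have e1 : x ≤ y / lam := by rw [le_div_iff₀ hlam]; linarith
      have e2 : x * y ≤ y / lam * y := by gcongr
      have e3 : y / lam * y * 2 = 2 / lam * y ^ 2 := by ring
      nlinarith [mul_nonneg hlam.le (sq_nonneg x)]
    have h3 : ‖M.σ (w.1 0)‖ ≤ √(2 / lam) * y := by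
      rw [← Real.sqrt_sq hy, ← Real.sqrt_mul (by positivity)]
      exact Real.le_sqrt_of_sq_le h2
    rw [hl]
    calc _ ≤ ‖u₀‖ * ‖M.σ (w.1 0)‖ := norm_inner_le_norm _ _
      _ ≤ ‖u₀‖ * (√(2 / lam) * y) := by gcongr
      _ = _ := by ring)
  refine ⟨d, fun θ hθ => ?_⟩
  have hi1 : Integrable (fun t => deriv θ t • M.b (d t)) halfLine :=
    integrable_smul_of_memLp ((hθ.deriv.continuous.memLp_of_hasCompactSupport hθ.deriv.2.1
      (p := 2)).restrict _) (M.b.comp_memLp' (Lp.memLp d))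
  have hi2 : Integrable (fun t => θ t • M.a (T d t)) halfLine :=
    integrable_smul_of_memLp ((hθ.continuous.memLp_of_hasCompactSupport hθ.2.1
      (p := 2)).restrict _) (M.a.comp_memLp' (Lp.memLp (T d)))
  rw [eq_sub_iff_add_eq, ← sub_eq_zero]
  refine ext_inner_left ℂ fun x => ?_
  rw [inner_zero_right]
  have hω : (fun t => θ t • x) ∈ curves H :=
    ⟨(hθ.1.of_le (by simp)).smul contDiff_const, hθ.2.1.smul_right⟩
  have h1 := hd ⟨_, hω⟩
  rw [hl, hK, inner_sub_right, ContinuousLinearMap.adjoint_inner_right, L2.inner_def,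
    L2.inner_def] at h1
  have e1 : ∫ t, inner ℂ (T d t) (aL (curvesToLp H ⟨_, hω⟩) t) ∂halfLine =
      starRingEnd ℂ (inner ℂ x (∫ t, θ t • M.a (T d t) ∂halfLine)) := by
    rw [← integral_inner hi2, ← integral_conj]
    refine integral_congr_ae ?_
    filter_upwards [M.a.coeFn_compLpL (curvesToLp H ⟨_, hω⟩), (curves_memLp hω).coeFn_toLp]
      with t h2 h3
    have h3' : curvesToLp H ⟨_, hω⟩ t = θ t • x := h3
    simp only [aL]
    rw [h2, h3', inner_conj_symm, ← Complex.coe_smul, ← Complex.coe_smul, map_smul,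
      inner_smul_right, inner_smul_left, M.a_sa, Complex.conj_ofReal]
  have e2 : ∫ t, inner ℂ (d t) (bL (curvesDerivToLp H ⟨_, hω⟩) t) ∂halfLine =
      starRingEnd ℂ (inner ℂ x (∫ t, deriv θ t • M.b (d t) ∂halfLine)) := by
    rw [← integral_inner hi1, ← integral_conj]
    refine integral_congr_ae ?_
    filter_upwards [M.b.coeFn_compLpL (curvesDerivToLp H ⟨_, hω⟩),
      (curves_deriv_memLp hω).coeFn_toLp] with t h2 h3
    have h3' : curvesDerivToLp H ⟨_, hω⟩ t = deriv θ t • x := by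
      have : curvesDerivToLp H ⟨_, hω⟩ t = deriv (fun t => θ t • x) t := h3
      rw [this, deriv_smul_const (hθ.1.differentiable (by simp) t)]
    simp only [bL]
    rw [h2, h3', inner_conj_symm, ← Complex.coe_smul, ← Complex.coe_smul, map_smul,
      inner_smul_right, inner_smul_left, M.b_sa, Complex.conj_ofReal]
  rw [e1, e2] at h1
  have h2 := congrArg (starRingEnd ℂ) h1
  simp only [map_sub, inner_conj_symm] at h2
  rw [inner_sub_right, inner_add_right]
  have h3 : inner ℂ (M.σ (θ 0 • x)) u₀ = inner ℂ x (θ 0 • M.σ u₀) := by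
    rw [M.σ_sa, ← Complex.coe_smul, ← Complex.coe_smul, inner_smul_left, inner_smul_right,
      Complex.conj_ofReal]
  rw [h3] at h2
  rw [← h2]; ring

/-- Existence for the abstract Cauchy problem. -/
theorem exists_solution {lam : ℝ} (hlam : 0 < lam)
    (T : Lp H 2 halfLine →L[ℂ] Lp H 2 halfLine)
    (hT : ∀ W, lam * ‖M.a.compLpL 2 _ W‖ ^ 2 ≤
      (inner ℂ (T (M.a.compLpL 2 _ W)) (M.a.compLpL 2 _ W)).re) (u₀ : H) :
    ∃ (d : Lp H 2 halfLine) (C : ℝ → H), ContinuousOn C (Ici 0) ∧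
      (∀ᵐ t ∂halfLine, M.σ (C t) = M.b (d t)) ∧
      (∀ t, 0 ≤ t → M.σ (C t) = M.σ (C 0) - ∫ s in (0 : ℝ)..t, M.a (T d s)) ∧
      (∀ t, 0 ≤ t → ‖C t‖ ^ 2 = 2 * ∫ s in Ioi t, (inner ℂ (T d s) (d s)).re) ∧ C 0 = u₀ := by
  obtain ⟨d, hd⟩ := M.exists_weak_solution hlam T hT u₀
  obtain ⟨C, c1, c2, c3, c4⟩ := M.exists_isSolution (d := d) (h := T d) (Lp.memLp _) (Lp.memLp _)
    (fun θ hθ => by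
      rw [hd θ ⟨hθ.1, hθ.2.1, subset_univ _⟩,
        image_eq_zero_of_notMem_tsupport (fun h0 => lt_irrefl _ (mem_Ioi.1 (hθ.2.2 h0)))]
      simp)
  refine ⟨d, C, c1, c2, c3, c4, ?_⟩
  have hah : ∀ s : ℝ, 0 ≤ s → IntervalIntegrable (fun s => M.a (T d s)) volume 0 s := by
    intro s hs
    rw [intervalIntegrable_iff_integrableOn_Ioc_of_le hs]
    have h1 : MemLp (fun s => M.a (T d s)) 2 (volume.restrict (Ioc 0 s)) :=
      (M.a.comp_memLp' (Lp.memLp (T d))).mono_measure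
        (Measure.restrict_mono (fun x hx => hx.1) le_rfl)
    exact h1.integrable one_le_two
  -- A cutoff with value `1` at `0`. The weak equation has boundary term `σ u₀`, integration by
  -- parts for `σ C` has boundary term `σ (C 0)`, and `σ` is injective.
  let f : ContDiffBump (0 : ℝ) := ⟨1, 2, by norm_num, by norm_num⟩
  have hf : IsTestFunction univ (f : ℝ → ℝ) := ⟨f.contDiff, f.hasCompactSupport, subset_univ _⟩
  have hf0 : f 0 = 1 := f.one_of_mem_closedBall (by simp [f])
  have hf3 : ∀ t, 2 ≤ t → f t = 0 := fun t ht => f.zero_of_le_dist (by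
    rw [Real.dist_eq, sub_zero]; exact ht.trans (le_abs_self _))
  have hf3' : ∀ t, 2 < t → deriv f t = 0 := fun t ht => by
    have : (f : ℝ → ℝ) =ᶠ[𝓝 t] fun _ => 0 := by
      filter_upwards [Ioi_mem_nhds ht] with s hs using hf3 s (le_of_lt hs)
    rw [this.deriv_eq]; simp
  have red : ∀ (η : ℝ → ℝ) (w : ℝ → H), (∀ t, 2 < t → η t = 0) →
      ∫ t in Ioi (0 : ℝ), η t • w t = ∫ t in (0 : ℝ)..2, η t • w t := by
    intro η w hη
    rw [intervalIntegral.integral_of_le (by norm_num)]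
    refine setIntegral_eq_of_subset_of_forall_sdiff_eq_zero measurableSet_Ioi
      (fun x hx => hx.1) fun s hs => ?_
    rw [hη s (by
      by_contra h'; exact hs.2 ⟨hs.1, not_lt.1 h'⟩), zero_smul]
  have ibp := integral_bilin_deriv (ContinuousLinearMap.lsmul ℝ ℝ : ℝ →L[ℝ] H →L[ℝ] H)
    (f := f) (f' := deriv f) (g := fun t => M.σ (C t)) (g' := fun t => - M.a (T d t))
    (a := 0) (b := 2) (by norm_num)
    (hf.deriv.continuous.intervalIntegrable _ _) (hah 2 (by norm_num)).neg
    (fun t _ => by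
      rw [intervalIntegral.integral_deriv_eq_sub
        (fun x _ => hf.1.differentiable (by simp) x)
        (hf.deriv.continuous.intervalIntegrable _ _)]; abel)
    (fun t ht => by
      rw [c3 t ht.1, intervalIntegral.integral_neg, sub_eq_add_neg])
  have h1 := hd f hf
  rw [red _ _ hf3', red _ _ (fun t ht => hf3 t ht.le), hf0, one_smul] at h1
  simp only [ContinuousLinearMap.lsmul_apply, smul_neg] at ibp
  have h2 : ∫ t in (0 : ℝ)..2, deriv f t • M.b (d t) =
      ∫ t in (0 : ℝ)..2, deriv f t • M.σ (C t) := by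
    refine intervalIntegral.integral_congr_ae ?_
    rw [ae_restrict_iff' measurableSet_Ioi] at c2
    filter_upwards [c2] with s hs hsI
    rw [uIoc_of_le (by norm_num)] at hsI
    rw [hs hsI.1]
  have cc : ContinuousOn (fun t => M.σ (C t)) (uIcc 0 2) := by
    rw [uIcc_of_le (by norm_num)]
    exact M.σ.continuous.comp_continuousOn (c1.mono Icc_subset_Ici_self)
  have i1 : IntervalIntegrable (fun t => deriv f t • M.σ (C t)) volume 0 2 :=
    (hf.deriv.continuous.continuousOn.smul cc).intervalIntegrable
  have i2 : IntervalIntegrable (fun t => - (f t • M.a (T d t))) volume 0 2 :=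
    ((hah 2 (by norm_num)).continuousOn_smul hf.continuous.continuousOn).neg
  rw [intervalIntegral.integral_add i1 i2, intervalIntegral.integral_neg, hf3 2 le_rfl, hf0,
    ← h2, h1] at ibp
  simp only [zero_smul, one_smul, zero_sub] at ibp
  have h3 : M.σ (u₀ - C 0) = 0 := by
    rw [map_sub]
    have : M.σ u₀ = M.σ (C 0) := by
      rw [← neg_inj, ← ibp]; abel
    rw [this, sub_self]
  exact (sub_eq_zero.1 (M.σ_inj _ h3)).symm

end MultSystem

end Lions

section

/-! ### Functions of two variables as curves in `L²`. -/

section Slices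

theorem exists_measurable_denseSeq_dist_lt {α X : Type*} [MeasurableSpace α] [PseudoMetricSpace X]
    [TopologicalSpace.SeparableSpace X] [Nonempty X] {f : α → X}
    (hf : ∀ h, Measurable fun t => dist h (f t)) {ε : ℝ} (hε : 0 < ε) :
    ∃ i : α → ℕ, Measurable i ∧ ∀ t, dist (TopologicalSpace.denseSeq X (i t)) (f t) < ε := by
  classical
  have h1 : ∀ t, ∃ i, dist (TopologicalSpace.denseSeq X i) (f t) < ε := fun t => by
    obtain ⟨i, hi⟩ := (TopologicalSpace.denseRange_denseSeq X).exists_dist_lt (f t) hε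
    exact ⟨i, by rwa [dist_comm]⟩
  exact ⟨fun t => Nat.find (h1 t), measurable_find h1 fun k => measurableSet_lt (hf _)
    measurable_const, fun t => Nat.find_spec (h1 t)⟩

/-- Separability makes `f` a limit of countably valued measurable functions. For a curve of slices
the distances to fixed elements are given by iterated integrals, whose measurability is Tonelli's
theorem. -/
theorem measurable_of_measurable_dist {α X : Type*} [MeasurableSpace α] [PseudoMetricSpace X]
    [TopologicalSpace.SeparableSpace X] [MeasurableSpace X] [BorelSpace X] {f : α → X}
    (hf : ∀ h, Measurable fun t => dist h (f t)) : Measurable f := by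
  rcases isEmpty_or_nonempty X with hX | hX
  · exact measurable_of_subsingleton_codomain f
  choose i hi hi' using fun k : ℕ =>
    exists_measurable_denseSeq_dist_lt hf (ε := 1 / ((k : ℝ) + 1)) (by positivity)
  refine measurable_of_tendsto_metrizable
    (f := fun k t => TopologicalSpace.denseSeq X (i k t))
    (fun k => (measurable_from_nat (f := TopologicalSpace.denseSeq X)).comp (hi k)) ?_
  rw [tendsto_pi_nhds]
  intro t
  rw [tendsto_iff_dist_tendsto_zero]
  exact squeeze_zero (fun k => dist_nonneg) (fun k => (hi' k t).le)
    tendsto_one_div_add_atTop_nhds_zero_nat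

variable {α β F : Type*} [MeasurableSpace α] [MeasurableSpace β] {μ : Measure α} {ν : Measure β}
  [SFinite μ] [SFinite ν] [MeasurableSpace.CountablyGenerated β]
  [NormedAddCommGroup F] [TopologicalSpace.SeparableSpace F]

theorem eLpNorm_two_pow {α F : Type*} [MeasurableSpace α] [NormedAddCommGroup F] (μ : Measure α)
    (f : α → F) : eLpNorm f 2 μ ^ 2 = ∫⁻ x, ‖f x‖ₑ ^ 2 ∂μ := by
  rw [eLpNorm_eq_lintegral_rpow_enorm_toReal (by norm_num) (by norm_num)]
  simp only [ENNReal.toReal_ofNat, ENNReal.rpow_ofNat, one_div]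
  rw [← ENNReal.rpow_natCast, ← ENNReal.rpow_mul]
  norm_num

variable (ν) in
open scoped Classical in
/-- The curve `t ↦ g(t, ·)` in `L²`, with the value `0` where the slice is not in `L²`. -/
def sliceLp (g : α × β → F) : α → Lp F 2 ν := fun t =>
  if h : MemLp (fun x => g (t, x)) 2 ν then h.toLp else 0

theorem coeFn_sliceLp {g : α × β → F} {t : α} (h : MemLp (fun x => g (t, x)) 2 ν) :
    sliceLp ν g t =ᵐ[ν] fun x => g (t, x) := by
  rw [sliceLp, dif_pos h]; exact h.coeFn_toLp

theorem sliceLp_eq {g : α × β → F} {t : α} {f : Lp F 2 ν} (h : (fun x => g (t, x)) =ᵐ[ν] f) :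
    sliceLp ν g t = f := by
  have : MemLp (fun x => g (t, x)) 2 ν := (memLp_congr_ae h).2 (Lp.memLp f)
  exact Lp.ext ((coeFn_sliceLp this).trans h)

theorem sliceLp_congr {g g' : α × β → F} {t : α}
    (h : (fun x => g (t, x)) =ᵐ[ν] fun x => g' (t, x)) : sliceLp ν g t = sliceLp ν g' t := by
  by_cases h1 : MemLp (fun x => g (t, x)) 2 ν
  · have h2 := (memLp_congr_ae h).1 h1
    exact sliceLp_eq (h.trans (coeFn_sliceLp h2).symm)
  · have h2 : ¬ MemLp (fun x => g' (t, x)) 2 ν := fun h2 => h1 ((memLp_congr_ae h).2 h2)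
    rw [sliceLp, sliceLp, dif_neg h1, dif_neg h2]

theorem sliceLp_congr_ae {g g' : α × β → F} (h : g =ᵐ[μ.prod ν] g') :
    sliceLp ν g =ᵐ[μ] sliceLp ν g' := by
  filter_upwards [Measure.ae_ae_of_ae_prod h] with t ht using sliceLp_congr ht

theorem measurable_eLpNorm_slice {g : α × β → F} (hg : StronglyMeasurable g) (u : β → F)
    (hu : StronglyMeasurable u) : Measurable fun t => eLpNorm (fun x => g (t, x) - u x) 2 ν := by
  have h1 : Measurable fun t => ∫⁻ x, ‖g (t, x) - u x‖ₑ ^ 2 ∂ν := by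
    refine Measurable.lintegral_prod_right' (f := fun p : α × β => ‖g p - u p.2‖ₑ ^ 2) ?_
    exact ((hg.sub (hu.comp_measurable measurable_snd)).enorm).pow_const 2
  have h2 : (fun t => eLpNorm (fun x => g (t, x) - u x) 2 ν) =
      fun t => (∫⁻ x, ‖g (t, x) - u x‖ₑ ^ 2 ∂ν) ^ (1 / 2 : ℝ) := by
    funext t
    rw [← eLpNorm_two_pow ν (fun x => g (t, x) - u x), ← ENNReal.rpow_natCast, ← ENNReal.rpow_mul]
    norm_num
  rw [h2]
  exact h1.pow_const _

theorem aestronglyMeasurable_sliceLp {g : α × β → F} (hg : AEStronglyMeasurable g (μ.prod ν)) :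
    AEStronglyMeasurable (sliceLp ν g) μ := by
  classical
  have : Fact ((2 : ℝ≥0∞) ≠ ⊤) := ⟨by norm_num⟩
  let _ : MeasurableSpace (Lp F 2 ν) := borel _
  have : BorelSpace (Lp F 2 ν) := ⟨rfl⟩
  refine AEStronglyMeasurable.congr ?_ (sliceLp_congr_ae hg.ae_eq_mk).symm
  have hm := hg.stronglyMeasurable_mk
  set g' := hg.mk g
  refine (measurable_of_measurable_dist fun h => ?_).aestronglyMeasurable
  have hset : MeasurableSet {t | MemLp (fun x => g' (t, x)) 2 ν} := by
    have : {t | MemLp (fun x => g' (t, x)) 2 ν} = {t | eLpNorm (fun x => g' (t, x)) 2 ν < ⊤} := by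
      ext t
      exact ⟨fun h => h.2, fun h => ⟨(hm.comp_measurable measurable_prodMk_left).aestronglyMeasurable,
        h⟩⟩
    rw [this]
    have h2 := measurable_eLpNorm_slice (ν := ν) hm 0 stronglyMeasurable_zero
    simp only [Pi.zero_apply, sub_zero] at h2
    exact measurableSet_lt h2 measurable_const
  have hd : (fun t => dist h (sliceLp ν g' t)) =
      Set.piecewise {t | MemLp (fun x => g' (t, x)) 2 ν}
        (fun t => (eLpNorm (fun x => g' (t, x) - h x) 2 ν).toReal) (fun _ => dist h 0) := by
    funext t
    by_cases ht : MemLp (fun x => g' (t, x)) 2 ν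
    · rw [Set.piecewise_eq_of_mem _ _ _ (show t ∈ {t | MemLp (fun x => g' (t, x)) 2 ν} from ht), dist_comm, Lp.dist_def]
      congr 1
      refine eLpNorm_congr_ae ?_
      filter_upwards [coeFn_sliceLp ht] with x hx
      simp [hx]
    · rw [Set.piecewise_eq_of_notMem _ _ _
        (show t ∉ {t | MemLp (fun x => g' (t, x)) 2 ν} from ht), sliceLp, dif_neg ht]
  rw [hd]
  exact Measurable.piecewise hset
    (measurable_eLpNorm_slice hm _ (Lp.stronglyMeasurable h)).ennreal_toReal measurable_const

theorem ae_memLp_slice {g : α × β → F} (hg : MemLp g 2 (μ.prod ν)) :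
    ∀ᵐ t ∂μ, MemLp (fun x => g (t, x)) 2 ν := by
  have h1 : ∫⁻ t, ∫⁻ x, ‖g (t, x)‖ₑ ^ 2 ∂ν ∂μ ≠ ⊤ := by
    rw [← lintegral_prod _ (hg.1.enorm.pow_const 2), ← eLpNorm_two_pow]
    exact ENNReal.pow_ne_top hg.2.ne
  have h2 : AEMeasurable (fun t => ∫⁻ x, ‖g (t, x)‖ₑ ^ 2 ∂ν) μ :=
    (hg.1.enorm.pow_const 2).lintegral_prod_right'
  filter_upwards [ae_lt_top' h2 h1, hg.1.prodMk_left] with t ht ht'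
  refine ⟨ht', ?_⟩
  rw [← eLpNorm_two_pow ν (fun x => g (t, x))] at ht
  by_contra hc
  rw [not_lt, top_le_iff] at hc
  rw [hc] at ht
  simp at ht

theorem eLpNorm_sliceLp {g : α × β → F} (hg : AEStronglyMeasurable g (μ.prod ν))
    (hs : ∀ᵐ t ∂μ, MemLp (fun x => g (t, x)) 2 ν) :
    eLpNorm (sliceLp ν g) 2 μ = eLpNorm g 2 (μ.prod ν) := by
  have : eLpNorm (sliceLp ν g) 2 μ ^ 2 = eLpNorm g 2 (μ.prod ν) ^ 2 := by
    rw [eLpNorm_two_pow, eLpNorm_two_pow, lintegral_prod _ (hg.enorm.pow_const 2)]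
    refine lintegral_congr_ae ?_
    filter_upwards [hs] with t ht
    rw [sliceLp, dif_pos ht, Lp.enorm_toLp, eLpNorm_two_pow]
  exact (ENNReal.pow_right_strictMono two_ne_zero).injective this

theorem memLp_sliceLp {g : α × β → F} (hg : MemLp g 2 (μ.prod ν)) : MemLp (sliceLp ν g) 2 μ :=
  ⟨aestronglyMeasurable_sliceLp hg.1, by
    rw [eLpNorm_sliceLp hg.1 (ae_memLp_slice hg)]; exact hg.2⟩

/-- Every measurable curve in `L²` comes from a jointly measurable function. -/
theorem exists_slice_eq [CompleteSpace F] {W : α → Lp F 2 ν} (hW : AEStronglyMeasurable W μ) :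
    ∃ g : α × β → F, StronglyMeasurable g ∧ ∀ᵐ t ∂μ, (fun x => g (t, x)) =ᵐ[ν] W t := by
  have : Fact ((2 : ℝ≥0∞) ≠ ⊤) := ⟨by norm_num⟩
  let _ : MeasurableSpace (Lp F 2 ν) := borel _
  have : BorelSpace (Lp F 2 ν) := ⟨rfl⟩
  set W' := hW.mk W
  have hm : StronglyMeasurable W' := hW.stronglyMeasurable_mk
  -- The geometric rate gives convergence almost everywhere in `x` for each `t`, without a
  -- subsequence depending on `t`; hence the pointwise limit is jointly measurable. The extra factor
  -- `1/2` lets two errors add up to at most `(1/2)^N`.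
  choose i hi hi' using fun k : ℕ => exists_measurable_denseSeq_dist_lt (f := W')
    (fun h => (measurable_const.dist hm.measurable)) (ε := (1 / 2) * (1 / 2 : ℝ) ^ k) (by positivity)
  set u := TopologicalSpace.denseSeq (Lp F 2 ν)
  set g : ℕ → α × β → F := fun k p => u (i k p.1) p.2
  have hg : ∀ k, StronglyMeasurable (g k) := by
    intro k
    borelize F
    have := UniformSpace.secondCountable_of_separable F
    have h1 : StronglyMeasurable (fun q : ℕ × β => u q.1 q.2) :=
      (measurable_from_prod_countable_right
        fun j => (Lp.stronglyMeasurable (u j)).measurable).stronglyMeasurable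
    exact h1.comp_measurable (((hi k).comp measurable_fst).prodMk measurable_snd)
  refine ⟨fun p => limUnder atTop (fun k => g k p), StronglyMeasurable.limUnder hg, ?_⟩
  filter_upwards [hW.ae_eq_mk] with t ht
  rw [ht]
  change _ =ᵐ[ν] W' t
  have hB : ∑' j : ℕ, ENNReal.ofReal ((1 / 2 : ℝ) ^ j) ≠ ⊤ := by
    rw [← ENNReal.ofReal_tsum_of_nonneg (fun j => by positivity) summable_geometric_two]
    exact ENNReal.ofReal_ne_top
  have h1 := Lp.ae_tendsto_of_cauchy_eLpNorm (μ := ν) (f := fun k x => g k (t, x)) (p := 2)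
    (fun k => Lp.aestronglyMeasurable (u (i k t))) (by norm_num) hB (by
      intro N n m hn hm
      have e1 : eLpNorm ((fun x => g n (t, x)) - fun x => g m (t, x)) 2 ν =
          ENNReal.ofReal (dist (u (i n t)) (u (i m t))) := by
        rw [← edist_dist, Lp.edist_def]
      rw [e1, ENNReal.ofReal_lt_ofReal_iff (by positivity)]
      have p1 : (1 / 2 : ℝ) ^ n ≤ (1 / 2) ^ N := pow_le_pow_of_le_one (by norm_num) (by norm_num) hn
      have p2 : (1 / 2 : ℝ) ^ m ≤ (1 / 2) ^ N := pow_le_pow_of_le_one (by norm_num) (by norm_num) hm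
      have := dist_triangle_right (u (i n t)) (u (i m t)) (W' t)
      linarith [hi' n t, hi' m t])
  have h2 : Tendsto (fun k => u (i k t)) atTop (𝓝 (W' t)) := by
    rw [tendsto_iff_dist_tendsto_zero]
    refine squeeze_zero (fun k => dist_nonneg) (fun k => (hi' k t).le) ?_
    have := (tendsto_pow_atTop_nhds_zero_of_lt_one (r := (1 / 2 : ℝ)) (by norm_num)
      (by norm_num)).const_mul (1 / 2)
    simpa using this
  obtain ⟨ns, hns, hns'⟩ := (tendstoInMeasure_of_tendsto_Lp h2).exists_seq_tendsto_ae
  filter_upwards [h1, hns'] with x ⟨l, hl⟩ hx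
  have e1 : limUnder atTop (fun k => g k (t, x)) = l := hl.limUnder_eq
  rw [e1]
  exact tendsto_nhds_unique (hl.comp hns.tendsto_atTop) hx

variable [InnerProductSpace ℂ F] [CompleteSpace F]

variable (F μ ν) in
/-- The identification of `L²(α × β)` with `L²(α; L²(β))`. -/
def sliceEquiv : Lp F 2 (μ.prod ν) ≃ₗᵢ[ℂ] Lp (Lp F 2 ν) 2 μ :=
  LinearIsometryEquiv.ofSurjective
    { toFun := fun g => (memLp_sliceLp (Lp.memLp g)).toLp
      map_add' := fun f g => by
        apply Lp.ext
        refine (MemLp.coeFn_toLp _).trans ?_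
        filter_upwards [Lp.coeFn_add (memLp_sliceLp (Lp.memLp f)).toLp
          (memLp_sliceLp (Lp.memLp g)).toLp, (memLp_sliceLp (Lp.memLp f)).coeFn_toLp,
          (memLp_sliceLp (Lp.memLp g)).coeFn_toLp, ae_memLp_slice (Lp.memLp f),
          ae_memLp_slice (Lp.memLp g), Measure.ae_ae_of_ae_prod (Lp.coeFn_add f g)]
          with t h1 h2 h3 h4 h5 h6
        rw [h1, Pi.add_apply, h2, h3]
        apply sliceLp_eq
        filter_upwards [h6, Lp.coeFn_add (sliceLp ν f t) (sliceLp ν g t), coeFn_sliceLp h4,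
          coeFn_sliceLp h5] with x e1 e2 e3 e4
        rw [e1, e2, Pi.add_apply, Pi.add_apply, e3, e4]
      map_smul' := fun c g => by
        apply Lp.ext
        refine (MemLp.coeFn_toLp _).trans ?_
        filter_upwards [Lp.coeFn_smul c (memLp_sliceLp (Lp.memLp g)).toLp,
          (memLp_sliceLp (Lp.memLp g)).coeFn_toLp, ae_memLp_slice (Lp.memLp g),
          Measure.ae_ae_of_ae_prod (Lp.coeFn_smul c g)] with t h1 h3 h5 h6
        rw [RingHom.id_apply, h1, Pi.smul_apply, h3]
        apply sliceLp_eq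
        filter_upwards [h6, Lp.coeFn_smul c (sliceLp ν g t), coeFn_sliceLp h5] with x e1 e2 e4
        rw [e1, e2, Pi.smul_apply, Pi.smul_apply, e4]
      norm_map' := fun g => by
        change ‖(memLp_sliceLp (Lp.memLp g)).toLp‖ = ‖g‖
        rw [Lp.norm_toLp, eLpNorm_sliceLp (Lp.aestronglyMeasurable g)
          (ae_memLp_slice (Lp.memLp g)), Lp.norm_def] }
    (fun W => by
      obtain ⟨g, hg, hgW⟩ := exists_slice_eq (Lp.aestronglyMeasurable W)
      have hs : sliceLp ν g =ᵐ[μ] W := by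
        filter_upwards [hgW] with t ht using sliceLp_eq ht
      have hm : MemLp g 2 (μ.prod ν) := by
        refine ⟨hg.aestronglyMeasurable, ?_⟩
        rw [← eLpNorm_sliceLp hg.aestronglyMeasurable, eLpNorm_congr_ae hs]
        · exact Lp.eLpNorm_lt_top W
        · filter_upwards [hgW] with t ht using (memLp_congr_ae ht).2 (Lp.memLp _)
      refine ⟨hm.toLp, Lp.ext ?_⟩
      exact (memLp_sliceLp (Lp.memLp hm.toLp)).coeFn_toLp.trans ((sliceLp_congr_ae hm.coeFn_toLp).trans hs))

theorem coeFn_sliceEquiv (g : Lp F 2 (μ.prod ν)) :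
    ∀ᵐ t ∂μ, sliceEquiv F μ ν g t =ᵐ[ν] fun x => g (t, x) := by
  have h1 : sliceEquiv F μ ν g =ᵐ[μ] sliceLp ν g := (memLp_sliceLp (Lp.memLp g)).coeFn_toLp
  filter_upwards [h1, ae_memLp_slice (Lp.memLp g)] with t e1 e2
  rw [e1]
  exact coeFn_sliceLp e2

end Slices

end

section

open scoped SchwartzMap FourierTransform LineDeriv

/-! ### Derivatives of multi-index order and their Fourier symbols. -/

section MultiDeriv

/-- The composition of the iterates `(f i)^[α i]`. -/
def iterOps {X : Type*} {n : ℕ} (f : Fin n → X → X) (α : Fin n → ℕ) (x : X) : X :=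
  (List.finRange n).foldr (fun i y => (f i)^[α i] y) x

/-- The induction behind most identities for `∂^α` here: only a single directional derivative has to
be examined. -/
theorem iterOps_rel {X Y : Type*} {n : ℕ} {R : X → Y → Prop} {f : Fin n → X → X}
    {g : Fin n → Y → Y} (h : ∀ i x y, R x y → R (f i x) (g i y)) (α : Fin n → ℕ) {x : X} {y : Y}
    (hxy : R x y) : R (iterOps f α x) (iterOps g α y) := by
  have key : ∀ i k x y, R x y → R ((f i)^[k] x) ((g i)^[k] y) := by
    intro i k
    induction k with
    | zero => exact fun x y h => h
    | succ k ih => exact fun x y h' => ih _ _ (h i _ _ h')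
  unfold iterOps
  induction List.finRange n with
  | nil => exact hxy
  | cons i l ih => exact key _ _ _ _ ih

theorem iterOps_mul {R : Type*} [CommMonoid R] {n : ℕ} (s : Fin n → R) (α : Fin n → ℕ) (x : R) :
    iterOps (fun i y => s i * y) α x = (∏ i, s i ^ α i) * x := by
  rw [iterOps, Fin.prod_univ_def]
  induction List.finRange n with
  | nil => simp
  | cons i l ih =>
    rw [List.foldr_cons, ih, mul_left_iterate, List.map_cons, List.prod_cons, mul_assoc]

theorem iterOps_zero {X : Type*} {n : ℕ} (f : Fin n → X → X) (x : X) : iterOps f 0 x = x := by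
  unfold iterOps
  induction List.finRange n with
  | nil => rfl
  | cons i l ih => simp

variable {E F G : Type*} [NormedAddCommGroup E] [NormedSpace ℝ E]
  [NormedAddCommGroup F] [NormedSpace ℝ F] [NormedAddCommGroup G] [NormedSpace ℝ G] {n : ℕ}

theorem multiDeriv_zero (e : Fin n → E) (φ : E → F) : multiDeriv e 0 φ = φ := iterOps_zero _ _

theorem contDiff_fderiv_apply {φ : E → F} (h : ContDiff ℝ ∞ φ) (v : E) :
    ContDiff ℝ ∞ fun p => fderiv ℝ φ p v :=
  (h.fderiv_right (m := ∞) (by simp)).clm_apply contDiff_const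

theorem IsTestFunction.fderiv_apply {Q : Set E} {φ : E → F} (h : IsTestFunction Q φ) (v : E) :
    IsTestFunction Q fun p => fderiv ℝ φ p v :=
  ⟨contDiff_fderiv_apply h.1 v, h.2.1.fderiv_apply ℝ v,
    (tsupport_fderiv_apply_subset ℝ v).trans h.2.2⟩

theorem IsTestFunction.multiDeriv {Q : Set E} {φ : E → F} (h : IsTestFunction Q φ)
    (e : Fin n → E) (α : Fin n → ℕ) : IsTestFunction Q (multiDeriv e α φ) :=
  iterOps_rel (R := fun φ _ => IsTestFunction Q φ) (g := fun _ => id) (y := ())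
    (fun i x _ h => h.fderiv_apply (e i)) α h

theorem multiDeriv_comp_clm (L : F →L[ℝ] G) {φ : E → F} (h : ContDiff ℝ ∞ φ)
    (e : Fin n → E) (α : Fin n → ℕ) :
    multiDeriv e α (fun p => L (φ p)) = fun p => L (multiDeriv e α φ p) := by
  refine (iterOps_rel (R := fun (φ : E → F) (ψ : E → G) => ContDiff ℝ ∞ φ ∧ ψ = fun p => L (φ p))
    ?_ α ⟨h, rfl⟩).2
  rintro i φ _ ⟨h1, rfl⟩
  refine ⟨contDiff_fderiv_apply h1 _, ?_⟩
  ext p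
  have := (L.hasFDerivAt.comp p (h1.differentiable (by simp) p).hasFDerivAt).fderiv
  exact congrArg (fun T => T (e i)) this

theorem multiDeriv_slice {Φ : ℝ × E → F} (h : ContDiff ℝ ∞ Φ) (e : Fin n → E) (α : Fin n → ℕ)
    (t : ℝ) : multiDeriv e α (fun x => Φ (t, x)) =
      fun x => multiDeriv (fun i => ((0 : ℝ), e i)) α Φ (t, x) := by
  refine (iterOps_rel (R := fun (φ : ℝ × E → F) (ψ : E → F) =>
    ContDiff ℝ ∞ φ ∧ ψ = fun x => φ (t, x)) ?_ α ⟨h, rfl⟩).2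
  rintro i φ _ ⟨h1, rfl⟩
  refine ⟨contDiff_fderiv_apply h1 _, ?_⟩
  ext x
  have := ((h1.differentiable (by simp) (t, x)).hasFDerivAt.comp x
    (hasFDerivAt_prodMk_right t x)).fderiv
  exact congrArg (fun T => T (e i)) this

/-- The operator `∂^α` on Schwartz functions. -/
def schwartzDeriv (α : Fin n → ℕ) : 𝓢(Sp n, ℂ) →L[ℂ] 𝓢(Sp n, ℂ) :=
  iterOps (fun i T => (LineDeriv.lineDerivOpCLM ℂ 𝓢(Sp n, ℂ) (dir n i)).comp T) α
    (ContinuousLinearMap.id ℂ _)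

theorem coe_schwartzDeriv (α : Fin n → ℕ) (ψ : 𝓢(Sp n, ℂ)) :
    ⇑(schwartzDeriv α ψ) = multiDeriv (dir n) α ψ := by
  refine iterOps_rel (R := fun (T : 𝓢(Sp n, ℂ) →L[ℂ] 𝓢(Sp n, ℂ)) (φ : Sp n → ℂ) => ⇑(T ψ) = φ)
    ?_ α rfl
  rintro i T _ rfl
  rfl

/-- The Fourier symbol `∏ (2πi ξ_j)^{α_j}` of `∂^α`. -/
def sym (α : Fin n → ℕ) (ξ : Sp n) : ℂ := ∏ i, (2 * Real.pi * Complex.I * (ξ i : ℂ)) ^ α i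

theorem sym_zero (ξ : Sp n) : sym 0 ξ = 1 := by simp [sym]

theorem sym_neg (α : Fin n → ℕ) (ξ : Sp n) : sym α (-ξ) = (-1) ^ (∑ i, α i) * sym α ξ := by
  simp only [sym, ← Finset.prod_pow_eq_pow_sum, ← Finset.prod_mul_distrib, ← mul_pow]
  simp

theorem conj_sym (α : Fin n → ℕ) (ξ : Sp n) : starRingEnd ℂ (sym α ξ) = sym α (-ξ) := by
  simp [sym, Complex.conj_ofNat]

theorem continuous_sym (α : Fin n → ℕ) : Continuous (sym α : Sp n → ℂ) := by
  unfold sym; fun_prop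

/-- Multiplication of Schwartz functions with the symbol of `(-∂)^α`. -/
def schwartzMul (α : Fin n → ℕ) : 𝓢(Sp n, ℂ) → 𝓢(Sp n, ℂ) :=
  iterOps (fun i ψ => -(2 * Real.pi * Complex.I) •
    SchwartzMap.smulLeftCLM ℂ (fun x : Sp n => inner ℝ x (dir n i)) ψ) α

theorem schwartzMul_apply (α : Fin n → ℕ) (ψ : 𝓢(Sp n, ℂ)) (ξ : Sp n) :
    schwartzMul α ψ ξ = sym α (-ξ) * ψ ξ := by
  rw [sym, ← iterOps_mul]
  refine iterOps_rel (R := fun (ψ : 𝓢(Sp n, ℂ)) (c : ℂ) => ψ ξ = c) ?_ α rfl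
  rintro i ψ _ rfl
  rw [smul_apply, SchwartzMap.smulLeftCLM_apply_apply (by fun_prop)]
  simp [dir, EuclideanSpace.inner_single_right]
  ring

theorem schwartzDeriv_fourier (α : Fin n → ℕ) (ψ : 𝓢(Sp n, ℂ)) :
    schwartzDeriv α (𝓕 ψ) = 𝓕 (schwartzMul α ψ) := by
  refine iterOps_rel (R := fun (T : 𝓢(Sp n, ℂ) →L[ℂ] 𝓢(Sp n, ℂ)) (χ : 𝓢(Sp n, ℂ)) =>
    T (𝓕 ψ) = 𝓕 χ) ?_ α rfl
  intro i T χ h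
  rw [← SchwartzMap.lineDerivOp_fourier_eq χ (dir n i), ← h]
  rfl

end MultiDeriv

end

section

open scoped SchwartzMap FourierTransform LineDeriv

/-! ### Density of test functions in the Schwartz space. -/

section Density

variable {E : Type*} [NormedAddCommGroup E] [InnerProductSpace ℝ E] [FiniteDimensional ℝ E]

/-- Smooth cutoff functions with uniformly bounded derivatives. -/
theorem exists_cutoff : ∃ (c : ℕ → E → ℝ) (D : ℕ → ℝ), (∀ k, ContDiff ℝ ∞ (c k)) ∧
    (∀ k, HasCompactSupport (c k)) ∧ (∀ (k : ℕ) x, ‖x‖ ≤ (k : ℝ) + 1 → c k x = 1) ∧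
    (∀ k x, ‖c k x‖ ≤ 1) ∧
    ∀ i k x, ‖iteratedFDeriv ℝ i (c k) x‖ ≤ D i := by
  classical
  let χ : ContDiffBump (0 : E) := ⟨1, 2, by norm_num, by norm_num⟩
  have hχ : ContDiff ℝ ∞ (χ : E → ℝ) := χ.contDiff
  have hχc : HasCompactSupport (χ : E → ℝ) := χ.hasCompactSupport
  have hD : ∀ i, ∃ D, ∀ x, ‖iteratedFDeriv ℝ i (χ : E → ℝ) x‖ ≤ D := fun i =>
    (hχ.continuous_iteratedFDeriv (m := i) (by exact_mod_cast le_top)).bounded_above_of_compact_support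
      (hχc.iteratedFDeriv i)
  choose D hD using hD
  let L : ℕ → E →L[ℝ] E := fun k => ((k : ℝ) + 1)⁻¹ • ContinuousLinearMap.id ℝ E
  have hL : ∀ k x, L k x = ((k : ℝ) + 1)⁻¹ • x := fun k x => rfl
  have hk : ∀ k : ℕ, (0 : ℝ) < (k : ℝ) + 1 := fun k => by positivity
  refine ⟨fun k x => χ (L k x), D, fun k => hχ.comp (L k).contDiff, fun k => ?_, fun k x hx => ?_,
    fun k x => ?_, fun i k x => ?_⟩
  · have : ⇑(L k) = (fun x => ((k : ℝ) + 1)⁻¹ • x) := funext (hL k)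
    simp only [this]
    exact hχc.comp_homeomorph (Homeomorph.smulOfNeZero _ (inv_ne_zero (hk k).ne'))
  · refine χ.one_of_mem_closedBall ?_
    rw [mem_closedBall_zero_iff, hL, norm_smul, norm_inv, Real.norm_of_nonneg (hk k).le]
    rw [inv_mul_le_iff₀ (hk k)]
    simpa [χ] using hx
  · exact (Real.norm_of_nonneg χ.nonneg).trans_le χ.le_one
  · change ‖iteratedFDeriv ℝ i (χ ∘ L k) x‖ ≤ D i
    rw [(L k).iteratedFDeriv_comp_right hχ x (by exact_mod_cast le_top)]
    refine (ContinuousMultilinearMap.norm_compContinuousLinearMap_le _ _).trans ?_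
    have h1 : ‖L k‖ ≤ 1 := by
      refine ContinuousLinearMap.opNorm_le_bound _ zero_le_one fun y => ?_
      rw [hL, norm_smul, norm_inv, Real.norm_of_nonneg (hk k).le]
      gcongr
      exact inv_le_one_of_one_le₀ (by linarith [k.cast_nonneg (α := ℝ)])
    have h2 : ∏ _j : Fin i, ‖L k‖ ≤ 1 := Finset.prod_le_one (fun _ _ => norm_nonneg _) fun _ _ => h1
    calc _ ≤ ‖iteratedFDeriv ℝ i (χ : E → ℝ) (L k x)‖ * 1 := by gcongr
      _ ≤ D i := by rw [mul_one]; exact hD i _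

/-- The test functions are dense in the Schwartz space. -/
theorem exists_compactSupport_tendsto {F : Type*} [NormedAddCommGroup F] [NormedSpace ℝ F]
    (ψ : 𝓢(E, F)) : ∃ χ : ℕ → 𝓢(E, F),
    (∀ k, HasCompactSupport (χ k)) ∧ Tendsto χ atTop (𝓝 ψ) := by
  obtain ⟨c, D, hc, hcs, h1, -, hD⟩ := exists_cutoff (E := E)
  have hs : ∀ k, HasCompactSupport fun x => c k x • ψ x := fun k => (hcs k).smul_right
  have hsm : ∀ k, ContDiff ℝ ∞ fun x => c k x • ψ x := fun k => (hc k).smul (ψ.smooth ⊤)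
  refine ⟨fun k => (hs k).toSchwartzMap (hsm k), fun k => hs k, ?_⟩
  rw [(schwartz_withSeminorms ℝ E F).tendsto_nhds]
  rintro ⟨p, q⟩ ε hε
  -- The cutoff equals `1` on the ball of radius `k + 1`, so the error lives where `‖x‖ ≥ k + 1`.
  -- There one further power of `‖x‖`, paid for by the seminorm with `p + 1`, yields the factor
  -- `1/(k+1)`; the other factors come from the Leibniz rule.
  let S : ℝ := ∑ i ∈ Finset.range (q + 1), (q.choose i : ℝ) * (1 + D i) *
    SchwartzMap.seminorm ℝ (p + 1) (q - i) ψ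
  have hD0 : ∀ i, 0 ≤ D i := fun i => (norm_nonneg _).trans (hD i 0 0)
  have hS : 0 ≤ S := Finset.sum_nonneg fun i _ => by have := hD0 i; positivity
  have hlim : Tendsto (fun k : ℕ => S * (1 / ((k : ℝ) + 1))) atTop (𝓝 (S * 0)) :=
    tendsto_one_div_add_atTop_nhds_zero_nat.const_mul S
  rw [mul_zero] at hlim
  filter_upwards [hlim.eventually (gt_mem_nhds hε)] with k hk
  refine lt_of_le_of_lt ?_ hk
  have hk0 : (0 : ℝ) < (k : ℝ) + 1 := by positivity
  refine SchwartzMap.seminorm_le_bound ℝ p q _ (by positivity) fun x => ?_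
  let g : E → ℝ := fun y => c k y - 1
  have hg : ContDiff ℝ ∞ g := (hc k).sub contDiff_const
  have hcoe : ⇑((hs k).toSchwartzMap (hsm k) - ψ) = fun y => g y • ψ y := by
    ext y
    rw [sub_apply]
    simp [g, sub_smul]
  rw [hcoe]
  rcases lt_or_ge ‖x‖ (k + 1) with hx | hx
  · have : (fun y => g y • ψ y) =ᶠ[𝓝 x] fun _ => 0 := by
      filter_upwards [(continuous_norm.isOpen_preimage _ isOpen_Iio).mem_nhds
        (show x ∈ norm ⁻¹' Iio ((k : ℝ) + 1) from hx)] with y hy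
      simp [g, h1 k y (le_of_lt hy)]
    rw [(this.iteratedFDeriv ℝ q).eq_of_nhds]
    simp only [iteratedFDeriv_fun_zero, Pi.zero_apply, norm_zero, mul_zero]
    positivity
  have hgi : ∀ i, ‖iteratedFDeriv ℝ i g x‖ ≤ 1 + D i := by
    intro i
    rcases i with _ | i
    · rw [norm_iteratedFDeriv_zero]
      have := hD 0 k x
      rw [norm_iteratedFDeriv_zero] at this
      calc ‖c k x - 1‖ ≤ ‖c k x‖ + ‖(1 : ℝ)‖ := norm_sub_le _ _
        _ ≤ _ := by rw [norm_one]; linarith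
    · have : iteratedFDeriv ℝ (i + 1) g x = iteratedFDeriv ℝ (i + 1) (c k) x := by
        have := iteratedFDeriv_sub_apply (𝕜 := ℝ) (i := i + 1) (x := x) (f := c k) (g := fun _ => (1 : ℝ))
          ((hc k).contDiffAt.of_le (by exact_mod_cast le_top)) contDiffAt_const
        rw [iteratedFDeriv_const_of_ne (by simp)] at this
        simpa [g, Pi.sub_def] using this
      rw [this]
      linarith [hD (i + 1) k x]
  calc ‖x‖ ^ p * ‖iteratedFDeriv ℝ q (fun y => g y • ψ y) x‖
      ≤ ‖x‖ ^ p * ∑ i ∈ Finset.range (q + 1), (q.choose i : ℝ) * ‖iteratedFDeriv ℝ i g x‖ *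
          ‖iteratedFDeriv ℝ (q - i) ψ x‖ := by
        gcongr
        exact norm_iteratedFDeriv_smul_le hg (ψ.smooth ⊤) x (by exact_mod_cast le_top)
    _ = ∑ i ∈ Finset.range (q + 1), (q.choose i : ℝ) * ‖iteratedFDeriv ℝ i g x‖ *
          (‖x‖ ^ p * ‖iteratedFDeriv ℝ (q - i) ψ x‖) := by
        rw [Finset.mul_sum]; exact Finset.sum_congr rfl fun i _ => by ring
    _ ≤ ∑ i ∈ Finset.range (q + 1), (q.choose i : ℝ) * (1 + D i) *
          (SchwartzMap.seminorm ℝ (p + 1) (q - i) ψ * (1 / ((k : ℝ) + 1))) := by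
        refine Finset.sum_le_sum fun i _ => ?_
        have := hD0 i
        refine mul_le_mul (mul_le_mul_of_nonneg_left (hgi i) (Nat.cast_nonneg _)) ?_
          (by positivity) (by positivity)
        refine le_of_le_of_eq ((le_div_iff₀ hk0).2 ?_) (mul_one_div _ _).symm
        calc _ ≤ ‖x‖ ^ p * ‖iteratedFDeriv ℝ (q - i) ψ x‖ * ‖x‖ := by gcongr
          _ = ‖x‖ ^ (p + 1) * ‖iteratedFDeriv ℝ (q - i) ψ x‖ := by ring
          _ ≤ _ := SchwartzMap.le_seminorm ℝ _ _ ψ x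
    _ = S * (1 / ((k : ℝ) + 1)) := by
        rw [Finset.sum_mul]; exact Finset.sum_congr rfl fun i _ => by ring

end Density

end

section

open scoped SchwartzMap FourierTransform LineDeriv

/-! ### Weak relations between `L²` functions, read on the Fourier side. -/

section FourierWeak

variable {n : ℕ} {E : Type*} [NormedAddCommGroup E] [InnerProductSpace ℂ E] [CompleteSpace E]

/-- A real test function as a complex valued Schwartz function. -/
def IsTestFunction.toSchwartz {ψ : Sp n → ℝ} (h : IsTestFunction univ ψ) : 𝓢(Sp n, ℂ) :=
  HasCompactSupport.toSchwartzMap (f := fun x => (ψ x : ℂ)) (h.2.1.comp_left Complex.ofReal_zero)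
    (Complex.ofRealCLM.contDiff.comp h.1)

theorem IsTestFunction.toSchwartz_apply {ψ : Sp n → ℝ} (h : IsTestFunction univ ψ) (x : Sp n) :
    h.toSchwartz x = (ψ x : ℂ) := rfl

theorem IsTestFunction.schwartzDeriv_toSchwartz {ψ : Sp n → ℝ} (h : IsTestFunction univ ψ)
    (α : Fin n → ℕ) : schwartzDeriv α h.toSchwartz = (h.multiDeriv (dir n) α).toSchwartz := by
  ext x
  rw [coe_schwartzDeriv]
  exact congrFun (multiDeriv_comp_clm Complex.ofRealCLM h.1 (dir n) α) x

/-- The symbols of `∂^α ∂^β` and `∂^β ∂^α` agree, so these operators agree. -/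
theorem schwartzDeriv_schwartzDeriv_fourier (α β : Fin n → ℕ) (ψ : 𝓢(Sp n, ℂ)) :
    schwartzDeriv α (schwartzDeriv β (𝓕 ψ)) = 𝓕 (schwartzMul α (schwartzMul β ψ)) := by
  rw [schwartzDeriv_fourier, schwartzDeriv_fourier]

/-- On the Fourier side both orders of differentiation multiply by the same product of symbols. -/
theorem IsTestFunction.multiDeriv_comm {ψ : Sp n → ℝ} (h : IsTestFunction univ ψ)
    (α β : Fin n → ℕ) : ParabolicCauchy.multiDeriv (dir n) α (ParabolicCauchy.multiDeriv (dir n) β ψ) =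
      ParabolicCauchy.multiDeriv (dir n) β (ParabolicCauchy.multiDeriv (dir n) α ψ) := by
  have key : schwartzDeriv α (schwartzDeriv β h.toSchwartz) =
      schwartzDeriv β (schwartzDeriv α h.toSchwartz) := by
    rw [← FourierTransform.fourier_fourierInv_eq (F := 𝓢(Sp n, ℂ)) h.toSchwartz,
      schwartzDeriv_schwartzDeriv_fourier, schwartzDeriv_schwartzDeriv_fourier]
    congr 1
    ext ξ
    simp only [schwartzMul_apply]
    ring
  ext x
  have := congrArg (fun f : 𝓢(Sp n, ℂ) => f x) key
  simp only [h.schwartzDeriv_toSchwartz, (h.multiDeriv _ _).schwartzDeriv_toSchwartz,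
    IsTestFunction.toSchwartz_apply] at this
  exact_mod_cast this

theorem integral_fourier_smul (ψ : 𝓢(Sp n, ℂ)) (F : Lp E 2 (volume : Measure (Sp n))) :
    ∫ x, (𝓕 ψ) x • F x = ∫ ξ, ψ ξ • (𝓕 F) ξ := by
  have := congrArg (fun T => T ψ) (Lp.fourier_toTemperedDistribution_eq F)
  simpa [TemperedDistribution.fourier_apply] using this

theorem integral_schwartzDeriv_smul (α β : Fin n → ℕ) (ψ : 𝓢(Sp n, ℂ))
    (F : Lp E 2 (volume : Measure (Sp n))) :
    ∫ x, (schwartzDeriv α (schwartzDeriv β (𝓕 ψ))) x • F x =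
      ∫ ξ, ψ ξ • (sym α (-ξ) * sym β (-ξ)) • (𝓕 F) ξ := by
  rw [schwartzDeriv_schwartzDeriv_fourier, integral_fourier_smul]
  refine integral_congr_ae (Eventually.of_forall fun ξ => ?_)
  simp only [schwartzMul_apply, smul_smul]
  congr 1
  ring

theorem integrable_schwartz_smul (ψ : 𝓢(Sp n, ℂ)) (F : Lp E 2 (volume : Measure (Sp n))) :
    Integrable fun x => ψ x • F x :=
  memLp_one_iff_integrable.1 ((Lp.memLp F).smul (ψ.memLp 2 volume))

theorem eq_zero_of_forall_isTestFunction {T : 𝓢(Sp n, ℂ) →L[ℂ] E}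
    (h : ∀ ψ : Sp n → ℝ, ∀ hψ : IsTestFunction univ ψ, T hψ.toSchwartz = 0) : T = 0 := by
  ext ψ
  obtain ⟨χ, hχ, hlim⟩ := exists_compactSupport_tendsto ψ
  have hT : ∀ k, T (χ k) = 0 := by
    intro k
    have h1 : IsTestFunction univ fun x => (χ k x).re :=
      ⟨Complex.reCLM.contDiff.comp ((χ k).smooth ⊤), (hχ k).comp_left Complex.zero_re, subset_univ _⟩
    have h2 : IsTestFunction univ fun x => (χ k x).im :=
      ⟨Complex.imCLM.contDiff.comp ((χ k).smooth ⊤), (hχ k).comp_left Complex.zero_im, subset_univ _⟩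
    have : χ k = h1.toSchwartz + Complex.I • h2.toSchwartz := by
      ext x
      simp [IsTestFunction.toSchwartz_apply, mul_comm Complex.I]
    rw [this, map_add, map_smul, h _ h1, h _ h2, smul_zero, add_zero]
  refine tendsto_nhds_unique ((T.continuous.tendsto ψ).comp hlim) ?_
  simp only [Function.comp_def, hT]
  exact tendsto_const_nhds

/-- A linear relation between derivatives of `L²` functions, tested against test functions, is the
corresponding relation between their Fourier transforms. -/
theorem forall_sum_integral_multiDeriv_iff {κ : Type*} [Fintype κ] (α β : κ → Fin n → ℕ)
    (F : κ → Lp E 2 (volume : Measure (Sp n))) :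
    (∀ ψ : Sp n → ℝ, IsTestFunction univ ψ →
      ∑ i, ∫ x, ((multiDeriv (dir n) (α i) (multiDeriv (dir n) (β i) ψ) x : ℝ) : ℂ) • F i x = 0) ↔
    ∀ᵐ ξ, ∑ i, (sym (α i) (-ξ) * sym (β i) (-ξ)) • (𝓕 (F i)) ξ = 0 := by
  -- `T` is the tempered distribution being tested. Evaluated at `𝓕 ψ` it is integration of `ψ`
  -- against the locally integrable function `∑ i, S i`, so both sides of the equivalence say `T =
  -- 0`.
  let T : 𝓢(Sp n, ℂ) →L[ℂ] E := ∑ i, (((F i : 𝓢'(Sp n, E)) : 𝓢(Sp n, ℂ) →L[ℂ] E) ∘L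
    (schwartzDeriv (α i) ∘L schwartzDeriv (β i)))
  have hT : ∀ ψ, T ψ = ∑ i, ∫ x, (schwartzDeriv (α i) (schwartzDeriv (β i) ψ)) x • F i x := by
    intro ψ
    simp only [T, _root_.sum_apply]
    exact Finset.sum_congr rfl fun i _ => Lp.toTemperedDistribution_apply (F i) _
  have hT1 : ∀ ψ : Sp n → ℝ, ∀ hψ : IsTestFunction univ ψ, T hψ.toSchwartz = ∑ i, ∫ x,
      ((multiDeriv (dir n) (α i) (multiDeriv (dir n) (β i) ψ) x : ℝ) : ℂ) • F i x := by
    intro ψ hψ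
    simp only [hT, hψ.schwartzDeriv_toSchwartz, (hψ.multiDeriv _ _).schwartzDeriv_toSchwartz,
      IsTestFunction.toSchwartz_apply]
  let S : κ → Sp n → E := fun i ξ => (sym (α i) (-ξ) * sym (β i) (-ξ)) • (𝓕 (F i)) ξ
  have hint : ∀ i (ψ : 𝓢(Sp n, ℂ)), Integrable fun ξ => ψ ξ • S i ξ := by
    intro i ψ
    have := integrable_schwartz_smul (schwartzMul (α i) (schwartzMul (β i) ψ)) (𝓕 (F i))
    refine this.congr (Eventually.of_forall fun ξ => ?_)
    simp only [schwartzMul_apply, S, smul_smul]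
    congr 1; ring
  have hT2 : ∀ ψ : 𝓢(Sp n, ℂ), T (𝓕 ψ) = ∫ ξ, ψ ξ • ∑ i, S i ξ := by
    intro ψ
    simp only [hT, integral_schwartzDeriv_smul, Finset.smul_sum]
    rw [integral_finsetSum _ fun i _ => hint i ψ]
  have hloc : LocallyIntegrable fun ξ => ∑ i, S i ξ := by
    refine locallyIntegrable_finsetSum _ fun i _ => ?_
    refine ((Lp.memLp (𝓕 (F i))).locallyIntegrable (by norm_num)).continuous_smul ?_
    exact ((continuous_sym _).comp continuous_neg).mul ((continuous_sym _).comp continuous_neg)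
  constructor
  · intro h
    have h0 : T = 0 := eq_zero_of_forall_isTestFunction fun ψ hψ => by rw [hT1, h ψ hψ]
    refine ae_eq_zero_of_integral_contDiff_smul_eq_zero hloc fun g hg hgc => ?_
    have hgt : IsTestFunction univ g := ⟨hg, hgc, subset_univ _⟩
    have := hT2 hgt.toSchwartz
    rw [h0] at this
    simpa [IsTestFunction.toSchwartz_apply] using this.symm
  · intro h ψ hψ
    rw [← hT1 ψ hψ, ← FourierTransform.fourier_fourierInv_eq (F := 𝓢(Sp n, ℂ)) hψ.toSchwartz, hT2]
    refine (integral_congr_ae ?_).trans (integral_zero _ _)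
    filter_upwards [h] with ξ hξ
    simp only [S, hξ, smul_zero]

/-- The Fourier transform commutes with the application of a linear map to the values. -/
theorem fourier_compLp {E' : Type*} [NormedAddCommGroup E'] [InnerProductSpace ℂ E']
    [CompleteSpace E'] (L : E →L[ℂ] E') (F : Lp E 2 (volume : Measure (Sp n))) :
    𝓕 (L.compLp F) = L.compLp (𝓕 F) := by
  apply Lp.ext
  refine ae_eq_of_integral_contDiff_smul_eq ((Lp.memLp _).locallyIntegrable (by norm_num))
    ((Lp.memLp _).locallyIntegrable (by norm_num)) fun g hg hgc => ?_
  have hgt : IsTestFunction univ g := ⟨hg, hgc, subset_univ _⟩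
  have h1 := integral_fourier_smul hgt.toSchwartz (L.compLp F)
  have h2 := congrArg L (integral_fourier_smul hgt.toSchwartz F)
  rw [← L.integral_comp_comm (integrable_schwartz_smul _ _),
    ← L.integral_comp_comm (integrable_schwartz_smul _ _)] at h2
  have h3 : ∀ (ψ : 𝓢(Sp n, ℂ)) (F : Lp E 2 (volume : Measure (Sp n))),
      ∫ x, ψ x • (L.compLp F) x = ∫ x, L (ψ x • F x) := by
    intro ψ F
    refine integral_congr_ae ?_
    filter_upwards [L.coeFn_compLp F] with x hx
    rw [hx, map_smul]
  rw [h3, h2, ← h3] at h1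
  simpa [IsTestFunction.toSchwartz_apply] using h1.symm

end FourierWeak

end

/-! ### Multiplication operators on `L²`. -/

section MulOp

variable {X E E' E'' : Type*} [MeasurableSpace X] {μ : Measure X}
  [NormedAddCommGroup E] [InnerProductSpace ℂ E]
  [NormedAddCommGroup E'] [InnerProductSpace ℂ E']

theorem memLp_clm_apply {A : X → E →L[ℂ] E'} (hA : AEStronglyMeasurable A μ) {c : ℝ}
    (hc : ∀ᵐ x ∂μ, ‖A x‖ ≤ c) {f : X → E} (hf : MemLp f 2 μ) : MemLp (fun x => A x (f x)) 2 μ := by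
  refine hf.of_le_mul (c := c)
    ((ContinuousLinearMap.id ℂ (E →L[ℂ] E')).aestronglyMeasurable_comp₂ hA hf.1) ?_
  filter_upwards [hc] with x hx
  exact (A x).le_of_opNorm_le hx _

/-- The bounded operator `f ↦ A f` on `L²` given by a bounded operator valued function `A`. -/
def mulOp (A : X → E →L[ℂ] E') (c : ℝ) (hA : AEStronglyMeasurable A μ)
    (hc : ∀ᵐ x ∂μ, ‖A x‖ ≤ c) : Lp E 2 μ →L[ℂ] Lp E' 2 μ :=
  LinearMap.mkContinuous
    { toFun := fun f => (memLp_clm_apply hA hc (Lp.memLp f)).toLp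
      map_add' := fun f g => by
        apply Lp.ext
        filter_upwards [Lp.coeFn_add f g, MemLp.coeFn_toLp (memLp_clm_apply hA hc (Lp.memLp (f + g))),
          MemLp.coeFn_toLp (memLp_clm_apply hA hc (Lp.memLp f)),
          MemLp.coeFn_toLp (memLp_clm_apply hA hc (Lp.memLp g)),
          Lp.coeFn_add (memLp_clm_apply hA hc (Lp.memLp f)).toLp
            (memLp_clm_apply hA hc (Lp.memLp g)).toLp] with x h1 h2 h3 h4 h5
        rw [h5, h2, h1]
        simp only [Pi.add_apply, h3, h4, map_add]
      map_smul' := fun k f => by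
        apply Lp.ext
        filter_upwards [Lp.coeFn_smul k f, MemLp.coeFn_toLp (memLp_clm_apply hA hc (Lp.memLp (k • f))),
          MemLp.coeFn_toLp (memLp_clm_apply hA hc (Lp.memLp f)),
          Lp.coeFn_smul k (memLp_clm_apply hA hc (Lp.memLp f)).toLp] with x h1 h2 h3 h5
        rw [RingHom.id_apply, h5, h2, h1]
        simp only [Pi.smul_apply, h3, map_smul] } c
    (fun f => by
      refine Lp.norm_le_mul_norm_of_ae_le_mul ?_
      filter_upwards [hc, MemLp.coeFn_toLp (memLp_clm_apply hA hc (Lp.memLp f))] with x hx h2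
      simp only [LinearMap.coe_mk, AddHom.coe_mk]
      rw [h2]
      exact (A x).le_of_opNorm_le hx _)

variable {A : X → E →L[ℂ] E'} {c : ℝ} {hA : AEStronglyMeasurable A μ} {hc : ∀ᵐ x ∂μ, ‖A x‖ ≤ c}

theorem coeFn_mulOp (f : Lp E 2 μ) : mulOp A c hA hc f =ᵐ[μ] fun x => A x (f x) :=
  MemLp.coeFn_toLp (memLp_clm_apply hA hc (Lp.memLp f))

theorem inner_mulOp {B : X → E' →L[ℂ] E} {c' : ℝ} {hB : AEStronglyMeasurable B μ}
    {hc' : ∀ᵐ x ∂μ, ‖B x‖ ≤ c'} (h : ∀ᵐ x ∂μ, ∀ v w, inner ℂ (A x v) w = inner ℂ v (B x w))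
    (f : Lp E 2 μ) (g : Lp E' 2 μ) :
    inner ℂ (mulOp A c hA hc f) g = inner ℂ f (mulOp B c' hB hc' g) := by
  rw [L2.inner_def, L2.inner_def]
  refine integral_congr_ae ?_
  filter_upwards [h, coeFn_mulOp (hA := hA) (hc := hc) f, coeFn_mulOp (hA := hB) (hc := hc') g]
    with x h1 h2 h3
  rw [h2, h3, h1]

end MulOp

section SmulOp

variable {X E : Type*} [TopologicalSpace X] [MeasurableSpace X] [BorelSpace X]
  [SecondCountableTopology X] {μ : Measure X}
  [NormedAddCommGroup E] [InnerProductSpace ℂ E]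

/-- Multiplication by a bounded continuous function. -/
def smulOp (s : X → ℂ) (c : ℝ) (hs : Continuous s) (hc : ∀ x, ‖s x‖ ≤ c) :
    Lp E 2 μ →L[ℂ] Lp E 2 μ :=
  mulOp (fun x => s x • ContinuousLinearMap.id ℂ E) c
    (hs.smul continuous_const).aestronglyMeasurable
    (Eventually.of_forall fun x => by
      rw [norm_smul]
      exact (mul_le_of_le_one_right (norm_nonneg _) ContinuousLinearMap.norm_id_le).trans (hc x))

variable {s : X → ℂ} {c : ℝ} {hs : Continuous s} {hc : ∀ x, ‖s x‖ ≤ c}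

theorem coeFn_smulOp (f : Lp E 2 μ) : smulOp s c hs hc f =ᵐ[μ] fun x => s x • f x :=
  coeFn_mulOp f

theorem inner_smulOp (hr : ∀ x, starRingEnd ℂ (s x) = s x) (f g : Lp E 2 μ) :
    inner ℂ (smulOp s c hs hc f) g = inner ℂ f (smulOp s c hs hc g) :=
  inner_mulOp (Eventually.of_forall fun x v w => by
    simp [hr, mul_comm]) f g

theorem smulOp_smulOp_comm {s₁ s₂ s₃ s₄ : X → ℂ} {c₁ c₂ c₃ c₄ : ℝ} {hs₁ : Continuous s₁}
    {hs₂ : Continuous s₂} {hs₃ : Continuous s₃} {hs₄ : Continuous s₄} {hc₁ : ∀ x, ‖s₁ x‖ ≤ c₁}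
    {hc₂ : ∀ x, ‖s₂ x‖ ≤ c₂} {hc₃ : ∀ x, ‖s₃ x‖ ≤ c₃} {hc₄ : ∀ x, ‖s₄ x‖ ≤ c₄}
    (h : ∀ x, s₁ x * s₂ x = s₃ x * s₄ x) (f : Lp E 2 μ) :
    smulOp s₁ c₁ hs₁ hc₁ (smulOp s₂ c₂ hs₂ hc₂ f) =
      smulOp s₃ c₃ hs₃ hc₃ (smulOp s₄ c₄ hs₄ hc₄ f) := by
  apply Lp.ext
  filter_upwards [coeFn_smulOp (hs := hs₁) (hc := hc₁) (smulOp s₂ c₂ hs₂ hc₂ f),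
    coeFn_smulOp (hs := hs₂) (hc := hc₂) f,
    coeFn_smulOp (hs := hs₃) (hc := hc₃) (smulOp s₄ c₄ hs₄ hc₄ f),
    coeFn_smulOp (hs := hs₄) (hc := hc₄) f] with x h1 h2 h3 h4
  rw [h1, h2, h3, h4, smul_smul, smul_smul, h]

theorem smulOp_injective (h : ∀ᵐ x ∂μ, s x ≠ 0) {f : Lp E 2 μ} (hf : smulOp s c hs hc f = 0) :
    f = 0 := by
  apply Lp.ext
  filter_upwards [h, coeFn_smulOp (hs := hs) (hc := hc) f, Lp.coeFn_zero E 2 μ] with x h1 h2 h3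
  rw [hf, h3] at h2
  rw [h3]
  exact (smul_eq_zero.1 h2.symm).resolve_left h1

theorem norm_smulOp_le (f : Lp E 2 μ) : ‖smulOp s c hs hc f‖ ≤ c * ‖f‖ := by
  refine Lp.norm_le_mul_norm_of_ae_le_mul ?_
  filter_upwards [coeFn_smulOp (hs := hs) (hc := hc) f] with x h
  rw [h, norm_smul]
  exact mul_le_mul_of_nonneg_right (hc x) (norm_nonneg _)

theorem norm_sq_Lp_two (f : Lp E 2 μ) : ‖f‖ ^ 2 = ∫ x, ‖f x‖ ^ 2 ∂μ := by
  have := congrArg Complex.re (L2.inner_def (𝕜 := ℂ) f f)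
  rw [inner_self_eq_norm_sq_to_K] at this
  have h2 : ∫ x, inner ℂ (f x) (f x) ∂μ = ((∫ x, ‖f x‖ ^ 2 ∂μ : ℝ) : ℂ) := by
    rw [← integral_complex_ofReal]
    refine integral_congr_ae (Eventually.of_forall fun x => ?_)
    simp [inner_self_eq_norm_sq_to_K]
  rw [h2, Complex.ofReal_re] at this
  rw [← this]
  norm_cast

theorem tendsto_smulOp {s : ℕ → X → ℂ} {c : ℝ} {hs : ∀ k, Continuous (s k)}
    {hc : ∀ k x, ‖s k x‖ ≤ c} (h : ∀ᵐ x ∂μ, Tendsto (fun k => s k x) atTop (𝓝 1))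
    (f : Lp E 2 μ) : Tendsto (fun k => smulOp (s k) c (hs k) (hc k) f) atTop (𝓝 f) := by
  have key : Tendsto (fun k => ‖smulOp (s k) c (hs k) (hc k) f - f‖ ^ 2) atTop (𝓝 0) := by
    have h1 : ∀ k, ‖smulOp (s k) c (hs k) (hc k) f - f‖ ^ 2 = ∫ x, ‖(s k x - 1) • f x‖ ^ 2 ∂μ := by
      intro k
      rw [norm_sq_Lp_two]
      refine integral_congr_ae ?_
      filter_upwards [Lp.coeFn_sub (smulOp (s k) c (hs k) (hc k) f) f,
        coeFn_smulOp (hs := hs k) (hc := hc k) f] with x h1 h2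
      rw [h1, Pi.sub_apply, h2, sub_smul, one_smul]
    simp only [h1]
    rw [← integral_zero X ℝ (μ := μ)]
    refine tendsto_integral_of_dominated_convergence (fun x => ((c + 1) * ‖f x‖) ^ 2)
      (fun k => ?_) ?_ (fun k => Eventually.of_forall fun x => ?_) ?_
    · exact ((((hs k).sub continuous_const).aestronglyMeasurable.smul
        (Lp.aestronglyMeasurable f)).norm.pow 2)
    · simp only [mul_pow]
      exact (integrable_norm_sq (Lp.memLp f)).const_mul _
    · rw [Real.norm_of_nonneg (by positivity), norm_smul]
      gcongr
      exact (norm_sub_le _ _).trans (by rw [norm_one]; linarith [hc k x])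
    · filter_upwards [h] with x hx
      have := (((hx.sub_const 1).smul_const (f x)).norm).pow 2
      simpa using this
  rw [tendsto_iff_norm_sub_tendsto_zero]
  have := key.sqrt
  simpa using this

end SmulOp

section

open scoped FourierTransform

/-! ### The symbol `ρ` and its lower bounds. -/

section Symbols

variable {n : ℕ}

variable (m : ℕ) in
/-- The symbol `ρ(ξ) = (∑_{|α| = m} |(2πiξ)^α|²)^{1/2}` of `|∇^m|`. -/
def rho (ξ : Sp n) : ℝ := Real.sqrt (∑ α : MultiIndex n m, ‖sym α.1 ξ‖ ^ 2)

variable {m : ℕ}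

theorem rho_nonneg (ξ : Sp n) : 0 ≤ rho m ξ := Real.sqrt_nonneg _

theorem rho_sq (ξ : Sp n) : rho m ξ ^ 2 = ∑ α : MultiIndex n m, ‖sym α.1 ξ‖ ^ 2 :=
  Real.sq_sqrt (Finset.sum_nonneg fun _ _ => by positivity)

theorem continuous_rho : Continuous (rho m : Sp n → ℝ) :=
  Real.continuous_sqrt.comp (continuous_finsetSum _ fun α _ => ((continuous_sym α.1).norm.pow 2))

theorem MultiIndex.sum_eq (α : MultiIndex n m) : ∑ i, α.1 i = m := (Finset.mem_piAntidiag.1 α.2).1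

theorem sym_neg_multiIndex (α : MultiIndex n m) (ξ : Sp n) :
    sym α.1 (-ξ) = (-1) ^ m * sym α.1 ξ := by
  rw [sym_neg, α.sum_eq]

theorem norm_sym_le_rho (α : MultiIndex n m) (ξ : Sp n) : ‖sym α.1 ξ‖ ≤ rho m ξ :=
  Real.le_sqrt_of_sq_le (Finset.single_le_sum (f := fun α : MultiIndex n m => ‖sym α.1 ξ‖ ^ 2)
    (fun _ _ => by positivity) (Finset.mem_univ α))

theorem norm_two_pi_I_mul (x : ℝ) : ‖2 * Real.pi * Complex.I * (x : ℂ)‖ = 2 * Real.pi * |x| := by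
  simp [abs_of_pos Real.pi_pos]

/-- The pure derivative of order `m` in direction `i` is one of the components of `∇^m`. -/
theorem pow_le_rho (ξ : Sp n) (i : Fin n) : (2 * Real.pi * |ξ i|) ^ m ≤ rho m ξ := by
  have h : Pi.single i m ∈ Finset.piAntidiag (Finset.univ : Finset (Fin n)) m := by
    rw [Finset.mem_piAntidiag]
    exact ⟨by simp, fun _ _ => Finset.mem_univ _⟩
  refine le_trans (le_of_eq ?_) (norm_sym_le_rho (⟨Pi.single i m, h⟩ : MultiIndex n m) ξ)
  rw [sym, norm_prod, Finset.prod_eq_single i]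
  · rw [norm_pow, norm_two_pi_I_mul]
    change _ = _ ^ (Pi.single i m : Fin n → ℕ) i
    rw [Pi.single_eq_same]
  · intro j _ hj
    simp [Pi.single_eq_of_ne hj]
  · simp

theorem rho_pos {ξ : Sp n} (h : ξ ≠ 0) : 0 < rho m ξ := by
  obtain ⟨i, hi⟩ : ∃ i, ξ i ≠ 0 := by
    by_contra! h'
    exact h (by ext i; simpa using h' i)
  refine lt_of_lt_of_le ?_ (pow_le_rho ξ i)
  have := abs_pos.2 hi
  have := Real.pi_pos
  positivity

/-- The largest coordinate of `ξ` dominates, and `r^|γ| ≤ 1 + r^m`. Thus derivatives of lower order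
are controlled by `C` and `ρ C`. -/
theorem norm_sym_le (γ : Fin n → ℕ) (hγ : ∑ i, γ i ≤ m) (ξ : Sp n) :
    ‖sym γ ξ‖ ≤ 1 + rho m ξ := by
  rcases isEmpty_or_nonempty (Fin n) with hn | hn
  · simp [sym, rho_nonneg]
  obtain ⟨j, -, hj⟩ := Finset.exists_max_image Finset.univ (fun i => |ξ i|)
    Finset.univ_nonempty
  have hr := pow_le_rho (m := m) ξ j
  set r := 2 * Real.pi * |ξ j| with hrdef
  have hr0 : 0 ≤ r := by positivity
  have h1 : ‖sym γ ξ‖ ≤ r ^ (∑ i, γ i) := by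
    rw [sym, norm_prod, ← Finset.prod_pow_eq_pow_sum]
    refine Finset.prod_le_prod (fun _ _ => norm_nonneg _) fun i _ => ?_
    rw [norm_pow, norm_two_pi_I_mul]
    have := hj i (Finset.mem_univ i)
    rw [hrdef]
    gcongr
  refine h1.trans ?_
  have := rho_nonneg (m := m) ξ
  rcases le_total r 1 with h | h
  · exact (pow_le_one₀ hr0 h).trans (by linarith)
  · exact (pow_le_pow_right₀ h hγ).trans (by linarith)

/-- The zero set of `ρ` must be negligible. In dimension zero the origin is the whole space and has
positive measure. -/
theorem ae_ne_zero [NeZero n] : ∀ᵐ ξ : Sp n, ξ ≠ 0 := by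
  have : volume {(0 : Sp n)} = 0 := measure_singleton _
  exact compl_mem_ae_iff.2 this

theorem one_add_rho_sq_pos (ξ : Sp n) : 0 < 1 + rho m ξ ^ 2 := by positivity

theorem continuous_div_rho {f : Sp n → ℂ} (hf : Continuous f) :
    Continuous fun ξ => f ξ / ((1 + rho m ξ ^ 2 : ℝ) : ℂ) :=
  hf.div (Complex.continuous_ofReal.comp (continuous_const.add (continuous_rho.pow 2)))
    fun ξ => by exact_mod_cast (one_add_rho_sq_pos ξ).ne'

theorem norm_div_rho_le {z : ℂ} {c : ℝ} {ξ : Sp n} (h : ‖z‖ ≤ c * (1 + rho m ξ ^ 2)) :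
    ‖z / ((1 + rho m ξ ^ 2 : ℝ) : ℂ)‖ ≤ c := by
  rw [norm_div, Complex.norm_real, Real.norm_of_nonneg (one_add_rho_sq_pos ξ).le,
    div_le_iff₀ (one_add_rho_sq_pos ξ)]
  exact h

end Symbols

/-! ### The concrete multipliers built from `ρ`. -/

section ConcreteSystem

variable {n : ℕ} (m : ℕ) {E : Type*} [NormedAddCommGroup E] [InnerProductSpace ℂ E]

/-- Multiplication by `f / (1 + ρ²)`. -/
def divOp (f : Sp n → ℂ) (c : ℝ) (hf : Continuous f) (hc : ∀ ξ, ‖f ξ‖ ≤ c * (1 + rho m ξ ^ 2)) :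
    Lp E 2 (volume : Measure (Sp n)) →L[ℂ] Lp E 2 (volume : Measure (Sp n)) :=
  smulOp _ c (continuous_div_rho hf) fun ξ => norm_div_rho_le (hc ξ)

/-- The multiplier `ρ/(1+ρ²)`. -/
def sigmaSym (ξ : Sp n) : ℝ := rho m ξ / (1 + rho m ξ ^ 2)

variable {m}

theorem sigmaSym_nonneg (ξ : Sp n) : 0 ≤ sigmaSym m ξ :=
  div_nonneg (rho_nonneg ξ) (one_add_rho_sq_pos ξ).le

theorem continuous_sigmaSym : Continuous (sigmaSym m : Sp n → ℝ) :=
  continuous_rho.div (continuous_const.add (continuous_rho.pow 2))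
    fun ξ => (one_add_rho_sq_pos ξ).ne'

theorem sigmaSym_pos {ξ : Sp n} (h : ξ ≠ 0) : 0 < sigmaSym m ξ :=
  div_pos (rho_pos h) (one_add_rho_sq_pos ξ)

theorem cutoffSym_pos (k : ℕ) (ξ : Sp n) : 0 < sigmaSym m ξ + 1 / ((k : ℝ) + 1) :=
  add_pos_of_nonneg_of_pos (sigmaSym_nonneg ξ) (by positivity)

/-- The multiplier `σ / (σ + 1/(k+1))`, an approximation of `1`. -/
def approxSym (m k : ℕ) (ξ : Sp n) : ℝ := (sigmaSym m ξ + 1 / ((k : ℝ) + 1))⁻¹ * sigmaSym m ξ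

theorem continuous_approxSym (k : ℕ) : Continuous fun ξ : Sp n => (approxSym m k ξ : ℂ) :=
  Complex.continuous_ofReal.comp (((continuous_sigmaSym.add continuous_const).inv₀ fun ξ =>
    (cutoffSym_pos k ξ).ne').mul continuous_sigmaSym)

theorem norm_approxSym_le (k : ℕ) (ξ : Sp n) : ‖(approxSym m k ξ : ℂ)‖ ≤ 1 := by
  have h1 := cutoffSym_pos (m := m) k ξ
  have h2 := sigmaSym_nonneg (m := m) ξ
  rw [Complex.norm_real, approxSym, Real.norm_of_nonneg (by positivity), inv_mul_le_iff₀ h1]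
  have : 0 < 1 / ((k : ℝ) + 1) := by positivity
  linarith

theorem tendsto_approxSym {ξ : Sp n} (h : ξ ≠ 0) :
    Tendsto (fun k => (approxSym m k ξ : ℂ)) atTop (𝓝 1) := by
  have h0 := (sigmaSym_pos (m := m) h).ne'
  have h1 : Tendsto (fun k => approxSym m k ξ) atTop (𝓝 ((sigmaSym m ξ + 0)⁻¹ * sigmaSym m ξ)) :=
    ((tendsto_one_div_add_atTop_nhds_zero_nat.const_add _).inv₀ (by rwa [add_zero])).mul_const _
  rw [add_zero, inv_mul_cancel₀ h0] at h1
  exact (Complex.continuous_ofReal.tendsto 1).comp h1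

/-- `Q k σ` is a multiplier with values in `[0,1]` that converges to `1` off the origin;
contractivity and strong convergence follow. -/
theorem smulOp_eq_approx (k : ℕ) {c₁ c₂ : ℝ} {hs₁ hs₂ hc₁ hc₂}
    (f : Lp E 2 (volume : Measure (Sp n))) :
    smulOp (fun ξ => (((sigmaSym m ξ + 1 / ((k : ℝ) + 1))⁻¹ : ℝ) : ℂ)) c₁ hs₁ hc₁
      (divOp m (fun ξ => (rho m ξ : ℂ)) c₂ hs₂ hc₂ f) =
      smulOp (fun ξ => (approxSym m k ξ : ℂ)) 1 (continuous_approxSym k) (norm_approxSym_le k) f := by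
  apply Lp.ext
  filter_upwards [coeFn_smulOp (hs := hs₁) (hc := hc₁) (divOp m (fun ξ => (rho m ξ : ℂ)) c₂ hs₂ hc₂ f),
    coeFn_smulOp (hs := continuous_div_rho hs₂) (hc := fun ξ => norm_div_rho_le (hc₂ ξ)) f,
    coeFn_smulOp (hs := continuous_approxSym k) (hc := norm_approxSym_le (m := m) k) f]
    with ξ h1 h2 h3
  rw [h1, h3]
  erw [h2]
  rw [smul_smul, approxSym, sigmaSym]
  push_cast
  rfl

variable (m n E) in
/-- The multiplication operators by `ρ²/(1+ρ²)`, `1/(1+ρ²)`, `ρ/(1+ρ²)` on `L²`. -/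
def rhoSystem [NeZero n] : MultSystem (Lp E 2 (volume : Measure (Sp n))) where
  a := divOp m (fun ξ => ((rho m ξ ^ 2 : ℝ) : ℂ)) 1
    (Complex.continuous_ofReal.comp (continuous_rho.pow 2))
    (fun ξ => by
      rw [Complex.norm_real, Real.norm_of_nonneg (by positivity)]
      linarith)
  b := divOp m (fun ξ => 1) 1 continuous_const (fun ξ => by
      rw [norm_one]
      nlinarith [sq_nonneg (rho m ξ)])
  σ := divOp m (fun ξ => (rho m ξ : ℂ)) 1 (Complex.continuous_ofReal.comp continuous_rho)
    (fun ξ => by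
      rw [Complex.norm_real, Real.norm_of_nonneg (rho_nonneg ξ)]
      nlinarith [sq_nonneg (rho m ξ - 1)])
  -- The shift by `1/(k+1)` makes the inverse of `σ` bounded, by `k + 1`, because `σ ≥ 0`.
  Q k := smulOp (fun ξ => (((sigmaSym m ξ + 1 / ((k : ℝ) + 1))⁻¹ : ℝ) : ℂ))
    ((k : ℝ) + 1)
    (Complex.continuous_ofReal.comp ((continuous_sigmaSym.add continuous_const).inv₀ fun ξ =>
        (cutoffSym_pos k ξ).ne'))
    (fun ξ => by
      have := sigmaSym_nonneg (m := m) ξ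
      rw [Complex.norm_real, Real.norm_of_nonneg (by positivity)]
      refine inv_le_of_inv_le₀ (by positivity) ?_
      rw [one_div]
      linarith)
  a_sa := inner_smulOp fun ξ => by rw [← Complex.ofReal_div, Complex.conj_ofReal]
  b_sa := inner_smulOp fun ξ => by
    rw [← Complex.ofReal_one, ← Complex.ofReal_div, Complex.conj_ofReal]
  σ_sa := inner_smulOp fun ξ => by rw [← Complex.ofReal_div, Complex.conj_ofReal]
  Q_sa k := inner_smulOp fun ξ => Complex.conj_ofReal _
  ab := smulOp_smulOp_comm fun ξ => by push_cast; ring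
  ba := smulOp_smulOp_comm fun ξ => by push_cast; ring
  Qa k := smulOp_smulOp_comm fun ξ => mul_comm _ _
  Qσ k := smulOp_smulOp_comm fun ξ => mul_comm _ _
  bσ := smulOp_smulOp_comm fun ξ => mul_comm _ _
  b_inj x := smulOp_injective (Eventually.of_forall fun ξ => by
    have := (one_add_rho_sq_pos (m := m) ξ).ne'
    exact div_ne_zero one_ne_zero (by exact_mod_cast this))
  σ_inj x := smulOp_injective (by
    filter_upwards [ae_ne_zero (n := n)] with ξ hξ
    have := (one_add_rho_sq_pos (m := m) ξ).ne'
    have h2 := (rho_pos (m := m) hξ).ne'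
    exact div_ne_zero (by exact_mod_cast h2) (by exact_mod_cast this))
  P_le k x := by
    rw [smulOp_eq_approx]
    exact (norm_smulOp_le x).trans_eq (one_mul _)
  P_tendsto x := by
    simp only [smulOp_eq_approx]
    exact tendsto_smulOp (by
      filter_upwards [ae_ne_zero (n := n)] with ξ hξ using tendsto_approxSym hξ) x

end ConcreteSystem

/-! ### The pointwise symbol of `∇^m |∇^m|⁻¹` and its adjoint. -/

section GradOps

variable {n m N : ℕ}

/-- The components `(w_α^i)_i` of a gradient. -/
def gradProj (α : MultiIndex n m) : Grad n m N →L[ℂ] St N :=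
  LinearMap.toContinuousLinearMap
    { toFun := fun w => WithLp.toLp 2 fun i => w (α, i)
      map_add' := fun _ _ => rfl
      map_smul' := fun _ _ => rfl }

open scoped Classical in
/-- The gradient with components `v` in position `α` and `0` elsewhere. -/
def gradIncl (α : MultiIndex n m) : St N →L[ℂ] Grad n m N :=
  LinearMap.toContinuousLinearMap
    { toFun := fun v => WithLp.toLp 2 fun a => if a.1 = α then v a.2 else 0
      map_add' := fun v w => by ext a; by_cases h : a.1 = α <;> simp [h]
      map_smul' := fun c v => by ext a; by_cases h : a.1 = α <;> simp [h] }

theorem gradProj_apply (α : MultiIndex n m) (w : Grad n m N) (i : Fin N) :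
    gradProj α w i = w (α, i) := rfl

open scoped Classical in
theorem gradIncl_apply (α : MultiIndex n m) (v : St N) (a : MultiIndex n m × Fin N) :
    gradIncl α v a = if a.1 = α then v a.2 else 0 := rfl

theorem inner_grad (w w' : Grad n m N) :
    inner ℂ w w' = ∑ α, inner ℂ (gradProj α w) (gradProj α w') := by
  simp only [PiLp.inner_apply, gradProj_apply]
  exact Fintype.sum_prod_type _

theorem grad_ext {w w' : Grad n m N} (h : ∀ α, gradProj α w = gradProj α w') : w = w' := by
  ext ⟨α, i⟩
  exact congrArg (fun v : St N => v i) (h α)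

open scoped Classical in
theorem gradProj_gradIncl (α β : MultiIndex n m) (v : St N) :
    gradProj α (gradIncl β v) = if α = β then v else 0 := by
  ext i
  rw [gradProj_apply, gradIncl_apply]
  split_ifs <;> rfl

/-- The unit vector `sym α / ρ`. -/
def unitSym (α : MultiIndex n m) (ξ : Sp n) : ℂ := sym α.1 ξ / (rho m ξ : ℂ)

theorem measurable_unitSym (α : MultiIndex n m) : Measurable (unitSym α : Sp n → ℂ) :=
  (continuous_sym _).measurable.div (Complex.continuous_ofReal.comp continuous_rho).measurable

theorem sum_conj_unitSym_mul {ξ : Sp n} (h : ξ ≠ 0) :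
    ∑ α : MultiIndex n m, starRingEnd ℂ (unitSym α ξ) * unitSym α ξ = 1 := by
  have h0 : (rho m ξ : ℂ) ≠ 0 := by exact_mod_cast (rho_pos h).ne'
  have h1 : ∀ α : MultiIndex n m, starRingEnd ℂ (unitSym α ξ) * unitSym α ξ =
      ((‖sym α.1 ξ‖ ^ 2 : ℝ) : ℂ) / (rho m ξ : ℂ) ^ 2 := by
    intro α
    rw [mul_comm, Complex.mul_conj, Complex.normSq_eq_norm_sq, unitSym, norm_div, Complex.norm_real,
      Real.norm_of_nonneg (rho_nonneg ξ)]
    push_cast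
    ring
  rw [Finset.sum_congr rfl fun α _ => h1 α, ← Finset.sum_div, ← Complex.ofReal_sum, ← rho_sq]
  push_cast
  field_simp

theorem unitSym_mul_rho (α : MultiIndex n m) {ξ : Sp n} (h : ξ ≠ 0) :
    unitSym α ξ * rho m ξ = sym α.1 ξ :=
  div_mul_cancel₀ _ (by exact_mod_cast (rho_pos h).ne')

/-- The symbol of `R = ∇^m |∇^m|⁻¹`. -/
def gradSym (ξ : Sp n) : St N →L[ℂ] Grad n m N := ∑ α, unitSym α ξ • gradIncl α

/-- The adjoint of `gradSym`. -/
def divSym (ξ : Sp n) : Grad n m N →L[ℂ] St N := ∑ α, starRingEnd ℂ (unitSym α ξ) • gradProj α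

theorem gradProj_gradSym (α : MultiIndex n m) (ξ : Sp n) (v : St N) :
    gradProj α (gradSym ξ v) = unitSym α ξ • v := by
  classical
  simp [gradSym, _root_.sum_apply, gradProj_gradIncl]

theorem divSym_apply (ξ : Sp n) (w : Grad n m N) :
    divSym ξ w = ∑ α, starRingEnd ℂ (unitSym α ξ) • gradProj α w := by
  simp [divSym, _root_.sum_apply]

theorem inner_gradSym (ξ : Sp n) (v : St N) (w : Grad n m N) :
    inner ℂ (gradSym ξ v) w = inner ℂ v (divSym ξ w) := by
  simp only [inner_grad, gradProj_gradSym, divSym_apply, inner_smul_left, inner_sum,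
    inner_smul_right]

theorem divSym_gradSym {ξ : Sp n} (h : ξ ≠ 0) (v : St N) :
    divSym ξ (gradSym (m := m) ξ v) = v := by
  simp only [divSym_apply, gradProj_gradSym, smul_smul, ← Finset.sum_smul, sum_conj_unitSym_mul h,
    one_smul]

theorem norm_gradSym_apply {ξ : Sp n} (h : ξ ≠ 0) (v : St N) : ‖gradSym (m := m) ξ v‖ = ‖v‖ := by
  have : inner ℂ (gradSym (m := m) ξ v) (gradSym (m := m) ξ v) = inner ℂ v v := by
    rw [inner_gradSym, divSym_gradSym h]
  rw [inner_self_eq_norm_sq_to_K, inner_self_eq_norm_sq_to_K] at this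
  have h2 : ‖gradSym (m := m) ξ v‖ ^ 2 = ‖v‖ ^ 2 := by exact_mod_cast this
  exact (sq_eq_sq₀ (norm_nonneg _) (norm_nonneg _)).1 h2

theorem norm_gradSym_le {ξ : Sp n} (h : ξ ≠ 0) : ‖(gradSym ξ : St N →L[ℂ] Grad n m N)‖ ≤ 1 :=
  ContinuousLinearMap.opNorm_le_bound _ zero_le_one fun v => by rw [norm_gradSym_apply h, one_mul]

theorem norm_divSym_le {ξ : Sp n} (h : ξ ≠ 0) : ‖(divSym ξ : Grad n m N →L[ℂ] St N)‖ ≤ 1 := by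
  refine ContinuousLinearMap.opNorm_le_bound _ zero_le_one fun w => ?_
  have h1 : ‖divSym ξ w‖ ^ 2 ≤ ‖divSym ξ w‖ * ‖w‖ := by
    have h2 : ((‖divSym ξ w‖ ^ 2 : ℝ) : ℂ) = inner ℂ (gradSym ξ (divSym ξ w)) w := by
      rw [inner_gradSym, inner_self_eq_norm_sq_to_K]
      norm_cast
    have h3 := congrArg norm h2
    rw [Complex.norm_real, Real.norm_of_nonneg (by positivity)] at h3
    rw [h3, ← norm_gradSym_apply (m := m) h]
    exact norm_inner_le_norm _ _
  rw [one_mul]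
  rcases (norm_nonneg (divSym ξ w)).eq_or_lt with h0 | h0
  · rw [← h0]; positivity
  · rw [sq] at h1
    exact le_of_mul_le_mul_left h1 h0

theorem measurable_gradSym : AEStronglyMeasurable
    (gradSym : Sp n → St N →L[ℂ] Grad n m N) volume := by
  unfold gradSym
  exact Finset.aestronglyMeasurable_fun_sum _ fun α _ =>
    (measurable_unitSym α).aestronglyMeasurable.smul aestronglyMeasurable_const

theorem measurable_divSym : AEStronglyMeasurable
    (divSym : Sp n → Grad n m N →L[ℂ] St N) volume := by
  unfold divSym
  exact Finset.aestronglyMeasurable_fun_sum _ fun α _ =>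
    (Complex.continuous_conj.measurable.comp (measurable_unitSym α)).aestronglyMeasurable.smul
      aestronglyMeasurable_const

end GradOps

end

section

open scoped FourierTransform

/-! ### The isometry `riesz` from `L²` into gradients. -/

section Riesz

variable {n m N : ℕ}

variable (n N) in
/-- The space `L²(ℝⁿ; ℂ^N)`. -/
abbrev L2St : Type := Lp (St N) 2 (volume : Measure (Sp n))

variable (n m N) in
/-- The space `L²` of gradients. -/
abbrev L2Grad : Type := Lp (Grad n m N) 2 (volume : Measure (Sp n))

theorem ae_norm_gradSym_le [NeZero n] :
    ∀ᵐ ξ : Sp n, ‖(gradSym ξ : St N →L[ℂ] Grad n m N)‖ ≤ 1 := by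
  filter_upwards [ae_ne_zero (n := n)] with ξ hξ using norm_gradSym_le hξ

theorem ae_norm_divSym_le [NeZero n] :
    ∀ᵐ ξ : Sp n, ‖(divSym ξ : Grad n m N →L[ℂ] St N)‖ ≤ 1 := by
  filter_upwards [ae_ne_zero (n := n)] with ξ hξ using norm_divSym_le hξ

variable [NeZero n]

variable (n m N) in
/-- The isometry `d ↦ ∇^m |∇^m|⁻¹ 𝓕⁻¹ d`. -/
def riesz : L2St n N →L[ℂ] L2Grad n m N :=
  (FourierTransform.fourierInvCLM ℂ (L2Grad n m N)).comp
    (mulOp gradSym 1 measurable_gradSym ae_norm_gradSym_le)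

variable (n m N) in
/-- The adjoint of `riesz`. -/
def rieszAdj : L2Grad n m N →L[ℂ] L2St n N :=
  (mulOp divSym 1 measurable_divSym ae_norm_divSym_le).comp
    (FourierTransform.fourierCLM ℂ (L2Grad n m N))

theorem fourier_riesz (d : L2St n N) : 𝓕 (riesz n m N d) =
    mulOp gradSym 1 measurable_gradSym ae_norm_gradSym_le d :=
  FourierTransform.fourier_fourierInv_eq _

theorem gradProj_fourier_riesz (α : MultiIndex n m) (d : L2St n N) :
    ∀ᵐ ξ, gradProj α ((𝓕 (riesz n m N d)) ξ) = unitSym α ξ • d ξ := by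
  rw [fourier_riesz]
  filter_upwards [coeFn_mulOp (hA := measurable_gradSym) (hc := ae_norm_gradSym_le (m := m)) d]
    with ξ h
  rw [h, gradProj_gradSym]

theorem rieszAdj_apply (G : L2Grad n m N) :
    ∀ᵐ ξ, rieszAdj n m N G ξ = ∑ α, starRingEnd ℂ (unitSym α ξ) • gradProj α ((𝓕 G) ξ) := by
  filter_upwards [coeFn_mulOp (hA := measurable_divSym) (hc := ae_norm_divSym_le) (𝓕 G)] with ξ h
  rw [← divSym_apply, ← h]
  rfl

theorem inner_riesz (d : L2St n N) (G : L2Grad n m N) :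
    inner ℂ (riesz n m N d) G = inner ℂ d (rieszAdj n m N G) := by
  rw [← Lp.inner_fourier_eq, fourier_riesz]
  exact inner_mulOp (hB := measurable_divSym) (hc' := ae_norm_divSym_le)
    (Eventually.of_forall inner_gradSym) _ _

theorem rieszAdj_riesz (d : L2St n N) : rieszAdj n m N (riesz n m N d) = d := by
  apply Lp.ext
  filter_upwards [rieszAdj_apply (riesz n m N d), ae_ne_zero (n := n),
    ae_all_iff.2 fun α => gradProj_fourier_riesz (m := m) α d] with ξ h1 h2 h3
  rw [h1]
  rw [Finset.sum_congr rfl fun α _ => by rw [h3 α, smul_smul], ← Finset.sum_smul,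
    sum_conj_unitSym_mul h2, one_smul]

theorem norm_riesz (d : L2St n N) : ‖riesz n m N d‖ = ‖d‖ := by
  have := inner_riesz d (riesz n m N d)
  rw [rieszAdj_riesz, inner_self_eq_norm_sq_to_K, inner_self_eq_norm_sq_to_K] at this
  have h2 : ‖riesz n m N d‖ ^ 2 = ‖d‖ ^ 2 := by exact_mod_cast this
  exact (sq_eq_sq₀ (norm_nonneg _) (norm_nonneg _)).1 h2

theorem coeFn_divOp {f : Sp n → ℂ} {c : ℝ} {hf : Continuous f}
    {hc : ∀ ξ, ‖f ξ‖ ≤ c * (1 + rho m ξ ^ 2)} (d : L2St n N) :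
    divOp m f c hf hc d =ᵐ[volume] fun ξ => (f ξ / ((1 + rho m ξ ^ 2 : ℝ) : ℂ)) • d ξ :=
  coeFn_smulOp (hs := continuous_div_rho hf) (hc := fun ξ => norm_div_rho_le (hc ξ)) d

theorem rhoSystem_b_apply (d : L2St n N) :
    ∀ᵐ ξ, (rhoSystem n m (St N)).b d ξ = (1 / ((1 + rho m ξ ^ 2 : ℝ) : ℂ)) • d ξ := by
  simp only [rhoSystem]
  exact coeFn_divOp d

theorem rhoSystem_σ_apply (d : L2St n N) :
    ∀ᵐ ξ, (rhoSystem n m (St N)).σ d ξ = ((rho m ξ : ℂ) / ((1 + rho m ξ ^ 2 : ℝ) : ℂ)) • d ξ := by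
  simp only [rhoSystem]
  exact coeFn_divOp d

theorem rhoSystem_a_apply (d : L2St n N) :
    ∀ᵐ ξ, (rhoSystem n m (St N)).a d ξ =
      (((rho m ξ ^ 2 : ℝ) : ℂ) / ((1 + rho m ξ ^ 2 : ℝ) : ℂ)) • d ξ := by
  simp only [rhoSystem]
  exact coeFn_divOp d

/-- The relation `b d = σ C` means `d = ρ C`. -/
theorem rhoSystem_b_eq_σ_iff (C d : L2St n N) :
    (rhoSystem n m (St N)).σ C = (rhoSystem n m (St N)).b d ↔
      ∀ᵐ ξ, d ξ = (rho m ξ : ℂ) • C ξ := by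
  have key : ∀ (ξ : Sp n) (x y : St N), ((rho m ξ : ℂ) / ((1 + rho m ξ ^ 2 : ℝ) : ℂ)) • x =
      (1 / ((1 + rho m ξ ^ 2 : ℝ) : ℂ)) • y ↔ y = (rho m ξ : ℂ) • x := by
    intro ξ x y
    have h0 : (1 / ((1 + rho m ξ ^ 2 : ℝ) : ℂ)) ≠ 0 :=
      div_ne_zero one_ne_zero (by exact_mod_cast (one_add_rho_sq_pos ξ).ne')
    rw [div_eq_mul_one_div, mul_comm, mul_smul, smul_right_inj h0]
    exact eq_comm
  constructor
  · intro h
    filter_upwards [rhoSystem_b_apply (m := m) d, rhoSystem_σ_apply (m := m) C] with ξ h1 h2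
    rw [← key, ← h1, ← h2, h]
  · intro h
    apply Lp.ext
    filter_upwards [rhoSystem_b_apply (m := m) d, rhoSystem_σ_apply (m := m) C, h] with ξ h1 h2 h3
    rw [h1, h2, key, h3]

/-- The hypothesis means `d = ρ C`, and the factor `ρ` cancels the denominator of the unit symbol.
Hence `riesz d` is the true gradient of `𝓕⁻¹ C`. -/
theorem gradProj_fourier_riesz_of_σ_eq {C d : L2St n N}
    (h : (rhoSystem n m (St N)).σ C = (rhoSystem n m (St N)).b d) (α : MultiIndex n m) :
    ∀ᵐ ξ, gradProj α ((𝓕 (riesz n m N d)) ξ) = sym α.1 ξ • C ξ := by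
  filter_upwards [(rhoSystem_b_eq_σ_iff C d).1 h, gradProj_fourier_riesz (m := m) α d,
    ae_ne_zero (n := n)] with ξ h1 h2 h3
  rw [h2, h1, smul_smul, unitSym_mul_rho α h3]

end Riesz

/-! ### Weak derivatives: Fourier characterisation and uniqueness. -/

section WeakDeriv

variable {n : ℕ}

/-- The general criterion with two terms. The sign in the definition of a weak derivative cancels
the one from evaluating `sym γ` at `-ξ`. -/
theorem forall_integral_multiDeriv_smul_iff {N : ℕ} (γ : Fin n → ℕ) (f g : L2St n N) :
    (∀ ψ : Sp n → ℝ, IsTestFunction univ ψ → ∫ x, multiDeriv (dir n) γ ψ x • f x =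
      (-1 : ℝ) ^ (∑ i, γ i) • ∫ x, ψ x • g x) ↔ ∀ᵐ ξ, sym γ ξ • (𝓕 f) ξ = (𝓕 g) ξ := by
  have key := forall_sum_integral_multiDeriv_iff (κ := Bool) (fun b => cond b γ 0) (fun _ => 0)
    (fun b => cond b f ((-(-1 : ℂ) ^ (∑ i, γ i)) • g))
  simp only [Fintype.sum_bool, cond_true, cond_false, multiDeriv_zero, sym_zero, mul_one,
    one_smul, FourierTransform.fourier_smul, sym_neg γ] at key
  have hr : ∀ (r : ℝ) (v : St N), r • v = (r : ℂ) • v := fun r v => (Complex.coe_smul r v).symm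
  constructor
  · intro h
    have := key.1 fun ψ hψ => by
      have h1 := h ψ hψ
      have h2 : ∫ x, (ψ x : ℂ) • ((-(-1 : ℂ) ^ (∑ i, γ i)) • g) x =
          (-(-1 : ℂ) ^ (∑ i, γ i)) • ∫ x, (ψ x : ℂ) • g x := by
        rw [← integral_smul]
        refine integral_congr_ae ?_
        filter_upwards [Lp.coeFn_smul (-(-1 : ℂ) ^ (∑ i, γ i)) g] with x hx
        rw [hx, Pi.smul_apply, smul_comm]
      simp only [hr] at h1
      rw [h1, h2]
      push_cast
      rw [neg_smul, add_neg_cancel]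
    filter_upwards [this, Lp.coeFn_smul (-(-1 : ℂ) ^ (∑ i, γ i)) (𝓕 g)] with ξ h1 h2
    rw [h2, Pi.smul_apply, mul_smul, neg_smul, ← sub_eq_add_neg, ← smul_sub] at h1
    have h3 := (smul_eq_zero.1 h1).resolve_left (pow_ne_zero _ (by norm_num))
    exact sub_eq_zero.1 h3
  · intro h ψ hψ
    have := key.2 (by
      filter_upwards [h, Lp.coeFn_smul (-(-1 : ℂ) ^ (∑ i, γ i)) (𝓕 g)] with ξ h1 h2
      rw [h2, Pi.smul_apply, mul_smul, h1, neg_smul, add_neg_cancel]) ψ hψ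
    have h2 : ∫ x, (ψ x : ℂ) • ((-(-1 : ℂ) ^ (∑ i, γ i)) • g) x =
        (-(-1 : ℂ) ^ (∑ i, γ i)) • ∫ x, (ψ x : ℂ) • g x := by
      rw [← integral_smul]
      refine integral_congr_ae ?_
      filter_upwards [Lp.coeFn_smul (-(-1 : ℂ) ^ (∑ i, γ i)) g] with x hx
      rw [hx, Pi.smul_apply, smul_comm]
    rw [h2, neg_smul, add_neg_eq_zero] at this
    simp only [hr]
    rw [this]
    push_cast
    rfl

theorem hasWeakDerivOn_univ {N : ℕ} {γ : Fin n → ℕ} {f g : L2St n N}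
    (h : ∀ᵐ ξ, sym γ ξ • (𝓕 f) ξ = (𝓕 g) ξ) : HasWeakDerivOn (dir n) univ γ f g := by
  refine ⟨((Lp.memLp f).locallyIntegrable (by norm_num)).locallyIntegrableOn _,
    ((Lp.memLp g).locallyIntegrable (by norm_num)).locallyIntegrableOn _, fun ψ hψ => ?_⟩
  rw [Measure.restrict_univ]
  exact (forall_integral_multiDeriv_smul_iff γ f g).2 h ψ hψ

variable {E F : Type*} [NormedAddCommGroup E] [NormedSpace ℝ E] [FiniteDimensional ℝ E]
  [MeasureSpace E] [BorelSpace E] [NormedAddCommGroup F] [NormedSpace ℝ F] [CompleteSpace F]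
  {e : Fin n → E} {Q : Set E} {γ : Fin n → ℕ} {u u' g g' : E → F}

/-- Test functions supported in `Q` do not see the complement of `Q`. -/
theorem setIntegral_testFunction_smul {φ : E → ℝ} (hφ : tsupport φ ⊆ Q) (g : E → F) :
    ∫ p in Q, φ p • g p = ∫ p, φ p • g p :=
  setIntegral_eq_integral_of_forall_compl_eq_zero fun p hp => by
    rw [image_eq_zero_of_notMem_tsupport fun h => hp (hφ h), zero_smul]

theorem ae_eq_of_forall_integral_smul_eq (hQ : IsOpen Q) (hg : LocallyIntegrableOn g Q)
    (hg' : LocallyIntegrableOn g' Q) (h : ∀ φ : E → ℝ, IsTestFunction Q φ →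
      ∫ p in Q, φ p • g p = ∫ p in Q, φ p • g' p) : g =ᵐ[volume.restrict Q] g' := by
  have key := hQ.ae_eq_zero_of_integral_contDiff_smul_eq_zero (hg.sub hg') fun φ h1 h2 h3 => by
    have hφ : IsTestFunction Q φ := ⟨h1, h2, h3⟩
    have := h φ hφ
    rw [setIntegral_testFunction_smul h3, setIntegral_testFunction_smul h3] at this
    simp only [Pi.sub_apply, smul_sub]
    rw [integral_sub (hφ.integrable_smul hQ hg) (hφ.integrable_smul hQ hg'), this, sub_self]
  rw [EventuallyEq, ae_restrict_iff' hQ.measurableSet]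
  filter_upwards [key] with p hp hpQ
  exact sub_eq_zero.1 (hp hpQ)

theorem HasWeakDerivOn.ae_eq (hQ : IsOpen Q) (h : HasWeakDerivOn e Q γ u g)
    (h' : HasWeakDerivOn e Q γ u g') : g =ᵐ[volume.restrict Q] g' := by
  refine ae_eq_of_forall_integral_smul_eq hQ h.2.1 h'.2.1 fun φ hφ => ?_
  have := (h.2.2 φ hφ).symm.trans (h'.2.2 φ hφ)
  exact smul_right_injective F (pow_ne_zero _ (by norm_num : (-1 : ℝ) ≠ 0)) this

theorem weakDeriv_spec (h : HasWeakDerivOn e Q γ u g) :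
    HasWeakDerivOn e Q γ u (weakDeriv e Q γ u) := by
  have hex : ∃ g, HasWeakDerivOn e Q γ u g := ⟨g, h⟩
  rw [weakDeriv, dif_pos hex]
  exact hex.choose_spec

theorem weakDeriv_ae_eq (hQ : IsOpen Q) (h : HasWeakDerivOn e Q γ u g) :
    weakDeriv e Q γ u =ᵐ[volume.restrict Q] g :=
  (weakDeriv_spec h).ae_eq hQ h

theorem locallyIntegrableOn_congr (h : u =ᵐ[volume.restrict Q] u')
    (hu : LocallyIntegrableOn u Q) : LocallyIntegrableOn u' Q := fun x hx =>
  let ⟨s, hs, hi⟩ := hu x hx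
  ⟨s ∩ Q, inter_mem hs self_mem_nhdsWithin, (hi.mono_set inter_subset_left).congr
    (ae_mono (Measure.restrict_mono inter_subset_right le_rfl) h)⟩

theorem HasWeakDerivOn.congr (h : HasWeakDerivOn e Q γ u g) (hu : u =ᵐ[volume.restrict Q] u')
    (hg : g =ᵐ[volume.restrict Q] g') : HasWeakDerivOn e Q γ u' g' := by
  refine ⟨locallyIntegrableOn_congr hu h.1, locallyIntegrableOn_congr hg h.2.1, fun φ hφ => ?_⟩
  have := h.2.2 φ hφ
  rwa [integral_congr_ae (hu.mono fun p hp => congrArg (fun v => multiDeriv e γ φ p • v) hp),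
    integral_congr_ae (hg.mono fun p hp => congrArg (fun v => φ p • v) hp)] at this

theorem weakGrad_ae_eq {m N : ℕ} {u : E → St N} {G : E → Grad n m N} (hQ : IsOpen Q)
    (h : ∀ α : MultiIndex n m, HasWeakDerivOn e Q α.1 u fun p => gradProj α (G p)) :
    weakGrad e Q m u =ᵐ[volume.restrict Q] G := by
  filter_upwards [ae_all_iff.2 fun α => weakDeriv_ae_eq hQ (h α)] with p hp
  ext ⟨α, i⟩
  exact congrArg (fun v : St N => v i) (hp α)

end WeakDeriv

/-! ### Gradients of `𝓕⁻¹ C` when `d = ρ C`. -/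

section Garding

variable {n m N : ℕ} [NeZero n]

theorem hasWeakDerivOn_riesz {C d : L2St n N}
    (h : (rhoSystem n m (St N)).σ C = (rhoSystem n m (St N)).b d) (α : MultiIndex n m) :
    HasWeakDerivOn (dir n) univ α.1 (𝓕⁻ C : L2St n N) fun x => gradProj α (riesz n m N d x) := by
  have h1 : HasWeakDerivOn (dir n) univ α.1 (𝓕⁻ C : L2St n N)
      ((gradProj α).compLp (riesz n m N d)) := by
    refine hasWeakDerivOn_univ ?_
    rw [FourierTransform.fourier_fourierInv_eq, fourier_compLp]
    filter_upwards [gradProj_fourier_riesz_of_σ_eq h α,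
      (gradProj α).coeFn_compLp (𝓕 (riesz n m N d))] with ξ h1 h2
    rw [h2, h1]
  refine h1.congr EventuallyEq.rfl ?_
  rw [Measure.restrict_univ]
  exact (gradProj α).coeFn_compLp _

theorem weakGrad_fourierInv {C d : L2St n N}
    (h : (rhoSystem n m (St N)).σ C = (rhoSystem n m (St N)).b d) :
    weakGrad (dir n) univ m (𝓕⁻ C : L2St n N) =ᵐ[volume] riesz n m N d := by
  have := weakGrad_ae_eq isOpen_univ (hasWeakDerivOn_riesz h)
  rwa [Measure.restrict_univ] at this

theorem hasL2Grad_fourierInv {C d : L2St n N}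
    (h : (rhoSystem n m (St N)).σ C = (rhoSystem n m (St N)).b d) :
    HasL2Grad (dir n) univ m (𝓕⁻ C : L2St n N) := fun α =>
  ⟨_, hasWeakDerivOn_riesz h α, (gradProj α).comp_memLp' (by
    rw [Measure.restrict_univ]; exact Lp.memLp _)⟩

end Garding

end

/-! ### The coefficients as operators, and the energy bounds. -/

section Coefficients

variable {n m N : ℕ}

/-- A coefficient matrix as an operator on gradients. -/
def coefCLM (M : Matrix (MultiIndex n m × Fin N) (MultiIndex n m × Fin N) ℂ) :
    Grad n m N →L[ℂ] Grad n m N :=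
  Matrix.toEuclideanCLM (𝕜 := ℂ) M

theorem coefCLM_apply (M : Matrix (MultiIndex n m × Fin N) (MultiIndex n m × Fin N) ℂ)
    (ξ : Grad n m N) (a : MultiIndex n m × Fin N) : coefCLM M ξ a = ∑ b, M a b * ξ b :=
  rfl

theorem coeffForm_eq_inner (M : Matrix (MultiIndex n m × Fin N) (MultiIndex n m × Fin N) ℂ)
    (ξ η : Grad n m N) : coeffForm M ξ η = inner ℂ η (coefCLM M ξ) := by
  simp only [coeffForm, PiLp.inner_apply, coefCLM_apply, RCLike.inner_apply, Finset.sum_mul]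

theorem norm_coefCLM_le {M : Matrix (MultiIndex n m × Fin N) (MultiIndex n m × Fin N) ℂ}
    {Lam : ℝ} (hLam : 0 ≤ Lam) (h : ∀ ξ η : Grad n m N, ‖coeffForm M ξ η‖ ≤ Lam * ‖ξ‖ * ‖η‖) :
    ‖coefCLM M‖ ≤ Lam := by
  refine ContinuousLinearMap.opNorm_le_bound _ hLam fun ξ => ?_
  have h1 := h ξ (coefCLM M ξ)
  rw [coeffForm_eq_inner, inner_self_eq_norm_sq_to_K, norm_pow, RCLike.norm_ofReal,
    abs_of_nonneg (norm_nonneg _), sq] at h1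
  rcases (norm_nonneg (coefCLM M ξ)).eq_or_lt with h0 | h0
  · rw [← h0]; positivity
  · exact le_of_mul_le_mul_right h1 h0

theorem aestronglyMeasurable_coefCLM {X : Type*} [MeasurableSpace X] {μ : Measure X}
    {A : X → Matrix (MultiIndex n m × Fin N) (MultiIndex n m × Fin N) ℂ}
    (hA : ∀ a b, AEStronglyMeasurable (fun p => A p a b) μ) :
    AEStronglyMeasurable (fun p => coefCLM (A p)) μ := by
  classical
  have h : ∀ p, coefCLM (A p) = ∑ a, ∑ b, A p a b • coefCLM (Matrix.single a b (1 : ℂ)) := by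
    intro p
    ext ξ a
    simp [_root_.sum_apply, coefCLM_apply, Matrix.single_apply, Finset.sum_ite_eq, ite_and]
  simp only [h]
  exact Finset.aestronglyMeasurable_fun_sum _ fun a _ => Finset.aestronglyMeasurable_fun_sum _
    fun b _ => (hA a b).smul aestronglyMeasurable_const

theorem restrict_halfSpace : (volume : Measure (ℝ × Sp n)).restrict (halfSpace n) =
    halfLine.prod volume := by
  rw [halfSpace, Measure.volume_eq_prod, ← Measure.prod_restrict, Measure.restrict_univ]

variable {A : Coeff n m N} {lam Lam : ℝ}

theorem IsElliptic.aestronglyMeasurable (hA : IsElliptic A lam Lam) :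
    AEStronglyMeasurable (fun p => coefCLM (A p))
      (halfLine.prod (volume : Measure (Sp n))) := by
  rw [← restrict_halfSpace]
  exact aestronglyMeasurable_coefCLM hA.measurable

theorem IsElliptic.norm_le (hA : IsElliptic A lam Lam) (hLam : 0 < Lam) :
    ∀ᵐ p ∂(halfLine.prod (volume : Measure (Sp n))), ‖coefCLM (A p)‖ ≤ Lam := by
  rw [← restrict_halfSpace]
  filter_upwards [hA.upper] with p hp using norm_coefCLM_le hLam.le hp

/-- Multiplication by the coefficients. -/
def coefOp (hA : IsElliptic A lam Lam) (hLam : 0 < Lam) :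
    Lp (Grad n m N) 2 (halfLine.prod (volume : Measure (Sp n))) →L[ℂ]
      Lp (Grad n m N) 2 (halfLine.prod (volume : Measure (Sp n))) :=
  mulOp _ Lam hA.aestronglyMeasurable (hA.norm_le hLam)

/-- Multiplication by the coefficients on curves in `L²`. -/
def coefCurve (hA : IsElliptic A lam Lam) (hLam : 0 < Lam) :
    Lp (L2Grad n m N) 2 halfLine →L[ℂ] Lp (L2Grad n m N) 2 halfLine :=
  ((sliceEquiv (Grad n m N) halfLine volume).toContinuousLinearEquiv.toContinuousLinearMap.comp
    (coefOp hA hLam)).comp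
    (sliceEquiv (Grad n m N) halfLine volume).symm.toContinuousLinearEquiv.toContinuousLinearMap

theorem coeFn_coefOp (hA : IsElliptic A lam Lam) (hLam : 0 < Lam)
    (g : Lp (Grad n m N) 2 (halfLine.prod (volume : Measure (Sp n)))) :
    coefOp hA hLam g =ᵐ[halfLine.prod volume] fun p => coefCLM (A p) (g p) :=
  coeFn_mulOp (hA := hA.aestronglyMeasurable) (hc := hA.norm_le hLam) g

theorem coeFn_coefCurve (hA : IsElliptic A lam Lam) (hLam : 0 < Lam)
    (G : Lp (L2Grad n m N) 2 halfLine) :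
    ∀ᵐ t ∂halfLine, coefCurve hA hLam G t =ᵐ[volume] fun x => coefCLM (A (t, x)) (G t x) := by
  obtain ⟨g, rfl⟩ := (sliceEquiv (Grad n m N) halfLine volume).surjective G
  have h0 : coefCurve hA hLam (sliceEquiv (Grad n m N) halfLine volume g) =
      sliceEquiv (Grad n m N) halfLine volume (coefOp hA hLam g) := by
    simp [coefCurve]
  rw [h0]
  have h3 := Measure.ae_ae_of_ae_prod (coeFn_coefOp hA hLam g)
  filter_upwards [coeFn_sliceEquiv g, coeFn_sliceEquiv (coefOp hA hLam g), h3]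
    with t h1 h2 h3
  filter_upwards [h1, h2, h3] with x h1 h2 h3
  rw [h2, h3, h1]

variable [NeZero n]

/-- The operator `R† A R` on curves in `L²`. -/
def energyOp (hA : IsElliptic A lam Lam) (hLam : 0 < Lam) :
    Lp (L2St n N) 2 halfLine →L[ℂ] Lp (L2St n N) 2 halfLine :=
  (((rieszAdj n m N).compLpL 2 halfLine).comp (coefCurve hA hLam)).comp
    ((riesz n m N).compLpL 2 halfLine)

theorem coeFn_energyOp (hA : IsElliptic A lam Lam) (hLam : 0 < Lam)
    (D : Lp (L2St n N) 2 halfLine) : ∀ᵐ t ∂halfLine, ∃ Y : L2Grad n m N,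
      energyOp hA hLam D t = rieszAdj n m N Y ∧
      Y =ᵐ[volume] fun x => coefCLM (A (t, x)) (riesz n m N (D t) x) := by
  filter_upwards [(rieszAdj n m N).coeFn_compLpL (p := 2) (μ := halfLine)
      (coefCurve hA hLam ((riesz n m N).compLpL 2 halfLine D)),
    coeFn_coefCurve hA hLam ((riesz n m N).compLpL 2 halfLine D),
    (riesz n m N).coeFn_compLpL (p := 2) (μ := halfLine) D] with t h1 h2 h3
  refine ⟨_, h1, ?_⟩
  rw [h3] at h2
  exact h2

theorem re_inner_rieszAdj (Y : L2Grad n m N) (d : L2St n N) :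
    (inner ℂ (rieszAdj n m N Y) d).re = (inner ℂ Y (riesz n m N d)).re := by
  rw [← inner_conj_symm, ← inner_riesz, inner_conj_symm]

/-- The lower energy bound for `R† A R`, on the range of the multiplier `ρ`. -/
theorem le_re_inner_energyOp (hA : IsElliptic A lam Lam) (hLam : 0 < Lam)
    (D : Lp (L2St n N) 2 halfLine) : ∀ᵐ t ∂halfLine,
      (∃ C, (rhoSystem n m (St N)).σ C = (rhoSystem n m (St N)).b (D t)) →
      lam * ‖D t‖ ^ 2 ≤ (inner ℂ (energyOp hA hLam D t) (D t)).re := by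
  filter_upwards [hA.garding, coeFn_energyOp hA hLam D] with t h1 ⟨Y, h2, h3⟩ ⟨C, hC⟩
  -- The Gårding inequality is applied to `𝓕⁻¹ C`, whose gradient is `riesz (D t)` and therefore has
  -- norm `‖D t‖`.
  have h4 := h1 _ ((Lp.memLp (FourierTransform.fourierInv C : L2St n N)).locallyIntegrable
    (by norm_num)) (hasL2Grad_fourierInv hC)
  have h5 := weakGrad_fourierInv hC
  rw [integral_congr_ae (h5.mono fun x hx => by rw [hx]), ← norm_sq_Lp_two, norm_riesz,
    integral_congr_ae (g := fun x => inner ℂ (riesz n m N (D t) x) (Y x))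
      (by filter_upwards [h5, h3] with x h6 h7; rw [h6, h7, coeffForm_eq_inner]),
    ← L2.inner_def, ← inner_conj_symm, Complex.conj_re] at h4
  rwa [h2, re_inner_rieszAdj]

theorem re_inner_energyOp_le (hA : IsElliptic A lam Lam) (hLam : 0 < Lam)
    (D : Lp (L2St n N) 2 halfLine) : ∀ᵐ t ∂halfLine,
      (inner ℂ (energyOp hA hLam D t) (D t)).re ≤ Lam * ‖D t‖ ^ 2 := by
  filter_upwards [Measure.ae_ae_of_ae_prod (hA.norm_le hLam), coeFn_energyOp hA hLam D]
    with t h1 ⟨Y, h2, h3⟩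
  have h4 : ‖Y‖ ≤ Lam * ‖riesz n m N (D t)‖ := by
    refine Lp.norm_le_mul_norm_of_ae_le_mul ?_
    filter_upwards [h1, h3] with x h1 h3
    rw [h3]
    exact (coefCLM (A (t, x))).le_of_opNorm_le h1 _
  rw [h2, re_inner_rieszAdj]
  refine (Complex.re_le_norm _).trans ((norm_inner_le_norm _ _).trans ?_)
  rw [norm_riesz] at h4 ⊢
  rw [sq, ← mul_assoc]
  exact mul_le_mul_of_nonneg_right h4 (norm_nonneg _)

/-- Gårding is available only for elements of the form `ρ C` with `C` in `L²`. For `a W` one takes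
`C = σ W`, and integrates the slicewise bound in time. -/
theorem energyOp_coercive (hA : IsElliptic A lam Lam) (hLam : 0 < Lam)
    (W : Lp (L2St n N) 2 halfLine) :
    lam * ‖(rhoSystem n m (St N)).a.compLpL 2 _ W‖ ^ 2 ≤
      (inner ℂ (energyOp hA hLam ((rhoSystem n m (St N)).a.compLpL 2 _ W))
        ((rhoSystem n m (St N)).a.compLpL 2 _ W)).re := by
  set D := (rhoSystem n m (St N)).a.compLpL 2 halfLine W with hD
  rw [norm_sq_Lp_two, L2.inner_def, ← integral_const_mul]
  have h0 := integral_re (𝕜 := ℂ) (L2.integrable_inner (𝕜 := ℂ) (energyOp hA hLam D) D)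
  simp only [RCLike.re_eq_complex_re] at h0
  rw [← h0]
  refine integral_mono_ae ((integrable_norm_sq (Lp.memLp D)).const_mul _)
    (integrable_re_inner (Lp.memLp _) (Lp.memLp _)) ?_
  filter_upwards [le_re_inner_energyOp hA hLam D,
    (rhoSystem n m (St N)).a.coeFn_compLpL (p := 2) (μ := halfLine) W] with t h1 h2
  refine h1 ⟨(rhoSystem n m (St N)).σ (W t), ?_⟩
  rw [hD, h2, (rhoSystem n m (St N)).ba]

end Coefficients

/-! ### Product test functions `θ(t) ψ(x)`. -/

section Tensor

variable {n : ℕ} {θ : ℝ → ℝ} {ψ : Sp n → ℝ}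

/-- The function `(t, x) ↦ θ(t) ψ(x)`. -/
def tensor (θ : ℝ → ℝ) (ψ : Sp n → ℝ) : ℝ × Sp n → ℝ := fun p => θ p.1 * ψ p.2

theorem IsTestFunction.tensor (hθ : IsTestFunction (Ioi 0) θ) (hψ : IsTestFunction univ ψ) :
    IsTestFunction (halfSpace n) (tensor θ ψ) := by
  have hc : IsCompact (tsupport θ ×ˢ tsupport ψ) := hθ.2.1.prod hψ.2.1
  have hs : Function.support (ParabolicCauchy.tensor θ ψ) ⊆ tsupport θ ×ˢ tsupport ψ := by
    intro p hp
    have := mul_ne_zero_iff.1 hp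
    exact ⟨subset_tsupport _ this.1, subset_tsupport _ this.2⟩
  refine ⟨(hθ.1.comp contDiff_fst).mul (hψ.1.comp contDiff_snd),
    HasCompactSupport.of_support_subset_isCompact hc hs, ?_⟩
  exact (closure_minimal hs hc.isClosed).trans (prod_mono hθ.2.2 (subset_univ _))

theorem multiDeriv_tensor (hθ : IsTestFunction (Ioi 0) θ) (hψ : IsTestFunction univ ψ)
    (α : Fin n → ℕ) : multiDeriv (spaceDir n) α (tensor θ ψ) =
      tensor θ (multiDeriv (dir n) α ψ) := by
  ext ⟨t, x⟩
  have h1 := congrFun (multiDeriv_slice (hθ.tensor hψ).1 (dir n) α t) x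
  have h2 := congrFun (multiDeriv_comp_clm (θ t • ContinuousLinearMap.id ℝ ℝ) hψ.1 (dir n) α) x
  exact h1.symm.trans h2

theorem fderiv_tensor (hθ : IsTestFunction (Ioi 0) θ) (hψ : IsTestFunction univ ψ)
    (p : ℝ × Sp n) : fderiv ℝ (tensor θ ψ) p (1, 0) = tensor (deriv θ) ψ p := by
  have h1 : HasFDerivAt (fun p : ℝ × Sp n => θ p.1) _ p :=
    (hθ.1.differentiable (by simp) p.1).hasDerivAt.hasFDerivAt.comp p hasFDerivAt_fst
  have h2 : HasFDerivAt (fun p : ℝ × Sp n => ψ p.2) _ p :=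
    (hψ.1.differentiable (by simp) p.2).hasFDerivAt.comp p hasFDerivAt_snd
  have := (h1.mul h2).fderiv
  change fderiv ℝ (fun p : ℝ × Sp n => θ p.1 * ψ p.2) p (1, 0) = _
  erw [this]
  simp [tensor, mul_comm]

variable {F : Type*} [NormedAddCommGroup F] [InnerProductSpace ℂ F] [CompleteSpace F]

theorem IsTestFunction.memLp_ofReal {X : Type*} [NormedAddCommGroup X] [NormedSpace ℝ X]
    [MeasurableSpace X] [BorelSpace X] {Q : Set X} {φ : X → ℝ}
    (h : IsTestFunction Q φ) (p : ℝ≥0∞) (μ : Measure X) [IsFiniteMeasureOnCompacts μ] :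
    MemLp (fun x => (φ x : ℂ)) p μ :=
  (Complex.continuous_ofReal.comp h.continuous).memLp_of_hasCompactSupport
    (h.2.1.comp_left Complex.ofReal_zero)

/-- Pairing with a test function, as an operator on `L²`. -/
def IsTestFunction.pair (F : Type*) [NormedAddCommGroup F] [InnerProductSpace ℂ F]
    [CompleteSpace F] (h : IsTestFunction univ ψ) :
    Lp F 2 (volume : Measure (Sp n)) →L[ℂ] F :=
  (ContinuousLinearMap.lsmul ℂ ℂ : ℂ →L[ℂ] F →L[ℂ] F).lpPairing volume 2 2
    (h.memLp_ofReal 2 volume).toLp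

theorem IsTestFunction.pair_apply (h : IsTestFunction univ ψ)
    (f : Lp F 2 (volume : Measure (Sp n))) : h.pair F f = ∫ x, (ψ x : ℂ) • f x := by
  rw [IsTestFunction.pair, ContinuousLinearMap.lpPairing_eq_integral]
  refine integral_congr_ae ?_
  filter_upwards [(h.memLp_ofReal 2 volume).coeFn_toLp] with x hx
  rw [hx]; rfl

theorem IsTestFunction.integrable_smul_memLp (hθ : IsTestFunction (Ioi 0) θ) {V : ℝ → F}
    (hV : MemLp V 2 halfLine) : Integrable (fun t => (θ t : ℂ) • V t) halfLine :=
  memLp_one_iff_integrable.1 (hV.smul (hθ.memLp_ofReal 2 halfLine))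

/-- Fubini's theorem turns a space-time pairing into a spatial pairing with a time average. That
average is an `L²` function of `x`, so it has a Fourier transform. -/
theorem integral_tensor_smul (hθ : IsTestFunction (Ioi 0) θ) (hψ : IsTestFunction univ ψ)
    {v : ℝ × Sp n → F} (hv : MemLp v 2 (halfLine.prod volume))
    {V : ℝ → Lp F 2 (volume : Measure (Sp n))} (hV : MemLp V 2 halfLine)
    (hVv : ∀ᵐ t ∂halfLine, V t =ᵐ[volume] fun x => v (t, x)) :
    ∫ p, (tensor θ ψ p : ℂ) • v p ∂(halfLine.prod volume) =
      ∫ x, (ψ x : ℂ) • (∫ t, (θ t : ℂ) • V t ∂halfLine : Lp F 2 (volume : Measure (Sp n))) x := by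
  rw [← hψ.pair_apply, ← ContinuousLinearMap.integral_comp_comm _ (hθ.integrable_smul_memLp hV)]
  have hint : Integrable (fun p => (tensor θ ψ p : ℂ) • v p) (halfLine.prod volume) :=
    memLp_one_iff_integrable.1 (hv.smul ((hθ.tensor hψ).memLp_ofReal 2 _))
  rw [integral_prod _ hint]
  refine integral_congr_ae ?_
  filter_upwards [hVv] with t ht
  rw [map_smul, hψ.pair_apply, ← integral_smul]
  refine integral_congr_ae ?_
  filter_upwards [ht] with x hx
  rw [hx, smul_smul, tensor]
  push_cast
  rfl

end Tensor

/-! ### Gradient curves and the weak formulation with scalar test functions. -/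

section WeakSolution

variable {n m N : ℕ} {A : Coeff n m N} {lam Lam : ℝ} {u : ℝ × Sp n → St N}

theorem isOpen_halfSpace : IsOpen (halfSpace n) := isOpen_Ioi.prod isOpen_univ

theorem hasWeakDerivOn_spatialGrad (hu : u ∈ energyClass n m N) (α : MultiIndex n m) :
    HasWeakDerivOn (spaceDir n) (halfSpace n) α.1 u fun p => gradProj α (spatialGrad m u p) := by
  obtain ⟨g, hg, -⟩ := hu.2 α
  exact weakDeriv_spec hg

theorem sum_gradIncl_gradProj (w : Grad n m N) : ∑ α, gradIncl α (gradProj α w) = w := by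
  classical
  refine grad_ext fun α => ?_
  simp [gradProj_gradIncl]

theorem memLp_of_gradProj {X : Type*} [MeasurableSpace X] {μ : Measure X} {G : X → Grad n m N}
    (h : ∀ α, MemLp (fun p => gradProj α (G p)) 2 μ) : MemLp G 2 μ := by
  have : G = fun p => ∑ α, gradIncl α (gradProj α (G p)) := by
    ext1 p; rw [sum_gradIncl_gradProj]
  rw [this]
  exact memLp_finsetSum _ fun α _ => (gradIncl α).comp_memLp' (h α)

theorem memLp_spatialGrad (hu : u ∈ energyClass n m N) :
    MemLp (spatialGrad m u) 2 (halfLine.prod volume) := by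
  rw [← restrict_halfSpace]
  refine memLp_of_gradProj fun α => ?_
  obtain ⟨g, hg, hg2⟩ := hu.2 α
  exact (memLp_congr_ae ((hasWeakDerivOn_spatialGrad hu α).ae_eq isOpen_halfSpace hg)).2 hg2

/-- The curve `t ↦ ∇^m u(t, ·)` in `L²`. -/
def gradCurve (hu : u ∈ energyClass n m N) : Lp (L2Grad n m N) 2 halfLine :=
  sliceEquiv (Grad n m N) halfLine volume (memLp_spatialGrad hu).toLp

theorem coeFn_gradCurve (hu : u ∈ energyClass n m N) :
    ∀ᵐ t ∂halfLine, gradCurve hu t =ᵐ[volume] fun x => spatialGrad m u (t, x) := by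
  filter_upwards [coeFn_sliceEquiv (memLp_spatialGrad hu).toLp,
    Measure.ae_ae_of_ae_prod (memLp_spatialGrad hu).coeFn_toLp] with t h1 h2
  exact h1.trans h2

theorem classicalGrad_smul {c : ℝ × Sp n → ℝ} (hc : ContDiff ℝ ∞ c) (v : St N)
    (p : ℝ × Sp n) : classicalGrad (spaceDir n) m (fun p => c p • v) p =
      ∑ α : MultiIndex n m, ((multiDeriv (spaceDir n) α.1 c p : ℝ) : ℂ) • gradIncl α v := by
  classical
  refine grad_ext fun α => ?_
  have h1 := congrFun (multiDeriv_comp_clm (ContinuousLinearMap.toSpanSingleton ℝ v) hc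
    (spaceDir n) α.1) p
  simp only [map_sum, map_smul, gradProj_gradIncl, smul_ite, smul_zero, Finset.sum_ite_eq,
    Finset.mem_univ, if_true]
  exact h1.trans (Complex.coe_smul _ _).symm

/-- The weak formulation, tested against scalar test functions. -/
theorem IsGlobalWeakSolution.integral_fderiv_smul (hA : IsElliptic A lam Lam) (hLam : 0 < Lam)
    (hu : u ∈ energyClass n m N) (h : IsGlobalWeakSolution A u) {c : ℝ × Sp n → ℝ}
    (hc : IsTestFunction (halfSpace n) c) :
    ∫ p in halfSpace n, ((fderiv ℝ c p (1, 0) : ℝ) : ℂ) • u p =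
      ∑ α : MultiIndex n m, ∫ p in halfSpace n, ((multiDeriv (spaceDir n) α.1 c p : ℝ) : ℂ) •
        gradProj α (coefCLM (A p) (spatialGrad m u p)) := by
  have hF : MemLp (fun p => coefCLM (A p) (spatialGrad m u p)) 2 (volume.restrict (halfSpace n)) := by
    rw [restrict_halfSpace]
    exact memLp_clm_apply hA.aestronglyMeasurable (hA.norm_le hLam) (memLp_spatialGrad hu)
  have hdc := hc.fderiv_apply (1, 0)
  have i1 : Integrable (fun p => ((fderiv ℝ c p (1, 0) : ℝ) : ℂ) • u p) (volume.restrict (halfSpace n)) := by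
    have := (hdc.integrable_smul isOpen_halfSpace hu.1).integrableOn (s := halfSpace n)
    exact this.congr (Eventually.of_forall fun p => (Complex.coe_smul _ _).symm)
  have i2 : ∀ α : MultiIndex n m, Integrable (fun p => ((multiDeriv (spaceDir n) α.1 c p : ℝ) : ℂ) •
        gradProj α (coefCLM (A p) (spatialGrad m u p))) (volume.restrict (halfSpace n)) := fun α =>
    memLp_one_iff_integrable.1 (((gradProj α).comp_memLp' hF).smul
      ((hc.multiDeriv (spaceDir n) α.1).memLp_ofReal 2 _))
  refine ext_inner_left ℂ fun v => ?_
  rw [inner_sum]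
  rw [← integral_inner i1]
  simp only [← integral_inner (i2 _)]
  rw [← integral_finsetSum _ fun α _ => (i2 α).const_inner v]
  -- The vector test functions `c v` with constant `v` recover the vector-valued identity one inner
  -- product at a time.
  have hφ : IsTestFunction (halfSpace n) fun p => c p • v := by
    refine ⟨hc.1.smul contDiff_const, hc.2.1.smul_right, ?_⟩
    exact (closure_mono (Function.support_smul_subset_left _ _)).trans hc.2.2
  convert h.2 _ hφ using 1
  · refine integral_congr_ae (Eventually.of_forall fun p => ?_)
    have hd : fderiv ℝ (fun p => c p • v) p (1, 0) = ((fderiv ℝ c p (1, 0) : ℝ) : ℂ) • v := by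
      have := ((hc.1.differentiable (by simp) p).hasFDerivAt.smul_const v).fderiv
      rw [this]
      exact (Complex.coe_smul _ _).symm
    simp only [hd, inner_smul_right, PiLp.inner_apply, PiLp.smul_apply, smul_eq_mul,
      RCLike.inner_apply, map_mul, Complex.conj_ofReal, Finset.mul_sum]
    exact Finset.sum_congr rfl fun i _ => by ring
  · refine integral_congr_ae (Eventually.of_forall fun p => ?_)
    simp only [coeffForm_eq_inner, classicalGrad_smul hc.1, sum_inner, inner_smul_left,
      inner_smul_right, Complex.conj_ofReal]
    refine Finset.sum_congr rfl fun α _ => ?_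
    congr 1
    classical
    rw [inner_grad, Finset.sum_eq_single α]
    · rw [gradProj_gradIncl, if_pos rfl]
    · intro β _ hβ
      rw [gradProj_gradIncl, if_neg hβ, inner_zero_left]
    · simp

end WeakSolution

section

open scoped FourierTransform

/-! ### Time averages of curves in `L²`. -/

section WeightedIntegrals

variable {n m N : ℕ} {θ : ℝ → ℝ} {ψ : Sp n → ℝ}

theorem fourier_gradProj (α : MultiIndex n m) (G : L2Grad n m N) :
    ∀ᵐ ξ, (𝓕 ((gradProj α).compLp G : L2St n N)) ξ = gradProj α ((𝓕 G) ξ) := by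
  rw [fourier_compLp]
  exact (gradProj α).coeFn_compLp _

theorem integral_tensor_gradProj (hθ : IsTestFunction (Ioi 0) θ) (hψ : IsTestFunction univ ψ)
    {v : ℝ × Sp n → Grad n m N} (hv : MemLp v 2 (halfLine.prod volume))
    {V : ℝ → L2Grad n m N} (hV : MemLp V 2 halfLine)
    (hVv : ∀ᵐ t ∂halfLine, V t =ᵐ[volume] fun x => v (t, x)) (α : MultiIndex n m) :
    ∫ p in halfSpace n, (tensor θ ψ p : ℂ) • gradProj α (v p) =
      ∫ x, (ψ x : ℂ) • ((gradProj α).compLp (∫ t, (θ t : ℂ) • V t ∂halfLine) : L2St n N) x := by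
  have h := congrArg (gradProj α) (integral_tensor_smul hθ hψ hv hV hVv)
  have i1 : Integrable (fun p => (tensor θ ψ p : ℂ) • v p) (halfLine.prod volume) :=
    memLp_one_iff_integrable.1 (hv.smul ((hθ.tensor hψ).memLp_ofReal 2 _))
  have i2 : ∀ f : L2Grad n m N, Integrable (fun x => (ψ x : ℂ) • f x) volume := fun f =>
    memLp_one_iff_integrable.1 ((Lp.memLp f).smul (hψ.memLp_ofReal 2 _))
  rw [← (gradProj α).integral_comp_comm i1, ← (gradProj α).integral_comp_comm (i2 _)] at h
  simp only [map_smul] at h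
  rw [restrict_halfSpace, h]
  refine integral_congr_ae ?_
  filter_upwards [(gradProj α).coeFn_compLp (∫ t, (θ t : ℂ) • V t ∂halfLine)] with x hx
  rw [hx]

theorem eq_zero_of_forall_integral_smul_eq_zero {F : Type*} [NormedAddCommGroup F]
    [InnerProductSpace ℂ F] [CompleteSpace F] {V : ℝ → F} (hV : MemLp V 2 halfLine)
    (h : ∀ θ : ℝ → ℝ, IsTestFunction (Ioi 0) θ → ∫ t, (θ t : ℂ) • V t ∂halfLine = 0) :
    ∀ᵐ t ∂halfLine, V t = 0 := by
  have hloc : LocallyIntegrableOn V (Ioi 0) :=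
    fun x hx => by
      refine ⟨Ioi 0 ∩ Icc (x - 1) (x + 1), inter_mem self_mem_nhdsWithin
        (mem_nhdsWithin_of_mem_nhds (Icc_mem_nhds (by linarith) (by linarith))), ?_⟩
      have h1 : MemLp V 2 (volume.restrict (Ioi 0 ∩ Icc (x - 1) (x + 1))) :=
        hV.mono_measure (Measure.restrict_mono inter_subset_left le_rfl)
      have : IsFiniteMeasure (volume.restrict (Ioi 0 ∩ Icc (x - 1) (x + 1))) :=
        ⟨by rw [Measure.restrict_apply_univ]
            exact (measure_mono inter_subset_right).trans_lt isCompact_Icc.measure_lt_top⟩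
      exact h1.integrable (by norm_num)
  rw [ae_restrict_iff' measurableSet_Ioi]
  refine isOpen_Ioi.ae_eq_zero_of_integral_contDiff_smul_eq_zero hloc fun θ h1 h2 h3 => ?_
  rw [integral_smul_eq_setIntegral_Ioi h3, ← h θ ⟨h1, h2, h3⟩]
  rfl

end WeightedIntegrals

/-! ### Gradients lie in the range of `riesz`. -/

section Compatibility

variable {n m N : ℕ} [NeZero n] {u : ℝ × Sp n → St N} {θ : ℝ → ℝ}

/-- Symmetry exchanges `α` and `β`, so the projection returns each component `α` multiplied by the
sum over `β` of the squared moduli of the unit symbols, which is `1`. -/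
theorem riesz_rieszAdj_of_sym_comm {G : L2Grad n m N}
    (h : ∀ α β : MultiIndex n m, ∀ᵐ ξ, sym β.1 ξ • gradProj α ((𝓕 G) ξ) =
      sym α.1 ξ • gradProj β ((𝓕 G) ξ)) : riesz n m N (rieszAdj n m N G) = G := by
  have h' : ∀ᵐ ξ, ∀ α β : MultiIndex n m, sym β.1 ξ • gradProj α ((𝓕 G) ξ) =
      sym α.1 ξ • gradProj β ((𝓕 G) ξ) := ae_all_iff.2 fun α => ae_all_iff.2 fun β => h α β
  have key : 𝓕 (riesz n m N (rieszAdj n m N G)) = 𝓕 G := by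
    apply Lp.ext
    filter_upwards [h', ae_all_iff.2 fun α => gradProj_fourier_riesz (m := m) α (rieszAdj n m N G),
      rieszAdj_apply G, ae_ne_zero (n := n)] with ξ h1 h2 h3 h4
    refine grad_ext fun α => ?_
    rw [h2 α, h3, Finset.smul_sum]
    have h5 : ∀ β : MultiIndex n m, unitSym α ξ • starRingEnd ℂ (unitSym β ξ) • gradProj β ((𝓕 G) ξ) =
        (starRingEnd ℂ (unitSym β ξ) * unitSym β ξ) • gradProj α ((𝓕 G) ξ) := by
      intro β
      have := congrArg (fun w => (starRingEnd ℂ (unitSym β ξ) * (rho m ξ : ℂ)⁻¹) • w) (h1 α β)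
      simp only [smul_smul] at this ⊢
      rw [mul_comm (unitSym α ξ), unitSym, unitSym, div_eq_mul_inv, div_eq_mul_inv] at *
      rw [show starRingEnd ℂ (sym β.1 ξ * (rho m ξ : ℂ)⁻¹) * (sym α.1 ξ * (rho m ξ : ℂ)⁻¹) =
        starRingEnd ℂ (sym β.1 ξ * (rho m ξ : ℂ)⁻¹) * (rho m ξ : ℂ)⁻¹ * sym α.1 ξ by ring, ← this]
      congr 1; ring
    rw [Finset.sum_congr rfl fun β _ => h5 β, ← Finset.sum_smul, sum_conj_unitSym_mul h4, one_smul]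
  exact (Lp.fourierTransformₗᵢ (Sp n) (Grad n m N)).injective key

/-- Both sides represent `∂^α ∂^β` of a time average of `u`. As `u` itself need not be in `L²`, it
is only paired with derivatives of test functions, and the commutation happens there. -/
theorem sym_gradCurve_comm (hu : u ∈ energyClass n m N) (hθ : IsTestFunction (Ioi 0) θ)
    (α β : MultiIndex n m) :
    ∀ᵐ ξ, sym β.1 ξ • gradProj α ((𝓕 (∫ t, (θ t : ℂ) • gradCurve hu t ∂halfLine)) ξ) =
      sym α.1 ξ • gradProj β ((𝓕 (∫ t, (θ t : ℂ) • gradCurve hu t ∂halfLine)) ξ) := by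
  set G : L2Grad n m N := ∫ t, (θ t : ℂ) • gradCurve hu t ∂halfLine with hG
  have hr : ∀ (r : ℝ) (v : St N), r • v = (r : ℂ) • v := fun r v => (Complex.coe_smul r v).symm
  have hpair : ∀ (α : MultiIndex n m) {χ : Sp n → ℝ}, IsTestFunction univ χ →
      ∫ x, (χ x : ℂ) • ((gradProj α).compLp G : L2St n N) x =
        (-1 : ℝ) ^ m • ∫ p in halfSpace n, tensor θ (multiDeriv (dir n) α.1 χ) p • u p := by
    intro α χ hχ
    have h1 := (hasWeakDerivOn_spatialGrad hu α).2.2 _ (hθ.tensor hχ)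
    rw [multiDeriv_tensor hθ hχ, α.sum_eq] at h1
    rw [h1, smul_smul, ← mul_pow]
    simp only [mul_neg, mul_one, neg_neg, one_pow, hr]
    rw [Complex.ofReal_one, one_smul, integral_tensor_gradProj hθ hχ (memLp_spatialGrad hu) (Lp.memLp (gradCurve hu))
      (coeFn_gradCurve hu) α]
  have key := (forall_sum_integral_multiDeriv_iff (κ := Bool) (fun b => cond b β.1 α.1) (fun _ => 0)
    (fun b => cond b ((gradProj α).compLp G : L2St n N) (-(gradProj β).compLp G))).1 (by
      intro ψ hψ
      simp only [Fintype.sum_bool, cond_true, cond_false, multiDeriv_zero]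
      rw [hpair α (hψ.multiDeriv _ _)]
      have : ∫ x, ((multiDeriv (dir n) α.1 ψ x : ℝ) : ℂ) • (-(gradProj β).compLp G : L2St n N) x =
          -∫ x, ((multiDeriv (dir n) α.1 ψ x : ℝ) : ℂ) • ((gradProj β).compLp G : L2St n N) x := by
        rw [← integral_neg]
        refine integral_congr_ae ?_
        filter_upwards [Lp.coeFn_neg ((gradProj β).compLp G : L2St n N)] with x hx
        rw [hx, Pi.neg_apply, smul_neg]
      rw [this, hpair β (hψ.multiDeriv _ _), hψ.multiDeriv_comm, add_neg_cancel])
  filter_upwards [key, fourier_gradProj α G, fourier_gradProj β G,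
    Lp.coeFn_neg (𝓕 ((gradProj β).compLp G : L2St n N))] with ξ h1 h2 h3 h4
  simp only [Fintype.sum_bool, cond_true, cond_false, sym_zero, mul_one,
    FourierTransform.fourier_neg] at h1
  rw [h4, Pi.neg_apply, h2, h3, smul_neg, add_neg_eq_zero, sym_neg_multiIndex,
    sym_neg_multiIndex, mul_smul, mul_smul] at h1
  exact smul_right_injective _ (pow_ne_zero _ (by norm_num : (-1 : ℂ) ≠ 0)) h1

/-- The gradient curve of a function lies in the range of `riesz`. -/
theorem riesz_rieszAdj_gradCurve (hu : u ∈ energyClass n m N) :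
    ∀ᵐ t ∂halfLine, riesz n m N (rieszAdj n m N (gradCurve hu t)) = gradCurve hu t := by
  let S : L2Grad n m N →L[ℂ] L2Grad n m N :=
    (riesz n m N).comp (rieszAdj n m N) - ContinuousLinearMap.id ℂ _
  have h := eq_zero_of_forall_integral_smul_eq_zero (S.comp_memLp' (Lp.memLp (gradCurve hu)))
    fun θ hθ => by
      have h1 := S.integral_comp_comm (hθ.integrable_smul_memLp (Lp.memLp (gradCurve hu)))
      simp only [map_smul] at h1
      refine h1.trans ?_
      exact sub_eq_zero.2 (riesz_rieszAdj_of_sym_comm (sym_gradCurve_comm hu hθ))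
  filter_upwards [h] with t ht
  exact sub_eq_zero.1 ht

end Compatibility

/-! ### The equation for `d` on the Fourier side. -/

section Equation

variable {n m N : ℕ} [NeZero n] {A : Coeff n m N} {lam Lam : ℝ} {u : ℝ × Sp n → St N} {θ : ℝ → ℝ}

/-- The curve `d` with `∇^m u(t, ·) = riesz (d t)`. -/
def energyCurve (hu : u ∈ energyClass n m N) : Lp (L2St n N) 2 halfLine :=
  (rieszAdj n m N).compLpL 2 halfLine (gradCurve hu)

theorem riesz_energyCurve (hu : u ∈ energyClass n m N) :
    ∀ᵐ t ∂halfLine, riesz n m N (energyCurve hu t) = gradCurve hu t := by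
  filter_upwards [riesz_rieszAdj_gradCurve hu,
    (rieszAdj n m N).coeFn_compLpL (p := 2) (μ := halfLine) (gradCurve hu)] with t h1 h2
  rw [energyCurve, h2, h1]

theorem energyOp_energyCurve (hA : IsElliptic A lam Lam) (hLam : 0 < Lam)
    (hu : u ∈ energyClass n m N) : energyOp hA hLam (energyCurve hu) =
      (rieszAdj n m N).compLpL 2 halfLine (coefCurve hA hLam (gradCurve hu)) := by
  have : (riesz n m N).compLpL 2 halfLine (energyCurve hu) = gradCurve hu := by
    apply Lp.ext
    filter_upwards [riesz_energyCurve hu,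
      (riesz n m N).coeFn_compLpL (p := 2) (μ := halfLine) (energyCurve hu)] with t h1 h2
    rw [h2, h1]
  simp only [energyOp, ContinuousLinearMap.comp_apply, this]

/-- The test function is `θ(t) ∂^β ψ(x)`. The derivative `∂^β` passes to `u`, so that only square
integrable gradients remain and the Fourier transform applies. -/
theorem fourier_equation (hA : IsElliptic A lam Lam) (hLam : 0 < Lam)
    (hu : u ∈ energyClass n m N) (h : IsGlobalWeakSolution A u) (hθ : IsTestFunction (Ioi 0) θ)
    (β : MultiIndex n m) : ∀ᵐ ξ,
      gradProj β ((𝓕 (∫ t, ((deriv θ t : ℝ) : ℂ) • gradCurve hu t ∂halfLine)) ξ) =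
        sym β.1 ξ • ∑ α : MultiIndex n m, starRingEnd ℂ (sym α.1 ξ) • gradProj α
          ((𝓕 (∫ t, (θ t : ℂ) • coefCurve hA hLam (gradCurve hu) t ∂halfLine)) ξ) := by
  set G : L2Grad n m N := ∫ t, ((deriv θ t : ℝ) : ℂ) • gradCurve hu t ∂halfLine with hG
  set H : L2Grad n m N := ∫ t, (θ t : ℂ) • coefCurve hA hLam (gradCurve hu) t ∂halfLine with hH
  have hF : MemLp (fun p => coefCLM (A p) (spatialGrad m u p)) 2 (halfLine.prod volume) :=
    memLp_clm_apply hA.aestronglyMeasurable (hA.norm_le hLam) (memLp_spatialGrad hu)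
  have hFt : ∀ᵐ t ∂halfLine, coefCurve hA hLam (gradCurve hu) t =ᵐ[volume]
      fun x => coefCLM (A (t, x)) (spatialGrad m u (t, x)) := by
    filter_upwards [coeFn_coefCurve hA hLam (gradCurve hu), coeFn_gradCurve hu] with t h1 h2
    filter_upwards [h1, h2] with x h1 h2
    rw [h1, h2]
  have hr : ∀ (r : ℝ) (v : St N), r • v = (r : ℂ) • v := fun r v => (Complex.coe_smul r v).symm
  have key := (forall_sum_integral_multiDeriv_iff (κ := Option (MultiIndex n m))
    (fun o => o.elim 0 fun α => α.1) (fun o => o.elim 0 fun _ => β.1)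
    (fun o => o.elim ((-(-1 : ℂ) ^ m) • (gradProj β).compLp G : L2St n N)
      fun α => (gradProj α).compLp H)).1 (by
      intro ψ hψ
      simp only [Fintype.sum_option, Option.elim_none, Option.elim_some, multiDeriv_zero]
      have h1 := h.integral_fderiv_smul hA hLam hu (hθ.tensor (hψ.multiDeriv (dir n) β.1))
      simp only [fderiv_tensor hθ (hψ.multiDeriv (dir n) β.1),
        multiDeriv_tensor hθ (hψ.multiDeriv (dir n) β.1)] at h1
      have h2 := (hasWeakDerivOn_spatialGrad hu β).2.2 _ (hθ.deriv.tensor hψ)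
      rw [multiDeriv_tensor hθ.deriv hψ, β.sum_eq] at h2
      simp only [hr] at h2
      rw [h2] at h1
      rw [integral_tensor_gradProj hθ.deriv hψ (memLp_spatialGrad hu) (Lp.memLp (gradCurve hu))
        (coeFn_gradCurve hu) β] at h1
      simp only [integral_tensor_gradProj hθ ((hψ.multiDeriv (dir n) β.1).multiDeriv (dir n) _)
        hF (Lp.memLp (coefCurve hA hLam (gradCurve hu))) hFt] at h1
      rw [← h1]
      have h3 : ∫ x, (ψ x : ℂ) • ((-(-1 : ℂ) ^ m) • (gradProj β).compLp G : L2St n N) x =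
          (-(-1 : ℂ) ^ m) • ∫ x, (ψ x : ℂ) • ((gradProj β).compLp G : L2St n N) x := by
        rw [← integral_smul]
        refine integral_congr_ae ?_
        filter_upwards [Lp.coeFn_smul (-(-1 : ℂ) ^ m) ((gradProj β).compLp G : L2St n N)] with x hx
        rw [hx, Pi.smul_apply, smul_comm]
      rw [h3, neg_smul]
      push_cast
      exact neg_add_cancel _)
  filter_upwards [key, ae_all_iff.2 fun α => fourier_gradProj α H, fourier_gradProj β G,
    Lp.coeFn_smul (-(-1 : ℂ) ^ m) (𝓕 ((gradProj β).compLp G : L2St n N))] with ξ h1 h2 h3 h4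
  simp only [Fintype.sum_option, Option.elim_none, Option.elim_some, sym_zero, mul_one, one_smul,
    FourierTransform.fourier_smul] at h1
  rw [h4, Pi.smul_apply, h3, Finset.sum_congr rfl fun α _ => by rw [h2 α, ← conj_sym,
    sym_neg_multiIndex, mul_left_comm, mul_smul, mul_comm, mul_smul], ← Finset.smul_sum, neg_smul,
    neg_add_eq_zero] at h1
  rw [Finset.smul_sum]
  exact smul_right_injective _ (pow_ne_zero _ (by norm_num : (-1 : ℂ) ≠ 0)) (h1.trans (by rfl))

/-- The equation `(b d)' = -a h` in the sense of distributions. -/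
theorem integral_deriv_smul_energyCurve (hA : IsElliptic A lam Lam) (hLam : 0 < Lam)
    (hu : u ∈ energyClass n m N) (h : IsGlobalWeakSolution A u) (hθ : IsTestFunction (Ioi 0) θ) :
    ∫ t in Ioi 0, ((deriv θ t : ℝ) : ℂ) • (rhoSystem n m (St N)).b (energyCurve hu t) =
      ∫ t in Ioi 0, (θ t : ℂ) • (rhoSystem n m (St N)).a (energyOp hA hLam (energyCurve hu) t) := by
  set G : L2Grad n m N := ∫ t, ((deriv θ t : ℝ) : ℂ) • gradCurve hu t ∂halfLine with hG
  set H : L2Grad n m N := ∫ t, (θ t : ℂ) • coefCurve hA hLam (gradCurve hu) t ∂halfLine with hH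
  have key : (rhoSystem n m (St N)).b (rieszAdj n m N G) =
      (rhoSystem n m (St N)).a (rieszAdj n m N H) := by
    apply Lp.ext
    filter_upwards [rhoSystem_b_apply (m := m) (rieszAdj n m N G),
      rhoSystem_a_apply (m := m) (rieszAdj n m N H), rieszAdj_apply G, rieszAdj_apply H,
      ae_all_iff.2 fun β => fourier_equation hA hLam hu h hθ β, ae_ne_zero (n := n)]
      with ξ h1 h2 h3 h4 h5 h6
    have h7 : ∑ α : MultiIndex n m, starRingEnd ℂ (sym α.1 ξ) • gradProj α ((𝓕 H) ξ) =
        (rho m ξ : ℂ) • rieszAdj n m N H ξ := by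
      rw [h4, Finset.smul_sum]
      refine Finset.sum_congr rfl fun α _ => ?_
      rw [smul_smul, ← unitSym_mul_rho α h6, map_mul, Complex.conj_ofReal, mul_comm]
    -- One factor `ρ` comes from the divergence and one from `sym β`; dividing by `1 + ρ²` leaves
    -- `b` on the left and `a` on the right.
    have h8 : rieszAdj n m N G ξ = ((rho m ξ ^ 2 : ℝ) : ℂ) • rieszAdj n m N H ξ := by
      rw [h3, Finset.sum_congr rfl fun β _ => by
        rw [h5 β, h7, ← unitSym_mul_rho β h6, smul_smul, smul_smul, ← mul_assoc, mul_assoc],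
        ← Finset.sum_smul, ← Finset.sum_mul, sum_conj_unitSym_mul h6]
      congr 1
      push_cast
      ring
    rw [h1, h2, h8, smul_smul, one_div_mul_eq_div]
  have hG' : ∫ t in Ioi 0, ((deriv θ t : ℝ) : ℂ) • (rhoSystem n m (St N)).b (energyCurve hu t) =
      (rhoSystem n m (St N)).b (rieszAdj n m N G) := by
    have := ((rhoSystem n m (St N)).b.comp (rieszAdj n m N)).integral_comp_comm
      (hθ.deriv.integrable_smul_memLp (Lp.memLp (gradCurve hu)))
    rw [hG, ← ContinuousLinearMap.comp_apply, ← this]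
    refine integral_congr_ae ?_
    filter_upwards [(rieszAdj n m N).coeFn_compLpL (p := 2) (μ := halfLine) (gradCurve hu)]
      with t ht
    rw [map_smul, energyCurve, ht]
    rfl
  have hH' : ∫ t in Ioi 0, (θ t : ℂ) • (rhoSystem n m (St N)).a
      (energyOp hA hLam (energyCurve hu) t) = (rhoSystem n m (St N)).a (rieszAdj n m N H) := by
    have := ((rhoSystem n m (St N)).a.comp (rieszAdj n m N)).integral_comp_comm
      (hθ.integrable_smul_memLp (Lp.memLp (coefCurve hA hLam (gradCurve hu))))
    rw [hH, ← ContinuousLinearMap.comp_apply, ← this, energyOp_energyCurve]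
    refine integral_congr_ae ?_
    filter_upwards [(rieszAdj n m N).coeFn_compLpL (p := 2) (μ := halfLine)
      (coefCurve hA hLam (gradCurve hu))] with t ht
    rw [map_smul, ht]
    rfl
  rw [hG', hH', key]

end Equation

end

/-! ### Energy solutions: bounds, decay and uniqueness. -/

section EnergySolution

/-- Converse to du Bois-Reymond. It brings energy solutions back to the weak form, which is linear
in `d` and can be subtracted. -/
theorem integral_deriv_smul_of_eq_sub_integral {E : Type*} [NormedAddCommGroup E]
    [InnerProductSpace ℂ E] [CompleteSpace E] {g z : ℝ → E}
    (hz : ∀ T, 0 ≤ T → IntervalIntegrable z volume 0 T)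
    (hg : ∀ t, 0 ≤ t → g t = g 0 - ∫ s in (0 : ℝ)..t, z s) {θ : ℝ → ℝ}
    (hθ : IsTestFunction (Ioi 0) θ) :
    ∫ t in Ioi 0, deriv θ t • g t = ∫ t in Ioi 0, θ t • z t := by
  obtain ⟨a, b, ha, hab, hs⟩ := hθ.exists_Icc
  have hb : (0 : ℝ) ≤ b + 1 := by linarith
  have hz0 : ∀ t, t ∉ Icc a b → θ t = 0 := fun t ht =>
    image_eq_zero_of_notMem_tsupport fun h' => ht (hs h')
  have hz1 : ∀ t, t ∉ Icc a b → deriv θ t = 0 := fun t ht =>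
    image_eq_zero_of_notMem_tsupport fun h' => ht (hs (tsupport_deriv_subset h'))
  have red : ∀ (η : ℝ → ℝ) (w : ℝ → E), (∀ t, t ∉ Icc a b → η t = 0) →
      ∫ t in Ioi 0, η t • w t = ∫ t in (0 : ℝ)..(b + 1), η t • w t := by
    intro η w hη
    rw [intervalIntegral.integral_of_le hb]
    refine setIntegral_eq_of_subset_of_forall_sdiff_eq_zero measurableSet_Ioi
      (fun x hx => hx.1) fun s hs => ?_
    rw [hη s (fun h' => hs.2 ⟨hs.1, by linarith [h'.2]⟩), zero_smul]
  have hg' : ∀ t ∈ Icc 0 (b + 1), g t = g 0 + ∫ s in (0 : ℝ)..t, -z s := by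
    intro t ht
    rw [intervalIntegral.integral_neg, ← sub_eq_add_neg]
    exact hg t ht.1
  have ibp := integral_bilin_deriv (ContinuousLinearMap.lsmul ℝ ℝ : ℝ →L[ℝ] E →L[ℝ] E)
    (f := θ) (f' := deriv θ) (g := g) (g' := fun s => -z s) hb
    (hθ.deriv.continuous.intervalIntegrable _ _) (hz _ hb).neg
    (fun t _ => by
      rw [intervalIntegral.integral_deriv_eq_sub
        (fun x _ => hθ.1.differentiable (by simp) x)
        (hθ.deriv.continuous.intervalIntegrable _ _)]; abel) hg'
  have i1 : IntervalIntegrable (fun t => deriv θ t • g t) volume 0 (b + 1) := by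
    have hgc := continuousOn_of_eq_integral hb (hz _ hb).neg hg'
    refine ContinuousOn.intervalIntegrable ?_
    rw [uIcc_of_le hb]
    exact hθ.deriv.continuous.continuousOn.smul hgc
  have i2 : IntervalIntegrable (fun t => θ t • -z t) volume 0 (b + 1) :=
    (hz _ hb).neg.continuousOn_smul hθ.continuous.continuousOn
  simp only [ContinuousLinearMap.lsmul_apply] at ibp
  rw [intervalIntegral.integral_add i1 i2,
    hz0 (b + 1) (fun h' => by linarith [h'.2]), hz0 0 (fun h' => by linarith [h'.1]),
    ← red _ _ hz1, ← red _ _ hz0] at ibp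
  simp only [zero_smul, sub_zero, smul_neg, integral_neg] at ibp
  exact add_neg_eq_zero.1 ibp

theorem MemLp.intervalIntegrable_halfLine {E : Type*} [NormedAddCommGroup E] {f : ℝ → E}
    (hf : MemLp f 2 halfLine) {s t : ℝ} (hs : 0 ≤ s) (ht : s ≤ t) :
    IntervalIntegrable f volume s t := by
  rw [intervalIntegrable_iff_integrableOn_Ioc_of_le ht]
  have h1 : MemLp f 2 (volume.restrict (Ioc s t)) :=
    hf.mono_measure (Measure.restrict_mono (fun x hx => lt_of_le_of_lt hs hx.1) le_rfl)
  exact h1.integrable (by norm_num)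

variable {n m N : ℕ} [NeZero n] {A : Coeff n m N} {lam Lam : ℝ}

/-- A curve `C` in `L²` and `d = ρ C` with `∂_t C = -ρ h`, where `h = R† A R d`: the Fourier side
of a solution of the parabolic system. -/
structure IsEnergySolution (hA : IsElliptic A lam Lam) (hLam : 0 < Lam)
    (d : Lp (L2St n N) 2 halfLine) (C : ℝ → L2St n N) : Prop where
  continuousOn : ContinuousOn C (Ici 0)
  rel : ∀ᵐ t ∂halfLine, (rhoSystem n m (St N)).σ (C t) = (rhoSystem n m (St N)).b (d t)
  evol : ∀ t, 0 ≤ t → (rhoSystem n m (St N)).σ (C t) = (rhoSystem n m (St N)).σ (C 0) -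
    ∫ s in (0 : ℝ)..t, (rhoSystem n m (St N)).a (energyOp hA hLam d s)
  energy : ∀ t, 0 ≤ t → ‖C t‖ ^ 2 = 2 * ∫ s in Ioi t, (inner ℂ (energyOp hA hLam d s) (d s)).re

variable {hA : IsElliptic A lam Lam} {hLam : 0 < Lam}

theorem exists_isEnergySolution_of_weak {d : Lp (L2St n N) 2 halfLine}
    (h : ∀ θ : ℝ → ℝ, IsTestFunction (Ioi 0) θ →
      ∫ t in Ioi 0, ((deriv θ t : ℝ) : ℂ) • (rhoSystem n m (St N)).b (d t) =
        ∫ t in Ioi 0, (θ t : ℂ) • (rhoSystem n m (St N)).a (energyOp hA hLam d t)) :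
    ∃ C, IsEnergySolution hA hLam d C := by
  obtain ⟨C, c1, c2, c3, c4⟩ := (rhoSystem n m (St N)).exists_isSolution
    (d := d) (h := energyOp hA hLam d) (Lp.memLp _) (Lp.memLp _) h
  exact ⟨C, c1, c2, c3, c4⟩

theorem IsGlobalWeakSolution.exists_isEnergySolution {u : ℝ × Sp n → St N}
    (hu : u ∈ energyClass n m N) (h : IsGlobalWeakSolution A u) :
    ∃ C, IsEnergySolution hA hLam (energyCurve hu) C :=
  exists_isEnergySolution_of_weak fun _ hθ => integral_deriv_smul_energyCurve hA hLam hu h hθ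

theorem exists_isEnergySolution (hlam : 0 < lam) (u₀ : L2St n N) :
    ∃ d C, IsEnergySolution hA hLam d C ∧ C 0 = u₀ := by
  obtain ⟨d, C, c1, c2, c3, c4, c5⟩ := (rhoSystem n m (St N)).exists_solution hlam
    (energyOp hA hLam) (energyOp_coercive hA hLam) u₀
  exact ⟨d, C, ⟨c1, c2, c3, c4⟩, c5⟩

namespace IsEnergySolution

variable {d d' : Lp (L2St n N) 2 halfLine} {C C' : ℝ → L2St n N}

theorem le_energy (h : IsEnergySolution hA hLam d C) : ∀ᵐ t ∂halfLine,
    lam * ‖d t‖ ^ 2 ≤ (inner ℂ (energyOp hA hLam d t) (d t)).re := by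
  filter_upwards [le_re_inner_energyOp hA hLam d, h.rel] with t h1 h2
  exact h1 ⟨_, h2⟩

theorem integrable_energy (hA : IsElliptic A lam Lam) (hLam : 0 < Lam)
    (d : Lp (L2St n N) 2 halfLine) :
    Integrable (fun s => (inner ℂ (energyOp hA hLam d s) (d s)).re) halfLine :=
  integrable_re_inner (Lp.memLp _) (Lp.memLp _)

theorem le_norm_sq (h : IsEnergySolution hA hLam d C) : 2 * lam * ‖d‖ ^ 2 ≤ ‖C 0‖ ^ 2 := by
  rw [h.energy 0 le_rfl, norm_sq_Lp_two, mul_assoc, ← integral_const_mul]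
  refine mul_le_mul_of_nonneg_left ?_ (zero_le_two (α := ℝ))
  exact integral_mono_ae ((integrable_norm_sq (Lp.memLp d)).const_mul _)
    (integrable_energy hA hLam d) h.le_energy

theorem norm_sq_le (h : IsEnergySolution hA hLam d C) : ‖C 0‖ ^ 2 ≤ 2 * Lam * ‖d‖ ^ 2 := by
  rw [h.energy 0 le_rfl, norm_sq_Lp_two, mul_assoc, ← integral_const_mul Lam]
  refine mul_le_mul_of_nonneg_left ?_ (zero_le_two (α := ℝ))
  exact integral_mono_ae (integrable_energy hA hLam d)
    ((integrable_norm_sq (Lp.memLp d)).const_mul _) (re_inner_energyOp_le hA hLam d)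

/-- The squared norm at time `t` is an integral over `(t,∞)` of a density that is nonnegative by
Gårding. -/
theorem antitoneOn_norm (hlam : 0 < lam) (h : IsEnergySolution hA hLam d C) :
    AntitoneOn (fun t => ‖C t‖) (Ici 0) := by
  intro s hs t ht hst
  refine (sq_le_sq₀ (norm_nonneg _) (norm_nonneg _)).1 ?_
  have hs0 : (0 : ℝ) ≤ s := hs
  have hsub : Ioi s ⊆ Ioi (0 : ℝ) := Ioi_subset_Ioi hs0
  rw [h.energy t ht, h.energy s hs]
  refine mul_le_mul_of_nonneg_left (setIntegral_mono_set ?_ ?_ ?_) (zero_le_two (α := ℝ))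
  · exact (integrable_energy hA hLam d).mono_measure (Measure.restrict_mono hsub le_rfl)
  · refine ae_mono (Measure.restrict_mono hsub le_rfl) ?_
    filter_upwards [h.le_energy] with r hr
    exact le_trans (by positivity) hr
  · exact (Ioi_subset_Ioi hst).eventuallyLE

theorem tendsto_zero (h : IsEnergySolution hA hLam d C) : Tendsto C atTop (𝓝 0) := by
  have h1 := intervalIntegral_tendsto_integral_Ioi 0 (integrable_energy hA hLam d) tendsto_id
  have h2 : Tendsto (fun t => ‖C t‖ ^ 2) atTop (𝓝 0) := by
    have h3 := (tendsto_const_nhds (x := ∫ s in Ioi (0 : ℝ),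
      (inner ℂ (energyOp hA hLam d s) (d s)).re)).sub h1
    rw [sub_self] at h3
    have h4 := h3.const_mul 2
    rw [mul_zero] at h4
    refine h4.congr' ?_
    filter_upwards [eventually_ge_atTop 0] with t ht
    rw [h.energy t ht]
    have i1 := integrable_energy hA hLam d
    have := intervalIntegral.integral_Ioi_sub_Ioi (f := fun s =>
      (inner ℂ (energyOp hA hLam d s) (d s)).re) i1 ht
    rw [id, ← this]
    ring
  rw [tendsto_zero_iff_norm_tendsto_zero]
  have := h2.sqrt
  simpa using this

theorem intervalIntegrable (hA : IsElliptic A lam Lam) (hLam : 0 < Lam)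
    (d : Lp (L2St n N) 2 halfLine) {s t : ℝ} (hs : 0 ≤ s) (ht : s ≤ t) :
    IntervalIntegrable (fun s => (rhoSystem n m (St N)).a (energyOp hA hLam d s)) volume s t :=
  MemLp.intervalIntegrable_halfLine ((rhoSystem n m (St N)).a.comp_memLp' (Lp.memLp _)) hs ht

theorem integral_deriv_smul (h : IsEnergySolution hA hLam d C) {θ : ℝ → ℝ}
    (hθ : IsTestFunction (Ioi 0) θ) :
    ∫ t in Ioi 0, ((deriv θ t : ℝ) : ℂ) • (rhoSystem n m (St N)).b (d t) =
        ∫ t in Ioi 0, (θ t : ℂ) • (rhoSystem n m (St N)).a (energyOp hA hLam d t) := by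
  have h1 := integral_deriv_smul_of_eq_sub_integral
    (fun T hT => intervalIntegrable hA hLam d le_rfl hT) h.evol hθ
  refine Eq.trans (integral_congr_ae ?_) h1
  filter_upwards [h.rel] with t ht
  rw [ht]
  rfl

/-- An energy solution is determined by its initial value. -/
theorem eq_of_initial_eq (hlam : 0 < lam) (h : IsEnergySolution hA hLam d C)
    (h' : IsEnergySolution hA hLam d' C') (h0 : C 0 = C' 0) : d = d' ∧ ∀ t, 0 ≤ t → C t = C' t := by
  -- The difference `d - d'` has an energy curve of its own. Injectivity of `σ` and continuity
  -- identify it with `C - C'`, so its initial value is zero and the energy bounds kill it.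
  obtain ⟨C'', h''⟩ := exists_isEnergySolution_of_weak (hA := hA) (hLam := hLam) (d := d - d') (by
    intro θ hθ
    have i1 := hθ.deriv.integrable_smul_memLp ((rhoSystem n m (St N)).b.comp_memLp' (Lp.memLp d))
    have i2 := hθ.deriv.integrable_smul_memLp ((rhoSystem n m (St N)).b.comp_memLp' (Lp.memLp d'))
    have i3 := hθ.integrable_smul_memLp ((rhoSystem n m (St N)).a.comp_memLp'
      (Lp.memLp (energyOp hA hLam d)))
    have i4 := hθ.integrable_smul_memLp ((rhoSystem n m (St N)).a.comp_memLp'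
      (Lp.memLp (energyOp hA hLam d')))
    have e := congrArg₂ (· - ·) (h.integral_deriv_smul hθ) (h'.integral_deriv_smul hθ)
    have e1 := integral_sub i1 i2
    have e2 := integral_sub i3 i4
    simp only [Function.comp_apply] at e1 e2
    have e := e1.trans (e.trans e2.symm)
    refine Eq.trans (integral_congr_ae ?_) (e.trans (integral_congr_ae ?_))
    · filter_upwards [Lp.coeFn_sub d d'] with t ht
      rw [ht, Pi.sub_apply, map_sub, smul_sub]
    · rw [map_sub]
      filter_upwards [Lp.coeFn_sub (energyOp hA hLam d) (energyOp hA hLam d')] with t ht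
      rw [ht, Pi.sub_apply, map_sub, smul_sub])
  have hrel : ∀ᵐ t ∂halfLine, C'' t = C t - C' t := by
    filter_upwards [h.rel, h'.rel, h''.rel, Lp.coeFn_sub d d'] with t e1 e2 e3 e4
    rw [e4, Pi.sub_apply, map_sub, ← e1, ← e2, ← map_sub, ← sub_eq_zero, ← map_sub] at e3
    exact sub_eq_zero.1 ((rhoSystem n m (St N)).σ_inj _ e3)
  have hIci : ∀ᵐ t ∂volume.restrict (Ici (0 : ℝ)), C'' t = C t - C' t := by
    rwa [← restrict_Ioi_eq_restrict_Ici]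
  have heq : EqOn C'' (fun t => C t - C' t) (Ici 0) :=
    Measure.eqOn_of_ae_eq hIci h''.continuousOn (h.continuousOn.sub h'.continuousOn)
      (by rw [interior_Ici, closure_Ioi])
  have hz : d - d' = 0 := by
    have h1 := h''.le_norm_sq
    rw [heq (mem_Ici.2 le_rfl)] at h1
    simp only [h0, sub_self, norm_zero] at h1
    have h2 : ‖d - d'‖ ^ 2 ≤ 0 := by
      by_contra hc
      have : 0 < 2 * lam * ‖d - d'‖ ^ 2 := mul_pos (by positivity) (not_le.1 hc)
      linarith [h1, (by norm_num : (0 : ℝ) ^ 2 = 0)]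
    have h3 : ‖d - d'‖ = 0 := by
      have := sq_nonneg ‖d - d'‖
      exact pow_eq_zero_iff (two_ne_zero) |>.1 (le_antisymm h2 this)
    exact norm_eq_zero.1 h3
  refine ⟨sub_eq_zero.1 hz, fun t ht => ?_⟩
  have h1 := h''.antitoneOn_norm hlam (mem_Ici.2 le_rfl) (mem_Ici.2 ht) ht
  simp only [heq (mem_Ici.2 le_rfl), h0, sub_self, norm_zero] at h1
  have h2 := norm_eq_zero.1 (le_antisymm h1 (norm_nonneg _))
  rw [heq (mem_Ici.2 ht)] at h2
  exact sub_eq_zero.1 h2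

end IsEnergySolution

end EnergySolution

section

open scoped FourierTransform

/-! ### Weak derivatives and integrability from slices. -/

section Slabs

variable {n N : ℕ}

theorem restrict_slab (I : Set ℝ) : (volume : Measure (ℝ × Sp n)).restrict (I ×ˢ univ) =
    (volume.restrict I).prod volume := by
  rw [Measure.volume_eq_prod, ← Measure.prod_restrict, Measure.restrict_univ]

theorem IsTestFunction.slice {Q : Set (ℝ × Sp n)} {φ : ℝ × Sp n → ℝ} (h : IsTestFunction Q φ)
    (t : ℝ) : IsTestFunction univ fun x => φ (t, x) := by
  refine ⟨h.1.comp (contDiff_const.prodMk contDiff_id), ?_, subset_univ _⟩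
  have hc : IsCompact (Prod.snd '' tsupport φ) := h.2.1.isCompact.image continuous_snd
  exact HasCompactSupport.of_support_subset_isCompact hc fun x hx =>
    ⟨(t, x), subset_tsupport _ hx, rfl⟩

theorem hasWeakDerivOn_of_slices {I : Set ℝ} (hI : IsOpen I) {γ : Fin n → ℕ}
    {u g : ℝ × Sp n → St N} (hu : LocallyIntegrableOn u (I ×ˢ univ))
    (hg : LocallyIntegrableOn g (I ×ˢ univ))
    (h : ∀ᵐ t ∂(volume.restrict I), ∃ f k : L2St n N, (f =ᵐ[volume] fun x => u (t, x)) ∧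
      (k =ᵐ[volume] fun x => g (t, x)) ∧ ∀ᵐ ξ, sym γ ξ • (𝓕 f) ξ = (𝓕 k) ξ) :
    HasWeakDerivOn (spaceDir n) (I ×ˢ univ) γ u g := by
  refine ⟨hu, hg, fun φ hφ => ?_⟩
  have hQ : IsOpen (I ×ˢ (univ : Set (Sp n))) := hI.prod isOpen_univ
  have i1 := ((hφ.multiDeriv (spaceDir n) γ).integrable_smul hQ hu).integrableOn
    (s := I ×ˢ (univ : Set (Sp n)))
  have i2 := (hφ.integrable_smul hQ hg).integrableOn (s := I ×ˢ (univ : Set (Sp n)))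
  rw [IntegrableOn, restrict_slab] at i1 i2
  rw [restrict_slab, integral_prod _ i1, integral_prod _ i2, ← integral_smul]
  refine integral_congr_ae ?_
  filter_upwards [h] with t ⟨f, k, hf, hk, hfk⟩
  have h1 := (forall_integral_multiDeriv_smul_iff γ f k).2 hfk _ (hφ.slice t)
  have h2 : ∀ x, multiDeriv (spaceDir n) γ φ (t, x) = multiDeriv (dir n) γ (fun x => φ (t, x)) x :=
    fun x => (congrFun (multiDeriv_slice hφ.1 (dir n) γ t) x).symm
  simp only [h2]
  rw [← integral_congr_ae (hf.mono fun x hx => congrArg (fun v =>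
    multiDeriv (dir n) γ (fun x => φ (t, x)) x • v) hx), h1]
  congr 1
  exact integral_congr_ae (hk.mono fun x hx => congrArg (fun v => φ (t, x) • v) hx)

theorem memLp_of_slices {F : Type*} [NormedAddCommGroup F] [TopologicalSpace.SeparableSpace F]
    {μ : Measure ℝ} [SFinite μ] {g : ℝ × Sp n → F}
    (hg : AEStronglyMeasurable g (μ.prod volume)) {W : ℝ → Lp F 2 (volume : Measure (Sp n))}
    (hW : MemLp W 2 μ) (h : ∀ᵐ t ∂μ, W t =ᵐ[volume] fun x => g (t, x)) :
    MemLp g 2 (μ.prod volume) := by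
  have hs : sliceLp volume g =ᵐ[μ] W := by
    filter_upwards [h] with t ht using sliceLp_eq ht.symm
  refine ⟨hg, ?_⟩
  rw [← eLpNorm_sliceLp hg, eLpNorm_congr_ae hs]
  · exact hW.2
  · filter_upwards [h] with t ht using (memLp_congr_ae ht).1 (Lp.memLp _)

/-- Square integrability on the slabs `(0, T) × ℝⁿ`. -/
def MemLpSlabs {F : Type*} [NormedAddCommGroup F] (g : ℝ × Sp n → F) : Prop :=
  ∀ T : ℝ, MemLp g 2 (volume.restrict (Ioo 0 T ×ˢ univ))

variable {F : Type*} [NormedAddCommGroup F] {g : ℝ × Sp n → F}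

theorem MemLpSlabs.locallyIntegrableOn_slab (h : MemLpSlabs g) (T : ℝ) :
    LocallyIntegrableOn g (Ioo 0 T ×ˢ univ) :=
  locallyIntegrableOn_of_locallyIntegrable_restrict ((h T).locallyIntegrable (by norm_num))

theorem MemLpSlabs.locallyIntegrableOn (h : MemLpSlabs g) : LocallyIntegrableOn g (halfSpace n) := by
  intro p hp
  have hp0 : 0 < p.1 := hp.1
  have hs : p ∈ Ioo 0 (p.1 + 1) ×ˢ (univ : Set (Sp n)) := ⟨⟨hp0, by linarith⟩, mem_univ _⟩
  have := h.locallyIntegrableOn_slab (p.1 + 1) p hs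
  rw [(isOpen_Ioo.prod isOpen_univ).nhdsWithin_eq hs] at this
  exact this.filter_mono nhdsWithin_le_nhds

theorem MemLpSlabs.memLp_compact (h : MemLpSlabs g) {K : Set (ℝ × Sp n)} (hK : IsCompact K)
    (hKs : K ⊆ halfSpace n) : MemLp g 2 (volume.restrict K) := by
  obtain ⟨T, hT⟩ := (hK.image continuous_fst).bddAbove
  have hsub : K ⊆ Ioo 0 (T + 1) ×ˢ univ := fun p hp =>
    ⟨⟨(hKs hp).1, (hT (mem_image_of_mem Prod.fst hp)).trans_lt (lt_add_one T)⟩, mem_univ _⟩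
  exact (h (T + 1)).mono_measure (Measure.restrict_mono hsub le_rfl)

theorem memLpSlabs_of_slices [TopologicalSpace.SeparableSpace F]
    (hg : AEStronglyMeasurable g (halfLine.prod volume)) {W : ℝ → Lp F 2 (volume : Measure (Sp n))}
    (hW : ∀ T, MemLp W 2 (volume.restrict (Ioo 0 T)))
    (h : ∀ᵐ t ∂halfLine, W t =ᵐ[volume] fun x => g (t, x)) : MemLpSlabs g := by
  intro T
  have hle : volume.restrict (Ioo 0 T) ≤ halfLine := Measure.restrict_mono (fun x hx => hx.1) le_rfl
  rw [restrict_slab]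
  refine memLp_of_slices (hg.mono_measure (Measure.prod_mono hle le_rfl)) (hW T) (ae_mono hle h)

theorem MemLp.memLpSlabs (hg : MemLp g 2 (halfLine.prod volume)) : MemLpSlabs g := fun T => by
  rw [restrict_slab]
  exact hg.mono_measure (Measure.prod_mono (Measure.restrict_mono (fun x hx => hx.1) le_rfl) le_rfl)

end Slabs

/-! ### Derivatives of order at most `m` from the pair `(C, ρ C)`. -/

section DerivCurves

variable {n m N : ℕ} [NeZero n]

variable (m N) in
/-- The operator on the Fourier side taking `(C, ρ C)` to the `γ`-th derivative of `𝓕⁻¹ C`. -/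
def derivOp (γ : Fin n → ℕ) (hγ : ∑ i, γ i ≤ m) : L2St n N × L2St n N →L[ℂ] L2St n N :=
  (FourierTransform.fourierInvCLM ℂ (L2St n N)).comp
    ((divOp m (sym γ) 2 (continuous_sym γ) (fun ξ => (norm_sym_le γ hγ ξ).trans (by
        nlinarith [sq_nonneg (rho m ξ - 1)]))).coprod
      (divOp m (fun ξ => sym γ ξ * (rho m ξ : ℂ)) 2
        ((continuous_sym γ).mul (Complex.continuous_ofReal.comp continuous_rho)) (fun ξ => by
          have h1 := norm_sym_le γ hγ ξ
          have h2 := rho_nonneg (m := m) ξ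
          rw [norm_mul, Complex.norm_real, Real.norm_of_nonneg h2]
          nlinarith [sq_nonneg (rho m ξ - 1)])))

/-- Split `1 = 1/(1+ρ²) + ρ²/(1+ρ²)`: then `sym γ · C` is `sym γ/(1+ρ²)` applied to `C` plus `sym γ
ρ/(1+ρ²)` applied to `ρ C`, and both multipliers are bounded. -/
theorem fourier_derivOp {γ : Fin n → ℕ} (hγ : ∑ i, γ i ≤ m) {C d : L2St n N}
    (h : (rhoSystem n m (St N)).σ C = (rhoSystem n m (St N)).b d) :
    ∀ᵐ ξ, sym γ ξ • C ξ = (𝓕 (derivOp m N γ hγ (C, d))) ξ := by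
  rw [derivOp, ContinuousLinearMap.comp_apply, FourierTransform.fourierInvCLM_apply,
    FourierTransform.fourier_fourierInv_eq, ContinuousLinearMap.coprod_apply]
  filter_upwards [(rhoSystem_b_eq_σ_iff C d).1 h, Lp.coeFn_add (divOp m (sym γ) 2 _ _ C)
    (divOp m (fun ξ => sym γ ξ * (rho m ξ : ℂ)) 2 _ _ d), coeFn_divOp C, coeFn_divOp d]
    with ξ h1 h2 h3 h4
  rw [h2, Pi.add_apply, h3, h4, h1, smul_smul, ← add_smul]
  congr 1
  have : ((1 + rho m ξ ^ 2 : ℝ) : ℂ) ≠ 0 := by exact_mod_cast (one_add_rho_sq_pos ξ).ne'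
  field_simp
  push_cast
  ring

end DerivCurves

/-! ### The function on the half-space with slices `𝓕⁻¹ (C t)`. -/

section SolutionFunction

variable {n m N : ℕ} [NeZero n] {A : Coeff n m N} {lam Lam : ℝ}
  {hA : IsElliptic A lam Lam} {hLam : 0 < Lam} {d : Lp (L2St n N) 2 halfLine} {C : ℝ → L2St n N}

/-- `u` is the function on the half-space with slices `𝓕⁻¹ (C t)`. -/
structure HasSlices (C : ℝ → L2St n N) (u : ℝ × Sp n → St N) : Prop where
  meas : AEStronglyMeasurable u (halfLine.prod volume)
  slices : ∀ᵐ t ∂halfLine, (𝓕⁻ (C t) : L2St n N) =ᵐ[volume] fun x => u (t, x)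

namespace IsEnergySolution

theorem aestronglyMeasurable (h : IsEnergySolution hA hLam d C) :
    AEStronglyMeasurable C halfLine :=
  (h.continuousOn.mono Ioi_subset_Ici_self).aestronglyMeasurable measurableSet_Ioi

theorem exists_hasSlices (h : IsEnergySolution hA hLam d C) : ∃ u, HasSlices C u := by
  have hU : AEStronglyMeasurable (fun t => (𝓕⁻ (C t) : L2St n N)) halfLine :=
    (FourierTransform.fourierInvCLM ℂ (L2St n N)).continuous.comp_aestronglyMeasurable
      h.aestronglyMeasurable
  obtain ⟨u, hu, hs⟩ := exists_slice_eq hU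
  exact ⟨u, hu.aestronglyMeasurable, hs.mono fun t ht => ht.symm⟩

theorem memLp_Ioo (h : IsEnergySolution hA hLam d C) (T : ℝ) :
    MemLp C 2 (volume.restrict (Ioo 0 T)) := by
  obtain ⟨c, hc⟩ := isCompact_Icc.exists_bound_of_continuousOn
    (h.continuousOn.mono (fun x (hx : x ∈ Icc 0 T) => hx.1))
  have hle : volume.restrict (Ioo 0 T) ≤ halfLine := Measure.restrict_mono (fun x hx => hx.1) le_rfl
  refine MemLp.of_bound (h.aestronglyMeasurable.mono_measure hle) c ?_
  refine (ae_restrict_iff' measurableSet_Ioo).2 (Eventually.of_forall fun t ht => ?_)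
  exact hc t ⟨ht.1.le, ht.2.le⟩

/-- All derivatives of order at most `m` exist and are square integrable on slabs. -/
theorem exists_slab_deriv (h : IsEnergySolution hA hLam d C) {γ : Fin n → ℕ}
    (hγ : ∑ i, γ i ≤ m) : ∃ g : ℝ × Sp n → St N, MemLpSlabs g ∧
      ∀ᵐ t ∂halfLine, ∃ k : L2St n N, (k =ᵐ[volume] fun x => g (t, x)) ∧
        ∀ᵐ ξ, sym γ ξ • C t ξ = (𝓕 k) ξ := by
  have hm : AEStronglyMeasurable (fun t => derivOp m N γ hγ (C t, d t)) halfLine :=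
    (derivOp m N γ hγ).continuous.comp_aestronglyMeasurable
      (h.aestronglyMeasurable.prodMk (Lp.aestronglyMeasurable d))
  obtain ⟨g, hg, hs⟩ := exists_slice_eq hm
  refine ⟨g, memLpSlabs_of_slices hg.aestronglyMeasurable (W := fun t => derivOp m N γ hγ (C t, d t))
    (fun T => ?_) (hs.mono fun t ht => ht.symm), ?_⟩
  · have hle : volume.restrict (Ioo 0 T) ≤ halfLine :=
      Measure.restrict_mono (fun x hx => hx.1) le_rfl
    have h1 := ((derivOp m N γ hγ).comp (ContinuousLinearMap.inl ℂ _ _)).comp_memLp' (h.memLp_Ioo T)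
    have h2 := ((derivOp m N γ hγ).comp (ContinuousLinearMap.inr ℂ _ _)).comp_memLp'
      ((Lp.memLp d).mono_measure hle)
    convert h1.add h2 using 2 with t
    simp [← map_add]
  · filter_upwards [hs, h.rel] with t h1 h2
    exact ⟨_, h1.symm, fourier_derivOp hγ h2⟩

theorem memLpSlabs (h : IsEnergySolution hA hLam d C) {u : ℝ × Sp n → St N} (hu : HasSlices C u) :
    MemLpSlabs u :=
  memLpSlabs_of_slices hu.meas (fun T =>
    (FourierTransform.fourierInvCLM ℂ (L2St n N)).comp_memLp' (h.memLp_Ioo T)) hu.slices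

theorem hasWeakDerivOn (h : IsEnergySolution hA hLam d C) {u : ℝ × Sp n → St N}
    (hu : HasSlices C u) {γ : Fin n → ℕ} {g : ℝ × Sp n → St N} (hg : MemLpSlabs g)
    (hgs : ∀ᵐ t ∂halfLine, ∃ k : L2St n N, (k =ᵐ[volume] fun x => g (t, x)) ∧
        ∀ᵐ ξ, sym γ ξ • C t ξ = (𝓕 k) ξ) :
    HasWeakDerivOn (spaceDir n) (halfSpace n) γ u g ∧
      ∀ T, HasWeakDerivOn (spaceDir n) (Ioo 0 T ×ˢ univ) γ u g := by
  have key : ∀ᵐ t ∂halfLine, ∃ f k : L2St n N, (f =ᵐ[volume] fun x => u (t, x)) ∧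
      (k =ᵐ[volume] fun x => g (t, x)) ∧ ∀ᵐ ξ, sym γ ξ • (𝓕 f) ξ = (𝓕 k) ξ := by
    filter_upwards [hu.slices, hgs] with t h1 ⟨k, h2, h3⟩
    refine ⟨_, k, h1, h2, ?_⟩
    rwa [FourierTransform.fourier_fourierInv_eq]
  exact ⟨hasWeakDerivOn_of_slices isOpen_Ioi (h.memLpSlabs hu).locallyIntegrableOn
    hg.locallyIntegrableOn key, fun T => hasWeakDerivOn_of_slices isOpen_Ioo
      ((h.memLpSlabs hu).locallyIntegrableOn_slab T) (hg.locallyIntegrableOn_slab T)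
      (ae_mono (Measure.restrict_mono (fun x hx => hx.1) le_rfl) key)⟩

theorem memL2Hm (h : IsEnergySolution hA hLam d C) {u : ℝ × Sp n → St N} (hu : HasSlices C u)
    (T : ℝ) : MemL2Hm m T u := fun γ hγ => by
  obtain ⟨g, hg, hgs⟩ := h.exists_slab_deriv hγ
  exact ⟨g, (h.hasWeakDerivOn hu hg hgs).2 T, hg T⟩

theorem memL2HmLoc (h : IsEnergySolution hA hLam d C) {u : ℝ × Sp n → St N} (hu : HasSlices C u) :
    MemL2HmLoc m u := fun γ hγ => by
  obtain ⟨g, hg, hgs⟩ := h.exists_slab_deriv hγ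
  exact ⟨g, (h.hasWeakDerivOn hu hg hgs).1, fun K hK hKs => hg.memLp_compact hK hKs⟩

theorem exists_grad (h : IsEnergySolution hA hLam d C) {u : ℝ × Sp n → St N} (hu : HasSlices C u) :
    ∃ G : ℝ × Sp n → Grad n m N, MemLp G 2 (halfLine.prod volume) ∧
      (∀ᵐ t ∂halfLine, riesz n m N (d t) =ᵐ[volume] fun x => G (t, x)) ∧
      ∀ α : MultiIndex n m, HasWeakDerivOn (spaceDir n) (halfSpace n) α.1 u
        fun p => gradProj α (G p) := by
  let R := (riesz n m N).compLpL 2 halfLine d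
  have hR := (riesz n m N).coeFn_compLpL (p := 2) (μ := halfLine) d
  obtain ⟨G, hG⟩ := (sliceEquiv (Grad n m N) halfLine volume).surjective R
  have hs : ∀ᵐ t ∂halfLine, riesz n m N (d t) =ᵐ[volume] fun x => G (t, x) := by
    filter_upwards [hR, coeFn_sliceEquiv G] with t h1 h2
    rw [hG, h1] at h2
    exact h2
  refine ⟨G, Lp.memLp G, hs, fun α => ?_⟩
  refine (h.hasWeakDerivOn hu (MemLp.memLpSlabs ((gradProj α).comp_memLp' (Lp.memLp G))) ?_).1
  filter_upwards [hs, h.rel] with t h1 h2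
  refine ⟨(gradProj α).compLp (riesz n m N (d t)), ?_, ?_⟩
  · filter_upwards [h1, (gradProj α).coeFn_compLp (riesz n m N (d t))] with x h3 h4
    rw [h4, h3]; rfl
  · filter_upwards [gradProj_fourier_riesz_of_σ_eq h2 α, fourier_gradProj α (riesz n m N (d t))]
      with ξ h3 h4
    rw [h4, h3]

theorem mem_energyClass (h : IsEnergySolution hA hLam d C) {u : ℝ × Sp n → St N}
    (hu : HasSlices C u) : u ∈ energyClass n m N := by
  obtain ⟨G, hG, -, hd⟩ := h.exists_grad hu
  refine ⟨(h.memLpSlabs hu).locallyIntegrableOn, fun α => ⟨_, hd α, ?_⟩⟩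
  rw [restrict_halfSpace]
  exact (gradProj α).comp_memLp' hG

theorem riesz_eq_spatialGrad (h : IsEnergySolution hA hLam d C) {u : ℝ × Sp n → St N}
    (hu : HasSlices C u) :
    ∀ᵐ t ∂halfLine, riesz n m N (d t) =ᵐ[volume] fun x => spatialGrad m u (t, x) := by
  obtain ⟨G, hG, hs, hd⟩ := h.exists_grad hu
  have h1 : spatialGrad m u =ᵐ[halfLine.prod volume] G := by
    rw [← restrict_halfSpace]
    exact weakGrad_ae_eq isOpen_halfSpace hd
  filter_upwards [hs, Measure.ae_ae_of_ae_prod h1] with t h2 h3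
  exact h2.trans (EventuallyEq.symm h3)

theorem gradCurve_eq (h : IsEnergySolution hA hLam d C) {u : ℝ × Sp n → St N}
    (hu : HasSlices C u) : ∀ᵐ t ∂halfLine, gradCurve (h.mem_energyClass hu) t = riesz n m N (d t) := by
  filter_upwards [h.riesz_eq_spatialGrad hu, coeFn_gradCurve (h.mem_energyClass hu)] with t h1 h2
  exact Lp.ext (h2.trans h1.symm)

end IsEnergySolution

end SolutionFunction

end

section

open scoped SchwartzMap FourierTransform LineDeriv

/-! ### Testing the abstract equation against smooth curves. -/

section Duality

variable {H : Type*} [NormedAddCommGroup H] [InnerProductSpace ℂ H] [CompleteSpace H]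

theorem tendsto_integral_re_inner {P : ℕ → H → H} (hP : ∀ k x, ‖P k x‖ ≤ ‖x‖)
    (hPc : ∀ k, Continuous (P k)) (hPt : ∀ x, Tendsto (fun k => P k x) atTop (𝓝 x)) {f g : ℝ → H}
    {a b : ℝ} (hf : Continuous f) (hg : IntervalIntegrable g volume a b) :
    Tendsto (fun k => ∫ t in a..b, (inner ℂ (P k (f t)) (g t)).re) atTop
      (𝓝 (∫ t in a..b, (inner ℂ (f t) (g t)).re)) := by
  have hm : ∀ {w : ℝ → H}, Continuous w →
      AEStronglyMeasurable (fun t => (inner ℂ (w t) (g t)).re) (volume.restrict (uIoc a b)) :=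
    fun hw => Complex.continuous_re.comp_aestronglyMeasurable
      (hw.aestronglyMeasurable.inner (intervalIntegrable_iff.1 hg).aestronglyMeasurable)
  refine intervalIntegral.tendsto_integral_filter_of_dominated_convergence
    (fun t => ‖f t‖ * ‖g t‖) (Eventually.of_forall fun k => hm ((hPc k).comp hf)) ?_
    (hg.norm.continuousOn_mul hf.norm.continuousOn) ?_
  · refine Eventually.of_forall fun k => Eventually.of_forall fun t _ => ?_
    refine (Complex.abs_re_le_norm _).trans ((norm_inner_le_norm _ _).trans ?_)
    exact mul_le_mul_of_nonneg_right (hP k _) (norm_nonneg _)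
  · exact Eventually.of_forall fun t _ => (Complex.continuous_re.tendsto _).comp
      ((hPt (f t)).inner tendsto_const_nhds)

namespace MultSystem

variable (M : MultSystem H) {Φ Φ' Ψ C h : ℝ → H} {T : ℝ}

theorem a_eq_σ {x y : H} (h : M.σ x = M.b y) : M.a x = M.σ y := by
  refine sub_eq_zero.1 (M.b_inj _ ?_)
  rw [map_sub, M.ba, h, M.bσ, sub_self]

/-- The weak form of `∂_t C = -ρ h`, tested against curves with `Ψ = ρ Φ`: the real part. -/
theorem integral_re_inner_deriv (hT : 0 ≤ T) (hΦ : ∀ t, HasDerivAt Φ (Φ' t) t)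
    (hΦ' : Continuous Φ') (hΨ : Continuous Ψ) (hrel : ∀ t, M.σ (Φ t) = M.b (Ψ t)) (h0 : Φ 0 = 0)
    (h1 : Φ T = 0) (hC : ContinuousOn C (Icc 0 T)) (hh : IntervalIntegrable h volume 0 T)
    (hev : ∀ t ∈ Icc 0 T, M.σ (C t) = M.σ (C 0) - ∫ s in (0 : ℝ)..t, M.a (h s)) :
    ∫ t in (0 : ℝ)..T, (inner ℂ (Φ' t) (C t)).re = ∫ t in (0 : ℝ)..T, (inner ℂ (Ψ t) (h t)).re := by
  have hCi : IntervalIntegrable C volume 0 T := by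
    refine ContinuousOn.intervalIntegrable ?_
    rwa [uIcc_of_le hT]
  have hP : ∀ k, Continuous fun x => M.Q k (M.σ x) := fun k => ((M.Q k).comp M.σ).continuous
  -- Only `σ C`, not `C`, is known to be a primitive. Inserting `Q k σ` and moving `σ` onto `C`
  -- permits integration by parts; the result is rewritten with `a Φ = σ Ψ`, and `Q k σ` tends to
  -- the identity.
  refine tendsto_nhds_unique (tendsto_integral_re_inner M.P_le hP M.P_tendsto hΦ' hCi) ?_
  refine (tendsto_integral_re_inner M.P_le hP M.P_tendsto hΨ hh).congr fun k => ?_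
  have hah : IntervalIntegrable (fun s => -M.a (h s)) volume 0 T := by
    rw [intervalIntegrable_iff] at hh ⊢
    exact (M.a.integrable_comp hh).neg
  have hQΦ' : Continuous fun t => M.Q k (Φ' t) := (M.Q k).continuous.comp hΦ'
  have ibp := integral_bilin_deriv (reInner H) (f := fun t => M.Q k (Φ t))
    (f' := fun t => M.Q k (Φ' t)) (g := fun t => M.σ (C t)) (g' := fun s => -M.a (h s)) hT
    (hQΦ'.intervalIntegrable _ _) hah
    (fun t _ => by
      have hd : ∀ s, HasDerivAt (fun t => M.Q k (Φ t)) (M.Q k (Φ' s)) s := fun s =>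
        ((M.Q k).restrictScalars ℝ).hasFDerivAt.comp_hasDerivAt s (hΦ s)
      rw [intervalIntegral.integral_eq_sub_of_hasDerivAt (fun s _ => hd s)
        (hQΦ'.intervalIntegrable _ _)]
      abel)
    (fun t ht => by rw [intervalIntegral.integral_neg, ← sub_eq_add_neg]; exact hev t ht)
  have hQΦ : Continuous fun t => M.Q k (Φ t) := (M.Q k).continuous.comp
    (continuous_iff_continuousAt.2 fun t => (hΦ t).continuousAt)
  have i1 : IntervalIntegrable (fun t => reInner H (M.Q k (Φ' t)) (M.σ (C t))) volume 0 T := by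
    refine ContinuousOn.intervalIntegrable ?_
    rw [uIcc_of_le hT]
    exact (reInner H).isBoundedBilinearMap.continuous.comp_continuousOn
      (hQΦ'.continuousOn.prodMk (M.σ.continuous.comp_continuousOn hC))
  have i2 : IntervalIntegrable (fun t => reInner H (M.Q k (Φ t)) (-M.a (h t))) volume 0 T :=
    intervalIntegrable_bilin (reInner H).flip hah hQΦ.continuousOn
  rw [intervalIntegral.integral_add i1 i2, h0, h1] at ibp
  simp only [map_zero, zero_apply, sub_zero, map_neg, intervalIntegral.integral_neg,
    reInner_apply] at ibp
  rw [← sub_eq_add_neg, sub_eq_zero] at ibp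
  refine Eq.trans ?_ (ibp.symm.trans ?_)
  · refine intervalIntegral.integral_congr fun t _ => ?_
    simp only [← M.a_eq_σ (hrel t), ← M.a_sa, M.Qa]
  · refine intervalIntegral.integral_congr fun t _ => ?_
    simp only [← M.σ_sa, M.Qσ]

/-- The imaginary part is the real-part identity for the curves multiplied by `I`. -/
theorem integral_inner_deriv (hT : 0 ≤ T) (hΦ : ∀ t, HasDerivAt Φ (Φ' t) t)
    (hΦ' : Continuous Φ') (hΨ : Continuous Ψ) (hrel : ∀ t, M.σ (Φ t) = M.b (Ψ t)) (h0 : Φ 0 = 0)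
    (h1 : Φ T = 0) (hC : ContinuousOn C (Icc 0 T)) (hh : IntervalIntegrable h volume 0 T)
    (hev : ∀ t ∈ Icc 0 T, M.σ (C t) = M.σ (C 0) - ∫ s in (0 : ℝ)..t, M.a (h s)) :
    ∫ t in (0 : ℝ)..T, inner ℂ (Φ' t) (C t) = ∫ t in (0 : ℝ)..T, inner ℂ (Ψ t) (h t) := by
  have i1 : IntervalIntegrable (fun t => inner ℂ (Φ' t) (C t)) volume 0 T := by
    refine ContinuousOn.intervalIntegrable ?_
    rw [uIcc_of_le hT]
    exact hΦ'.continuousOn.inner hC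
  have i2 : IntervalIntegrable (fun t => inner ℂ (Ψ t) (h t)) volume 0 T := by
    refine (hh.norm.continuousOn_mul hΨ.norm.continuousOn).mono_fun
      (hΨ.aestronglyMeasurable.inner (intervalIntegrable_iff.1 hh).aestronglyMeasurable)
      (Eventually.of_forall fun t => ?_)
    simpa using norm_inner_le_norm (𝕜 := ℂ) (Ψ t) (h t)
  have e1 := M.integral_re_inner_deriv hT hΦ hΦ' hΨ hrel h0 h1 hC hh hev
  have e2 := M.integral_re_inner_deriv (Φ := fun t => Complex.I • Φ t)
    (Φ' := fun t => Complex.I • Φ' t) (Ψ := fun t => Complex.I • Ψ t) hT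
    (fun t => (hΦ t).const_smul Complex.I) (hΦ'.const_smul _) (hΨ.const_smul _)
    (fun t => by rw [map_smul, map_smul, hrel]) (by rw [h0, smul_zero]) (by rw [h1, smul_zero])
    hC hh hev
  have hI : ∀ x y : H, (inner ℂ (Complex.I • x) y).re = Complex.imCLM (inner ℂ x y) := fun x y => by
    rw [inner_smul_left]; simp
  simp only [hI] at e2
  change ∫ t in (0 : ℝ)..T, Complex.reCLM (inner ℂ (Φ' t) (C t)) =
    ∫ t in (0 : ℝ)..T, Complex.reCLM (inner ℂ (Ψ t) (h t)) at e1
  rw [Complex.reCLM.intervalIntegral_comp_comm i1, Complex.reCLM.intervalIntegral_comp_comm i2] at e1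
  rw [Complex.imCLM.intervalIntegral_comp_comm i1, Complex.imCLM.intervalIntegral_comp_comm i2] at e2
  exact Complex.ext e1 e2

end MultSystem

end Duality

/-! ### Slices of test functions as differentiable curves in `L²`. -/

section TestSlices

variable {n : ℕ} {F : Type*} [NormedAddCommGroup F] [NormedSpace ℝ F]

theorem memLp_slice {f : ℝ × Sp n → F} (hf : Continuous f) (hc : HasCompactSupport f) (t : ℝ) :
    MemLp (fun x => f (t, x)) 2 (volume : Measure (Sp n)) := by
  refine Continuous.memLp_of_hasCompactSupport (by fun_prop) ?_
  refine HasCompactSupport.intro (hc.image continuous_snd) fun x hx => ?_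
  exact image_eq_zero_of_notMem_tsupport fun h' => hx ⟨_, h', rfl⟩

/-- The slice of a continuous compactly supported function, as an element of `L²`. -/
def testSlice (f : ℝ × Sp n → F) (hf : Continuous f) (hc : HasCompactSupport f) (t : ℝ) :
    Lp F 2 (volume : Measure (Sp n)) := (memLp_slice hf hc t).toLp

theorem coeFn_testSlice {f : ℝ × Sp n → F} {hf : Continuous f} {hc : HasCompactSupport f} (t : ℝ) :
    testSlice f hf hc t =ᵐ[volume] fun x => f (t, x) := (memLp_slice hf hc t).coeFn_toLp

theorem norm_le_of_bound_of_support {s : Set (Sp n)} (hs : IsCompact s) {w : Sp n → F} {c : ℝ}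
    (hc : 0 ≤ c) (h0 : ∀ x, x ∉ s → w x = 0) (hw : ∀ x, ‖w x‖ ≤ c)
    {g : Lp F 2 (volume : Measure (Sp n))} (hg : g =ᵐ[volume] w) :
    ‖g‖ ≤ c * ((volume s) ^ (2 : ℝ≥0∞).toReal⁻¹).toReal := by
  have hind : w = s.indicator w := by
    ext x
    by_cases hx : x ∈ s
    · rw [indicator_of_mem hx]
    · rw [indicator_of_notMem hx, h0 x hx]
  have h1 := eLpNorm_le_of_ae_bound (p := 2) (μ := volume.restrict s) (Eventually.of_forall hw)
  rw [Measure.restrict_apply_univ] at h1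
  have hfin : volume s ^ (2 : ℝ≥0∞).toReal⁻¹ ≠ ⊤ :=
    ENNReal.rpow_ne_top_of_nonneg (by positivity) hs.measure_lt_top.ne
  rw [Lp.norm_def, eLpNorm_congr_ae hg, hind,
    eLpNorm_indicator_eq_eLpNorm_restrict hs.measurableSet]
  refine (ENNReal.toReal_mono (ENNReal.mul_ne_top hfin ENNReal.ofReal_ne_top) h1).trans ?_
  rw [ENNReal.toReal_mul, ENNReal.toReal_ofReal hc, mul_comm]

/-- The time derivative is Lipschitz, so the Taylor remainder is of second order uniformly in `x`.
All slices are supported in one compact set, which turns the uniform bound into an `L²` bound. -/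
theorem hasDerivAt_testSlice {f : ℝ × Sp n → F} (h : IsTestFunction univ f) (t : ℝ) :
    HasDerivAt (testSlice f h.continuous h.2.1) (testSlice (fun p => fderiv ℝ f p (1, 0))
      (h.fderiv_apply (1, 0)).continuous (h.fderiv_apply (1, 0)).2.1 t) t := by
  set f' : ℝ × Sp n → F := fun p => fderiv ℝ f p (1, 0) with hf'
  have h' : IsTestFunction univ f' := h.fderiv_apply (1, 0)
  obtain ⟨L, hL⟩ := h'.1.lipschitzWith_of_hasCompactSupport h'.2.1 (by simp)
  have hd : ∀ s x, HasDerivAt (fun s => f (s, x)) (f' (s, x)) s := fun s x =>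
    (h.1.differentiable (by simp) (s, x)).hasFDerivAt.comp_hasDerivAt s
      ((hasDerivAt_id s).prodMk (hasDerivAt_const s x))
  have hbd : ∀ s x, ‖f (s, x) - f (t, x) - (s - t) • f' (t, x)‖ ≤ L * |s - t| ^ 2 := by
    intro s x
    have := Convex.norm_image_sub_le_of_norm_hasDerivWithin_le (s := uIcc t s) (x := t) (y := s)
      (C := L * |s - t|) (f := fun r => f (r, x) - (r - t) • f' (t, x))
      (f' := fun r => f' (r, x) - (1 : ℝ) • f' (t, x))
      (fun r _ => ((hd r x).sub (((hasDerivAt_id r).sub_const t).smul_const _)).hasDerivWithinAt)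
      (fun r hr => by
        rw [one_smul]
        refine (hL.norm_sub_le _ _).trans ?_
        have : ‖((r, x) : ℝ × Sp n) - (t, x)‖ = |r - t| := by
          rw [Prod.mk_sub_mk, sub_self, Prod.norm_mk, norm_zero, Real.norm_eq_abs]
          exact max_eq_left (abs_nonneg _)
        rw [this]
        exact mul_le_mul_of_nonneg_left (abs_sub_left_of_mem_uIcc hr) L.2)
      (convex_uIcc t s) left_mem_uIcc right_mem_uIcc
    simp only [sub_self, zero_smul, sub_zero, Real.norm_eq_abs] at this
    rw [sub_right_comm] at this
    rwa [pow_two, ← mul_assoc]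
  set κ := ((volume (Prod.snd '' tsupport f)) ^ (2 : ℝ≥0∞).toReal⁻¹).toReal
  have hK : IsCompact (Prod.snd '' tsupport f) := h.2.1.isCompact.image continuous_snd
  have hn : ∀ s, ‖testSlice f h.continuous h.2.1 s - testSlice f h.continuous h.2.1 t -
      (s - t) • testSlice f' h'.continuous h'.2.1 t‖ ≤ (L * κ) * ‖s - t‖ ^ 2 := by
    intro s
    rw [mul_right_comm, Real.norm_eq_abs]
    refine norm_le_of_bound_of_support hK (by positivity) ?_ (hbd s) ?_
    · intro x hx
      have h1 : ∀ r, (r, x) ∉ tsupport f := fun r hr => hx ⟨_, hr, rfl⟩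
      rw [image_eq_zero_of_notMem_tsupport (h1 s), image_eq_zero_of_notMem_tsupport (h1 t),
        image_eq_zero_of_notMem_tsupport (f := f')
          fun h'' => h1 t (tsupport_fderiv_apply_subset ℝ _ h'')]
      simp
    · filter_upwards [Lp.coeFn_sub (testSlice f h.continuous h.2.1 s - testSlice f h.continuous h.2.1 t)
          ((s - t) • testSlice f' h'.continuous h'.2.1 t),
        Lp.coeFn_sub (testSlice f h.continuous h.2.1 s) (testSlice f h.continuous h.2.1 t),
        Lp.coeFn_smul (s - t) (testSlice f' h'.continuous h'.2.1 t),
        coeFn_testSlice (hf := h.continuous) (hc := h.2.1) s,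
        coeFn_testSlice (hf := h.continuous) (hc := h.2.1) t,
        coeFn_testSlice (hf := h'.continuous) (hc := h'.2.1) t] with x e1 e2 e3 e4 e5 e6
      rw [e1, Pi.sub_apply, e2, Pi.sub_apply, e3, Pi.smul_apply, e4, e5, e6]
  rw [hasDerivAt_iff_isLittleO]
  refine (Asymptotics.IsBigO.of_bound (L * κ) (Eventually.of_forall fun s => ?_)).trans_isLittleO
    (Asymptotics.isLittleO_pow_sub_sub t one_lt_two)
  rw [norm_pow]
  simpa using hn s

theorem continuous_testSlice {f : ℝ × Sp n → F} (h : IsTestFunction univ f) :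
    Continuous (testSlice f h.continuous h.2.1) :=
  continuous_iff_continuousAt.2 fun t => (hasDerivAt_testSlice h t).continuousAt

theorem testSlice_eq_zero {f : ℝ × Sp n → F} {hf : Continuous f} {hc : HasCompactSupport f} {t : ℝ}
    (h : ∀ x, f (t, x) = 0) : testSlice f hf hc t = 0 := by
  apply Lp.ext
  filter_upwards [coeFn_testSlice (hf := hf) (hc := hc) t, Lp.coeFn_zero F 2 volume] with x h1 h2
  rw [h1, h, h2]; rfl

end TestSlices

/-! ### Fourier transform of derivatives of vector-valued test functions. -/

section FourierDeriv

variable {n : ℕ} {E : Type*} [NormedAddCommGroup E] [InnerProductSpace ℂ E] [CompleteSpace E]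

theorem fourier_multiDeriv {ψ : Sp n → E} (h : IsTestFunction univ ψ) (α : Fin n → ℕ)
    {f g : Lp E 2 (volume : Measure (Sp n))} (hf : f =ᵐ[volume] ψ)
    (hg : g =ᵐ[volume] multiDeriv (dir n) α ψ) : ∀ᵐ ξ, (𝓕 g) ξ = sym α ξ • (𝓕 f) ξ := by
  let S : 𝓢(Sp n, E) := h.2.1.toSchwartzMap h.1
  let D : 𝓢(Sp n, E) := iterOps (fun i χ => ∂_{dir n i} χ) α S
  have hD : ⇑D = multiDeriv (dir n) α ψ := by
    refine iterOps_rel (R := fun (χ : 𝓢(Sp n, E)) (φ : Sp n → E) => ⇑χ = φ) ?_ α rfl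
    rintro i χ _ rfl
    rfl
  have hF : ∀ ξ, (𝓕 D) ξ = sym α ξ • (𝓕 S) ξ := by
    intro ξ
    have h1 : sym α ξ = iterOps (fun i (y : ℂ) => (2 * Real.pi * Complex.I * (ξ i : ℂ)) * y) α 1 := by
      rw [iterOps_mul, mul_one]; rfl
    rw [h1]
    refine iterOps_rel (R := fun (χ : 𝓢(Sp n, E)) (c : ℂ) => (𝓕 χ) ξ = c • (𝓕 S) ξ) ?_ α
      (one_smul _ _).symm
    rintro i χ c hχ
    rw [SchwartzMap.fourier_lineDerivOp_eq, smul_apply,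
      SchwartzMap.smulLeftCLM_apply_apply (by fun_prop), hχ, mul_smul, mul_smul]
    simp only [dir, EuclideanSpace.inner_single_right, one_mul, conj_trivial]
    rw [← Complex.coe_smul (ξ i)]
    simp only [mul_smul]
  have hfS : f = S.toLp 2 := Lp.ext (hf.trans (S.coeFn_toLp 2 volume).symm)
  have hgD : g = D.toLp 2 := Lp.ext (hg.trans (by rw [← hD]; exact (D.coeFn_toLp 2 volume).symm))
  rw [hfS, hgD, SchwartzMap.toLp_fourier_eq, SchwartzMap.toLp_fourier_eq]
  filter_upwards [(𝓕 S).coeFn_toLp 2 volume, (𝓕 D).coeFn_toLp 2 volume] with ξ h1 h2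
  rw [h1, h2, hF]

end FourierDeriv

end

section

open scoped FourierTransform

/-! ### Energy solutions are weak solutions. -/

section WeakFormulation

variable {n m N : ℕ}

theorem IsTestFunction.mono {E F : Type*} [NormedAddCommGroup E] [NormedSpace ℝ E]
    [NormedAddCommGroup F] [NormedSpace ℝ F] {Q Q' : Set E} {f : E → F} (h : IsTestFunction Q f)
    (hQ : Q ⊆ Q') : IsTestFunction Q' f := ⟨h.1, h.2.1, h.2.2.trans hQ⟩

theorem classicalGrad_eq_sum {E : Type*} [NormedAddCommGroup E] [NormedSpace ℝ E] (e : Fin n → E)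
    (φ : E → St N) : classicalGrad e m φ =
      fun p => ∑ α : MultiIndex n m, gradIncl α (multiDeriv e α.1 φ p) := by
  ext1 p
  rw [← sum_gradIncl_gradProj (classicalGrad e m φ p)]
  rfl

theorem IsTestFunction.classicalGrad {E : Type*} [NormedAddCommGroup E] [NormedSpace ℝ E]
    {Q : Set E} {φ : E → St N} (h : IsTestFunction Q φ) (e : Fin n → E) :
    IsTestFunction Q (classicalGrad e m φ) := by
  have hz : ∀ p, p ∉ tsupport φ → ParabolicCauchy.classicalGrad e m φ p = 0 := by
    intro p hp
    rw [classicalGrad_eq_sum]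
    refine Finset.sum_eq_zero fun α _ => ?_
    have h1 : IsTestFunction (tsupport φ) φ := ⟨h.1, h.2.1, le_rfl⟩
    rw [image_eq_zero_of_notMem_tsupport fun h' => hp ((h1.multiDeriv e α.1).2.2 h'), map_zero]
  have hs : tsupport (ParabolicCauchy.classicalGrad e m φ) ⊆ tsupport φ :=
    closure_minimal (fun p hp => by_contra fun h' => hp (hz p h')) (isClosed_tsupport φ)
  refine ⟨?_, HasCompactSupport.intro h.2.1 hz, hs.trans h.2.2⟩
  rw [classicalGrad_eq_sum]
  exact ContDiff.sum fun α _ =>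
    ((gradIncl α).restrictScalars ℝ).contDiff.comp (h.multiDeriv e α.1).1

/-- A test function on the half-space vanishes for small and for large times. -/
theorem IsTestFunction.exists_time {F : Type*} [NormedAddCommGroup F] [NormedSpace ℝ F]
    {f : ℝ × Sp n → F} (h : IsTestFunction (halfSpace n) f) :
    ∃ T, 0 ≤ T ∧ ∀ t x, t ∉ Ioo 0 T → (t, x) ∉ tsupport f := by
  obtain ⟨T, hT⟩ := (h.2.1.isCompact.image continuous_fst).bddAbove
  refine ⟨max T 0 + 1, by positivity, fun t x ht h' => ht ?_⟩
  have h1 : t ≤ T := hT (mem_image_of_mem Prod.fst h')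
  exact ⟨(h.2.2 h').1, by linarith [le_max_left T 0]⟩

theorem integrable_inner_test {F : Type*} [NormedAddCommGroup F] [InnerProductSpace ℂ F]
    {f g : ℝ × Sp n → F} (h : IsTestFunction (halfSpace n) f)
    (hg : LocallyIntegrableOn g (halfSpace n)) :
    Integrable (fun p => inner ℂ (f p) (g p)) (halfLine.prod volume) := by
  obtain ⟨c, hc⟩ := h.2.1.exists_bound_of_continuous h.continuous
  have hgi : IntegrableOn g (tsupport f) := hg.integrableOn_compact_subset h.2.2 h.2.1
  have h1 : IntegrableOn (fun p => inner ℂ (f p) (g p)) (tsupport f) := by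
    refine (hgi.norm.const_mul c).mono' (h.continuous.aestronglyMeasurable.inner hgi.1)
      (Eventually.of_forall fun p => ?_)
    exact (norm_inner_le_norm _ _).trans (mul_le_mul_of_nonneg_right (hc p) (norm_nonneg _))
  have h2 : Integrable (fun p => inner ℂ (f p) (g p)) (volume : Measure (ℝ × Sp n)) := by
    refine (integrableOn_iff_integrable_of_support_subset fun p hp => subset_tsupport f ?_).1 h1
    intro h0
    exact hp (by simp [h0])
  rw [← restrict_halfSpace]
  exact h2.integrableOn

theorem integral_inner_slices {F : Type*} [NormedAddCommGroup F] [InnerProductSpace ℂ F]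
    [CompleteSpace F]
    {f g : ℝ × Sp n → F} (h : IsTestFunction (halfSpace n) f)
    (hg : LocallyIntegrableOn g (halfSpace n)) {W V : ℝ → Lp F 2 (volume : Measure (Sp n))}
    (hW : ∀ t, W t =ᵐ[volume] fun x => f (t, x))
    (hV : ∀ᵐ t ∂halfLine, V t =ᵐ[volume] fun x => g (t, x)) {T : ℝ} (hT : 0 ≤ T)
    (hfT : ∀ t x, t ∉ Ioo 0 T → f (t, x) = 0) :
    ∫ p in halfSpace n, inner ℂ (f p) (g p) = ∫ t in (0 : ℝ)..T, inner ℂ (W t) (V t) := by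
  rw [restrict_halfSpace, integral_prod _ (integrable_inner_test h hg),
    intervalIntegral.integral_of_le hT]
  have h1 : ∫ t in Ioc 0 T, inner ℂ (W t) (V t) = ∫ t in Ioi 0, inner ℂ (W t) (V t) := by
    refine (setIntegral_eq_of_subset_of_forall_sdiff_eq_zero measurableSet_Ioi
      (fun x hx => hx.1) fun s hs => ?_).symm
    have hs' : W s = 0 := by
      apply Lp.ext
      filter_upwards [hW s, Lp.coeFn_zero F 2 volume] with x h1 h2
      rw [h1, h2, hfT s x fun h' => hs.2 ⟨h'.1, h'.2.le⟩]; rfl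
    rw [hs', inner_zero_left]
  rw [h1]
  refine integral_congr_ae ?_
  filter_upwards [hV] with t ht
  rw [L2.inner_def]
  refine integral_congr_ae ?_
  filter_upwards [hW t, ht] with x h1 h2
  rw [h1, h2]

variable [NeZero n]

/-- A field with Fourier components `sym α Φ` is a true gradient, and its coordinate in the range of
`riesz` is `ρ Φ`. This is applied to the slices of `φ` and `∇^m φ`. -/
theorem riesz_rieszAdj_of_fourier {Φ : L2St n N} {Γ : L2Grad n m N}
    (h : ∀ α : MultiIndex n m, ∀ᵐ ξ, gradProj α ((𝓕 Γ) ξ) = sym α.1 ξ • Φ ξ) :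
    (rhoSystem n m (St N)).σ Φ = (rhoSystem n m (St N)).b (rieszAdj n m N Γ) ∧
      riesz n m N (rieszAdj n m N Γ) = Γ := by
  have h1 : (rhoSystem n m (St N)).σ Φ = (rhoSystem n m (St N)).b (rieszAdj n m N Γ) := by
    rw [rhoSystem_b_eq_σ_iff]
    filter_upwards [rieszAdj_apply Γ, ae_all_iff.2 h, ae_ne_zero (n := n)] with ξ h2 h3 h4
    rw [h2]
    have : ∀ α : MultiIndex n m, starRingEnd ℂ (unitSym α ξ) • gradProj α ((𝓕 Γ) ξ) =
        ((starRingEnd ℂ (unitSym α ξ) * unitSym α ξ) * rho m ξ) • Φ ξ := by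
      intro α
      rw [h3, smul_smul, ← unitSym_mul_rho α h4, mul_assoc]
    rw [Finset.sum_congr rfl fun α _ => this α, ← Finset.sum_smul, ← Finset.sum_mul,
      sum_conj_unitSym_mul h4, one_mul]
  refine ⟨h1, ?_⟩
  have h2 : 𝓕 (riesz n m N (rieszAdj n m N Γ)) = 𝓕 Γ := by
    apply Lp.ext
    filter_upwards [ae_all_iff.2 h, ae_all_iff.2 fun α => gradProj_fourier_riesz_of_σ_eq h1 α]
      with ξ h2 h3
    exact grad_ext fun α => (h3 α).trans (h2 α).symm
  exact (Lp.fourierTransformₗᵢ (Sp n) (Grad n m N)).injective h2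

variable {A : Coeff n m N} {lam Lam : ℝ} {hA : IsElliptic A lam Lam} {hLam : 0 < Lam}
  {d : Lp (L2St n N) 2 halfLine} {C : ℝ → L2St n N}


theorem fourier_testSlice {φ : ℝ × Sp n → St N} (h : IsTestFunction univ φ)
    (hG : IsTestFunction univ (classicalGrad (spaceDir n) m φ)) (t : ℝ) (α : MultiIndex n m) :
    ∀ᵐ ξ, gradProj α ((𝓕 (testSlice _ hG.continuous hG.2.1 t)) ξ) =
      sym α.1 ξ • (𝓕 (testSlice φ h.continuous h.2.1 t)) ξ := by
  have hs : IsTestFunction univ fun x => φ (t, x) := by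
    refine ⟨h.1.comp (contDiff_const.prodMk contDiff_id), ?_, subset_univ _⟩
    refine HasCompactSupport.intro (h.2.1.isCompact.image continuous_snd) fun x hx => ?_
    exact image_eq_zero_of_notMem_tsupport fun h' => hx ⟨_, h', rfl⟩
  have h1 := fourier_multiDeriv hs α.1 (coeFn_testSlice (hf := h.continuous) (hc := h.2.1) t)
    (g := (gradProj α).compLp (testSlice _ hG.continuous hG.2.1 t)) (by
      filter_upwards [(gradProj α).coeFn_compLp (testSlice _ hG.continuous hG.2.1 t),
        coeFn_testSlice (hf := hG.continuous) (hc := hG.2.1) t] with x e1 e2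
      rw [e1, e2, multiDeriv_slice h.1]
      rfl)
  filter_upwards [h1, fourier_gradProj α (testSlice _ hG.continuous hG.2.1 t)] with ξ h2 h3
  rw [← h3, h2]

/-- The weak form of the equation on the Fourier side, tested against `𝓕 φ`. -/
theorem IsEnergySolution.integral_inner_testSlice (h : IsEnergySolution hA hLam d C)
    {φ : ℝ × Sp n → St N} (hφ : IsTestFunction univ φ)
    (hφ' : IsTestFunction univ fun p => fderiv ℝ φ p (1, 0))
    (hG : IsTestFunction univ (classicalGrad (spaceDir n) m φ)) {T : ℝ} (hT : 0 ≤ T)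
    (hφT : ∀ t x, t ∉ Ioo 0 T → φ (t, x) = 0) :
    ∫ t in (0 : ℝ)..T, inner ℂ (testSlice _ hφ'.continuous hφ'.2.1 t) (𝓕⁻ (C t) : L2St n N) =
      ∫ t in (0 : ℝ)..T, inner ℂ (rieszAdj n m N (testSlice _ hG.continuous hG.2.1 t))
        (energyOp hA hLam d t) := by
  have key := (rhoSystem n m (St N)).integral_inner_deriv
    (Φ := fun t => 𝓕 (testSlice φ hφ.continuous hφ.2.1 t))
    (Φ' := fun t => 𝓕 (testSlice _ hφ'.continuous hφ'.2.1 t))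
    (Ψ := fun t => rieszAdj n m N (testSlice _ hG.continuous hG.2.1 t)) hT
    (fun t => ((FourierTransform.fourierCLM ℂ (L2St n N)).restrictScalars ℝ).hasFDerivAt.comp_hasDerivAt
      t (hasDerivAt_testSlice hφ t))
    ((FourierTransform.fourierCLM ℂ (L2St n N)).continuous.comp (continuous_testSlice hφ'))
    ((rieszAdj n m N).continuous.comp (continuous_testSlice hG))
    (fun t => (riesz_rieszAdj_of_fourier (fourier_testSlice hφ hG t)).1)
    (by
      rw [testSlice_eq_zero fun x => hφT 0 x (by simp)]
      exact map_zero (FourierTransform.fourierCLM ℂ (L2St n N)))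
    (by
      rw [testSlice_eq_zero fun x => hφT T x (by simp)]
      exact map_zero (FourierTransform.fourierCLM ℂ (L2St n N)))
    (h.continuousOn.mono fun t ht => ht.1)
    (MemLp.intervalIntegrable_halfLine (Lp.memLp (energyOp hA hLam d)) le_rfl hT)
    (fun t ht => h.evol t ht.1)
  rw [← key]
  refine intervalIntegral.integral_congr fun t _ => ?_
  have := Lp.inner_fourier_eq (testSlice _ hφ'.continuous hφ'.2.1 t) (𝓕⁻ (C t) : L2St n N)
  rw [FourierTransform.fourier_fourierInv_eq] at this
  exact this.symm

theorem IsEnergySolution.integral_inner_fderiv (h : IsEnergySolution hA hLam d C)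
    {u : ℝ × Sp n → St N} (hu : HasSlices C u) {φ : ℝ × Sp n → St N}
    (hφ : IsTestFunction (halfSpace n) φ) :
    ∫ p in halfSpace n, inner ℂ (fderiv ℝ φ p (1, 0)) (u p) =
      ∫ p in halfSpace n, inner ℂ (classicalGrad (spaceDir n) m φ p)
        (coefCLM (A p) (spatialGrad m u p)) := by
  have hφ' : IsTestFunction (halfSpace n) fun p => fderiv ℝ φ p (1, 0) := hφ.fderiv_apply (1, 0)
  have hG : IsTestFunction (halfSpace n) (classicalGrad (spaceDir n) m φ) :=
    hφ.classicalGrad (spaceDir n)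
  have hφu := hφ.mono (subset_univ _)
  have hφu' := hφ'.mono (subset_univ _)
  have hGu := hG.mono (subset_univ _)
  obtain ⟨T, hT, hφT⟩ := hφ.exists_time
  have hF : MemLp (fun p => coefCLM (A p) (spatialGrad m u p)) 2 (halfLine.prod volume) :=
    memLp_clm_apply hA.aestronglyMeasurable (hA.norm_le hLam) (memLp_spatialGrad (h.mem_energyClass hu))
  have hFs : ∀ᵐ t ∂halfLine, coefCurve hA hLam (gradCurve (h.mem_energyClass hu)) t =ᵐ[volume]
      fun x => coefCLM (A (t, x)) (spatialGrad m u (t, x)) := by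
    filter_upwards [coeFn_coefCurve hA hLam (gradCurve (h.mem_energyClass hu)),
      coeFn_gradCurve (h.mem_energyClass hu)] with t h1 h2
    filter_upwards [h1, h2] with x h3 h4
    rw [h3, h4]
  have hzero : ∀ t x, t ∉ Ioo 0 T → φ (t, x) = 0 := fun t x ht =>
    image_eq_zero_of_notMem_tsupport (hφT t x ht)
  have hzero' : ∀ t x, t ∉ Ioo 0 T → fderiv ℝ φ (t, x) (1, 0) = 0 := fun t x ht =>
    image_eq_zero_of_notMem_tsupport (f := fun p => fderiv ℝ φ p (1, 0))
      fun h'' => hφT t x ht (tsupport_fderiv_apply_subset ℝ _ h'')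
  have hzeroG : ∀ t x, t ∉ Ioo 0 T → classicalGrad (spaceDir n) m φ (t, x) = 0 := fun t x ht => by
    have h1 : IsTestFunction (tsupport φ) φ := ⟨hφ.1, hφ.2.1, le_rfl⟩
    exact image_eq_zero_of_notMem_tsupport
      fun h'' => hφT t x ht ((h1.classicalGrad (spaceDir n)).2.2 h'')
  rw [integral_inner_slices hφ' (h.memLpSlabs hu).locallyIntegrableOn
      (W := testSlice _ hφu'.continuous hφu'.2.1) coeFn_testSlice hu.slices hT hzero',
    integral_inner_slices hG (MemLp.memLpSlabs hF).locallyIntegrableOn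
      (W := testSlice _ hGu.continuous hGu.2.1) coeFn_testSlice hFs hT hzeroG,
    h.integral_inner_testSlice hφu hφu' hGu hT hzero, intervalIntegral.integral_of_le hT,
    intervalIntegral.integral_of_le hT]
  refine integral_congr_ae (ae_mono (Measure.restrict_mono (fun x hx => hx.1) le_rfl :
    volume.restrict (Ioc 0 T) ≤ halfLine) ?_)
  filter_upwards [hFs, coeFn_energyOp hA hLam d, h.riesz_eq_spatialGrad hu] with t h1 ⟨Y, h2, h3⟩ h4
  have hY : Y = coefCurve hA hLam (gradCurve (h.mem_energyClass hu)) t := by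
    refine Lp.ext (h3.trans (EventuallyEq.trans ?_ (EventuallyEq.symm h1)))
    filter_upwards [h4] with x h5
    rw [h5]
  -- With `Γ` the slice of `∇^m φ`: `⟨R† Γ, R† Y⟩ = ⟨R R† Γ, Y⟩ = ⟨Γ, Y⟩`.
  rw [h2, ← hY, ← inner_riesz, (riesz_rieszAdj_of_fourier (fourier_testSlice hφu hGu t)).2]

theorem IsEnergySolution.isGlobalWeakSolution (h : IsEnergySolution hA hLam d C)
    {u : ℝ × Sp n → St N} (hu : HasSlices C u) : IsGlobalWeakSolution A u := by
  refine ⟨h.memL2HmLoc hu, fun φ hφ => ?_⟩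
  simp only [coeffForm_eq_inner]
  exact h.integral_inner_fderiv hu hφ

end WeakFormulation

end

section

open scoped FourierTransform

/-! ### Functions with vanishing time derivative. -/

section TimeIndependent

variable {n N : ℕ} {w : ℝ × Sp n → St N} {χ : Sp n → ℝ}

/-- The function is square integrable only on compact sets. Cutting off in space and to a time
interval away from `0` makes its slices an `L²` curve. -/
theorem memLp_indicator_smul
    (hw : ∀ K : Set (ℝ × Sp n), IsCompact K → K ⊆ halfSpace n → MemLp w 2 (volume.restrict K))
    (hχ : IsTestFunction univ χ) (hχ1 : ∀ x, ‖χ x‖ ≤ 1) {a b : ℝ} (ha : 0 < a) :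
    MemLp ((Icc a b ×ˢ univ).indicator fun p => χ p.2 • w p) 2
      (halfLine.prod (volume : Measure (Sp n))) := by
  have hK : IsCompact (Icc a b ×ˢ tsupport χ) := isCompact_Icc.prod hχ.2.1
  have hKs : Icc a b ×ˢ tsupport χ ⊆ halfSpace n := fun p hp => ⟨ha.trans_le hp.1.1, mem_univ _⟩
  have h1 : MemLp (fun p => χ p.2 • w p) 2 (volume.restrict (Icc a b ×ˢ tsupport χ)) := by
    refine (hw _ hK hKs).of_le
      ((hχ.continuous.comp continuous_snd).aestronglyMeasurable.smul (hw _ hK hKs).1) ?_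
    refine Eventually.of_forall fun p => ?_
    rw [norm_smul]
    exact mul_le_of_le_one_left (norm_nonneg _) (hχ1 _)
  have h2 := (memLp_indicator_iff_restrict hK.measurableSet).2 h1
  have h3 : (Icc a b ×ˢ tsupport χ).indicator (fun p => χ p.2 • w p) =
      (Icc a b ×ˢ univ).indicator fun p => χ p.2 • w p := by
    ext1 p
    by_cases hp : p.1 ∈ Icc a b
    · by_cases hx : p.2 ∈ tsupport χ
      · rw [indicator_of_mem (mk_mem_prod hp hx), indicator_of_mem (mk_mem_prod hp (mem_univ _))]
      · rw [indicator_of_notMem (fun h => hx h.2), indicator_of_mem (mk_mem_prod hp (mem_univ _)),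
          image_eq_zero_of_notMem_tsupport hx, zero_smul]
    · rw [indicator_of_notMem (fun h => hp h.1), indicator_of_notMem (fun h => hp h.1)]
  rw [h3] at h2
  rw [← restrict_halfSpace]
  exact h2.restrict _

theorem sliceLp_indicator {a b t : ℝ} (ht : t ∈ Icc a b) :
    sliceLp volume ((Icc a b ×ˢ univ).indicator fun p : ℝ × Sp n => χ p.2 • w p) t =
      sliceLp volume (fun p : ℝ × Sp n => χ p.2 • w p) t :=
  sliceLp_congr (Eventually.of_forall fun x =>
    indicator_of_mem (s := Icc a b ×ˢ univ) (a := (t, x)) ⟨ht, mem_univ _⟩ _)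

/-- A function whose distributional time derivative vanishes is locally, in space, the same
element of `L²` at almost all times. -/
theorem exists_sliceLp_ae_eq
    (hw : ∀ K : Set (ℝ × Sp n), IsCompact K → K ⊆ halfSpace n → MemLp w 2 (volume.restrict K))
    (h : ∀ c : ℝ × Sp n → ℝ, IsTestFunction (halfSpace n) c →
      ∫ p in halfSpace n, ((fderiv ℝ c p (1, 0) : ℝ) : ℂ) • w p = 0)
    (hχ : IsTestFunction univ χ) (hχ1 : ∀ x, ‖χ x‖ ≤ 1) :
    ∃ k : L2St n N, ∀ᵐ t ∂halfLine, k =ᵐ[volume] fun x => χ x • w (t, x) := by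
  set Y : ℝ → L2St n N := sliceLp volume (fun p : ℝ × Sp n => χ p.2 • w p) with hY
  have hv : ∀ {a b : ℝ}, 0 < a → MemLp ((Icc a b ×ˢ univ).indicator fun p => χ p.2 • w p) 2
      (halfLine.prod (volume : Measure (Sp n))) := fun ha => memLp_indicator_smul hw hχ hχ1 ha
  have hY1 : LocallyIntegrableOn Y (Ioi 0) := by
    intro t ht
    have ht : 0 < t := ht
    have ha : 0 < t / 2 := by linarith
    refine ⟨Icc (t / 2) (t + 1), mem_nhdsWithin_of_mem_nhds (Icc_mem_nhds (by linarith) (by linarith)),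
      ?_⟩
    have h1 := (memLp_sliceLp (hv (b := t + 1) ha)).mono_measure
      (Measure.restrict_mono (fun x hx => ha.trans_le hx.1) le_rfl :
        volume.restrict (Icc (t / 2) (t + 1)) ≤ halfLine)
    refine IntegrableOn.congr_fun (h1.integrable (by norm_num)) (fun s hs => ?_) measurableSet_Icc
    exact sliceLp_indicator hs
  have hY2 : ∀ θ : ℝ → ℝ, IsTestFunction (Ioi 0) θ → ∫ t in Ioi 0, deriv θ t • Y t = 0 := by
    intro θ hθ
    obtain ⟨a, b, ha, hab, hs⟩ := hθ.exists_Icc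
    have hd : ∀ t, t ∉ Icc a b → deriv θ t = 0 := fun t ht =>
      image_eq_zero_of_notMem_tsupport fun h' => ht (hs (tsupport_deriv_subset h'))
    set v : ℝ × Sp n → St N := (Icc a b ×ˢ univ).indicator fun p => χ p.2 • w p with hv'
    have hV : ∫ t in Ioi 0, deriv θ t • Y t =
        ∫ t, ((deriv θ t : ℝ) : ℂ) • sliceLp volume v t ∂halfLine := by
      refine integral_congr_ae (Eventually.of_forall fun t => ?_)
      by_cases ht : t ∈ Icc a b
      · simp only [hv', sliceLp_indicator ht]
        exact (Complex.coe_smul _ _).symm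
      · simp only [hd t ht, zero_smul, Complex.ofReal_zero]
    rw [hV]
    apply Lp.ext
    refine EventuallyEq.trans ?_ (EventuallyEq.symm (Lp.coeFn_zero _ 2 volume))
    refine ae_eq_zero_of_integral_contDiff_smul_eq_zero
      ((Lp.memLp _).locallyIntegrable (by norm_num)) fun ψ hψ1 hψ2 => ?_
    have hψ : IsTestFunction univ ψ := ⟨hψ1, hψ2, subset_univ _⟩
    have hχψ : IsTestFunction univ fun x => χ x * ψ x :=
      ⟨hχ.1.mul hψ1, hψ2.mul_left, subset_univ _⟩
    have e1 := integral_tensor_smul hθ.deriv hψ (hv ha) (memLp_sliceLp (hv (b := b) ha))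
      ((ae_memLp_slice (hv ha)).mono fun t ht => coeFn_sliceLp ht)
    have e2 := h _ (hθ.tensor hχψ)
    simp only [fderiv_tensor hθ hχψ] at e2
    rw [restrict_halfSpace] at e2
    have hr : ∀ (r : ℝ) (v : St N), r • v = (r : ℂ) • v := fun r v => (Complex.coe_smul r v).symm
    simp only [hr]
    refine e1.symm.trans (Eq.trans (integral_congr_ae (Eventually.of_forall fun p => ?_)) e2)
    by_cases ht : p.1 ∈ Icc a b
    · simp only [tensor, hr]
      rw [indicator_of_mem (mk_mem_prod ht (mem_univ p.2)), smul_smul]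
      congr 1
      push_cast
      ring
    · simp only [tensor, hd _ ht, zero_mul, Complex.ofReal_zero, zero_smul]
  obtain ⟨k, hk⟩ := exists_eq_add_integral_of_weak_deriv hY1 (z := fun _ => 0)
    (fun T _ => intervalIntegrable_const) (fun θ hθ => by rw [hY2 θ hθ]; simp)
  refine ⟨k, ?_⟩
  -- `sliceLp` has the default value `0` where a slice is not in `L²`, so this case must be excluded
  -- for almost every time. The intervals `[1/(j+1), j]` exhaust the half-line.
  have hslice : ∀ᵐ t ∂halfLine, MemLp (fun x => χ x • w (t, x)) 2 (volume : Measure (Sp n)) := by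
    have h1 : ∀ j : ℕ, ∀ᵐ t ∂halfLine, t ∈ Icc (1 / ((j : ℝ) + 1)) j →
        MemLp (fun x => χ x • w (t, x)) 2 (volume : Measure (Sp n)) := by
      intro j
      have hj : (0 : ℝ) < 1 / ((j : ℝ) + 1) := by positivity
      filter_upwards [ae_memLp_slice (hv (b := j) hj)] with t ht htj
      refine (memLp_congr_ae (Eventually.of_forall fun x => ?_)).1 ht
      exact indicator_of_mem (s := Icc _ _ ×ˢ univ) (a := (t, x)) ⟨htj, mem_univ _⟩ _
    filter_upwards [ae_all_iff.2 h1, ae_restrict_mem measurableSet_Ioi] with t ht ht0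
    obtain ⟨j1, hj1⟩ := exists_nat_one_div_lt (show (0 : ℝ) < t from ht0)
    obtain ⟨j2, hj2⟩ := exists_nat_ge t
    refine ht (max j1 j2) ⟨?_, ?_⟩
    · refine le_trans ?_ hj1.le
      gcongr
      exact le_max_left _ _
    · refine hj2.trans ?_
      exact_mod_cast le_max_right _ _
  filter_upwards [hk, hslice] with t h1 h2
  rw [intervalIntegral.integral_zero, add_zero] at h1
  rw [← h1]
  exact coeFn_sliceLp h2

/-- A function whose distributional time derivative vanishes does not depend on time. -/
theorem exists_ae_eq_of_fderiv_eq_zero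
    (hw : ∀ K : Set (ℝ × Sp n), IsCompact K → K ⊆ halfSpace n → MemLp w 2 (volume.restrict K))
    (h : ∀ c : ℝ × Sp n → ℝ, IsTestFunction (halfSpace n) c →
      ∫ p in halfSpace n, ((fderiv ℝ c p (1, 0) : ℝ) : ℂ) • w p = 0) :
    ∃ q : Sp n → St N, (∀ K, IsCompact K → MemLp q 2 (volume.restrict K)) ∧
      ∀ᵐ t ∂halfLine, (fun x => w (t, x)) =ᵐ[volume] q := by
  obtain ⟨c, -, hc, hcs, hc1, hcn, -⟩ := exists_cutoff (E := Sp n)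
  choose k hk using fun j => exists_sliceLp_ae_eq hw h ⟨hc j, hcs j, subset_univ _⟩ (hcn j)
  have hall : ∀ᵐ t ∂halfLine, ∀ j, k j =ᵐ[volume] fun x => c j x • w (t, x) := ae_all_iff.2 hk
  have hne : (ae halfLine).NeBot := by
    rw [ae_neBot]
    intro h0
    have := congrArg (fun μ : Measure ℝ => μ univ) h0
    simp [halfLine] at this
  -- The slice at one good time `s` serves as `q`. Every other good slice agrees with it on each
  -- ball where a cutoff equals `1`.
  obtain ⟨s, hs⟩ := hall.exists
  have hone : ∀ x : Sp n, ∃ j : ℕ, c j x = 1 := fun x => by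
    obtain ⟨j, hj⟩ := exists_nat_ge ‖x‖
    exact ⟨j, hc1 j x (by linarith)⟩
  refine ⟨fun x => w (s, x), fun K hK => ?_, ?_⟩
  · obtain ⟨r, hr⟩ := hK.isBounded.exists_norm_le
    obtain ⟨j, hj⟩ := exists_nat_ge r
    have h1 : MemLp (k j) 2 (volume.restrict K) := (Lp.memLp (k j)).restrict K
    refine (memLp_congr_ae ?_).1 h1
    filter_upwards [ae_restrict_of_ae (hs j), ae_restrict_mem hK.measurableSet] with x e1 e2
    rw [e1, hc1 j x (by linarith [hr x e2]), one_smul]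
  · filter_upwards [hall] with t ht
    filter_upwards [ae_all_iff.2 ht, ae_all_iff.2 hs] with x e1 e2
    obtain ⟨j, hj⟩ := hone x
    have := (e1 j).symm.trans (e2 j)
    rwa [hj, one_smul, one_smul] at this

end TimeIndependent

/-! ### Weak solutions up to functions of `x` alone. -/

section Decomposition

variable {n m N : ℕ} [NeZero n] {A : Coeff n m N} {lam Lam : ℝ} {hA : IsElliptic A lam Lam}
  {hLam : 0 < Lam} {u : ℝ × Sp n → St N}

theorem MemL2HmLoc.memLp (h : MemL2HmLoc m u) {K : Set (ℝ × Sp n)} (hK : IsCompact K)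
    (hKs : K ⊆ halfSpace n) : MemLp u 2 (volume.restrict K) := by
  obtain ⟨g, hg, hg2⟩ := h 0 (by simp)
  refine (memLp_congr_ae ?_).1 (hg2 K hK hKs)
  refine ae_mono (Measure.restrict_mono hKs le_rfl) ?_
  refine (ae_eq_of_forall_integral_smul_eq isOpen_halfSpace hg.1 hg.2.1 fun φ hφ => ?_).symm
  have := hg.2.2 φ hφ
  rw [multiDeriv_zero] at this
  simpa using this

/-- A weak solution is the solution with slices `𝓕⁻¹ (C t)` up to a function of `x`. -/
theorem IsGlobalWeakSolution.exists_eq_add (hu : u ∈ energyClass n m N)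
    (h : IsGlobalWeakSolution A u) {C : ℝ → L2St n N}
    (hC : IsEnergySolution hA hLam (energyCurve hu) C) :
    ∃ q : Sp n → St N, (∀ K, IsCompact K → MemLp q 2 (volume.restrict K)) ∧
      (∀ᵐ t ∂halfLine, (fun x => u (t, x)) =ᵐ[volume] (𝓕⁻ (C t) : L2St n N) + q) ∧
      ∀ (α : MultiIndex n m) (ψ : Sp n → ℝ), IsTestFunction univ ψ →
        ∫ x, multiDeriv (dir n) α.1 ψ x • q x = 0 := by
  -- `u` and `v` have the same gradient, hence the same right side in the weak equation, so the time
  -- derivative of `u - v` vanishes.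
  obtain ⟨v, hv⟩ := hC.exists_hasSlices
  have hve := hC.mem_energyClass hv
  have hvw := hC.isGlobalWeakSolution hv
  have hgrad : spatialGrad m u =ᵐ[volume.restrict (halfSpace n)] spatialGrad m v := by
    have h1 : gradCurve hu = gradCurve hve := by
      apply Lp.ext
      filter_upwards [riesz_energyCurve hu, hC.gradCurve_eq hv] with t e1 e2
      rw [e2, e1]
    have h2 := (sliceEquiv (Grad n m N) halfLine volume).injective h1
    rw [restrict_halfSpace]
    exact ((memLp_spatialGrad hu).toLp_eq_toLp_iff (memLp_spatialGrad hve)).1 h2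
  obtain ⟨q, hq1, hq2⟩ := exists_ae_eq_of_fderiv_eq_zero (w := fun p => u p - v p)
    (fun K hK hKs => (h.1.memLp hK hKs).sub (hvw.1.memLp hK hKs)) (fun c hc => by
      have hdc := hc.fderiv_apply (1, 0)
      have hr : ∀ (r : ℝ) (v : St N), (r : ℂ) • v = r • v := fun r v => Complex.coe_smul r v
      have e1 := h.integral_fderiv_smul hA hLam hu hc
      have e2 := hvw.integral_fderiv_smul hA hLam hve hc
      have e3 : ∑ α : MultiIndex n m, ∫ p in halfSpace n,
          ((multiDeriv (spaceDir n) α.1 c p : ℝ) : ℂ) • gradProj α (coefCLM (A p) (spatialGrad m u p)) =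
          ∑ α : MultiIndex n m, ∫ p in halfSpace n,
          ((multiDeriv (spaceDir n) α.1 c p : ℝ) : ℂ) •
            gradProj α (coefCLM (A p) (spatialGrad m v p)) := by
        refine Finset.sum_congr rfl fun α _ => integral_congr_ae ?_
        filter_upwards [hgrad] with p hp
        rw [hp]
      rw [e3, ← e2] at e1
      simp only [hr, smul_sub] at e1 ⊢
      rw [integral_sub (hdc.integrable_smul isOpen_halfSpace hu.1).integrableOn
        (hdc.integrable_smul isOpen_halfSpace hve.1).integrableOn, e1, sub_self])
  refine ⟨q, hq1, ?_, fun α ψ hψ => ?_⟩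
  · filter_upwards [hq2, hv.slices] with t e1 e2
    filter_upwards [e1, e2] with x e3 e4
    rw [Pi.add_apply, e4, ← e3, add_sub_cancel]
  -- Equality of the gradients, tested with `θ ψ` where `θ` has integral one, becomes a statement
  -- about `q` alone.
  · obtain ⟨θ, hθ, hθ1⟩ := exists_isTestFunction_integral_eq_one
    have hψα := hψ.multiDeriv (dir n) α.1
    have e1 := (hasWeakDerivOn_spatialGrad hu α).2.2 _ (hθ.tensor hψ)
    have e2 := (hasWeakDerivOn_spatialGrad hve α).2.2 _ (hθ.tensor hψ)
    rw [integral_congr_ae (hgrad.mono fun p hp =>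
      congrArg (fun G => tensor θ ψ p • gradProj α G) hp), ← e2, multiDeriv_tensor hθ hψ] at e1
    have i1 := ((hθ.tensor hψα).integrable_smul isOpen_halfSpace hu.1).integrableOn
      (s := halfSpace n)
    have i2 := ((hθ.tensor hψα).integrable_smul isOpen_halfSpace hve.1).integrableOn
      (s := halfSpace n)
    have e3 := (integral_sub i1 i2).trans (sub_eq_zero.2 e1)
    have i3 := Integrable.sub i1 i2
    rw [restrict_halfSpace] at e3 i3
    replace e3 := (integral_prod _ i3).symm.trans e3
    simp only [Pi.sub_apply] at e3
    have e4 : ∫ t, θ t • (∫ x, multiDeriv (dir n) α.1 ψ x • q x) ∂halfLine = 0 := by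
      refine Eq.trans (integral_congr_ae ?_) e3
      filter_upwards [hq2] with t ht
      rw [← integral_smul]
      refine integral_congr_ae ?_
      filter_upwards [ht] with x hx
      rw [← hx, ← smul_sub, smul_smul]
      rfl
    rwa [integral_smul_const, setIntegral_eq_integral_of_forall_compl_eq_zero (fun t ht =>
      image_eq_zero_of_notMem_tsupport fun h' => ht (hθ.2.2 h')), hθ1, one_smul] at e4

end Decomposition

end

section

open scoped FourierTransform

/-! ### Traces at `t = 0`. -/

section Traces

theorem le_sqrt_mul_of_sq_le {a b c : ℝ} (ha : 0 ≤ a) (hb : 0 ≤ b) (h : a ^ 2 ≤ c * b ^ 2) :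
    a ≤ Real.sqrt c * b := by
  rw [← Real.sqrt_sq ha, ← Real.sqrt_sq hb, ← Real.sqrt_mul' _ (sq_nonneg _)]
  exact Real.sqrt_le_sqrt h

variable {n N : ℕ}

theorem ae_eq_prod_of_slices {α β F : Type*} [MeasurableSpace α] [MeasurableSpace β]
    [NormedAddCommGroup F] {μ : Measure α} {ν : Measure β} [SFinite μ] [SFinite ν]
    {f g : α × β → F} (hf : AEStronglyMeasurable f (μ.prod ν))
    (hg : AEStronglyMeasurable g (μ.prod ν))
    (h : ∀ᵐ t ∂μ, (fun x => f (t, x)) =ᵐ[ν] fun x => g (t, x)) : f =ᵐ[μ.prod ν] g := by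
  have hm := (hf.sub hg).enorm
  have h0 : ∫⁻ p, ‖(f - g) p‖ₑ ∂(μ.prod ν) = 0 := by
    rw [lintegral_prod _ hm]
    refine (lintegral_congr_ae (g := 0) ?_).trans lintegral_zero
    filter_upwards [h] with t ht
    refine (lintegral_congr_ae (g := 0) ?_).trans lintegral_zero
    filter_upwards [ht] with x hx
    simp [hx]
  filter_upwards [(lintegral_eq_zero_iff' hm).1 h0] with p hp
  exact sub_eq_zero.1 (enorm_eq_zero.1 hp)

/-- Almost every small time. -/
theorem nhdsGT_inf_ae_neBot : (𝓝[>] (0 : ℝ) ⊓ ae halfLine).NeBot := by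
  rw [Filter.inf_neBot_iff]
  intro s hs t ht
  obtain ⟨δ, hδ, hsub⟩ := mem_nhdsGT_iff_exists_Ioo_subset.1 hs
  by_contra hne
  rw [not_nonempty_iff_eq_empty] at hne
  have h1 : Ioo 0 δ ⊆ tᶜ := fun x hx hxt => (hne ▸ (⟨hsub hx, hxt⟩ : x ∈ s ∩ t) : x ∈ (∅ : Set ℝ))
  have h2 : halfLine (Ioo 0 δ) = 0 := measure_mono_null h1 ht
  rw [halfLine, Measure.restrict_apply measurableSet_Ioo,
    inter_eq_left.2 (show Ioo 0 δ ⊆ Ioi (0 : ℝ) from fun x hx => hx.1), Real.volume_Ioo, sub_zero,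
    ENNReal.ofReal_eq_zero] at h2
  exact absurd h2 (not_le.2 hδ)

theorem tendsto_eLpNorm_two_restrict {ι : Type*} {l : Filter ι} {f : ι → L2St n N} {g : L2St n N}
    (h : Tendsto f l (𝓝 g)) (K : Set (Sp n)) :
    Tendsto (fun t => eLpNorm (⇑(f t) - ⇑g) 2 (volume.restrict K)) l (𝓝 0) := by
  refine tendsto_of_tendsto_of_tendsto_of_le_of_le tendsto_const_nhds
    ((Lp.tendsto_Lp_iff_tendsto_eLpNorm' f g).1 h) (fun _ => zero_le) fun t => ?_
  exact eLpNorm_mono_measure _ Measure.restrict_le_self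

theorem tendsto_eLpNorm_one_restrict {ι : Type*} {l : Filter ι} {f : ι → L2St n N} {g : L2St n N}
    (h : Tendsto f l (𝓝 g)) {K : Set (Sp n)} (hK : IsCompact K) :
    Tendsto (fun t => eLpNorm (⇑(f t) - ⇑g) 1 (volume.restrict K)) l (𝓝 0) := by
  have h1 := tendsto_eLpNorm_two_restrict h K
  have hfin : volume.restrict K univ ^ (1 / (1 : ℝ≥0∞).toReal - 1 / (2 : ℝ≥0∞).toReal) ≠ ⊤ := by
    refine ENNReal.rpow_ne_top_of_nonneg (by norm_num) ?_
    rw [Measure.restrict_apply_univ]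
    exact hK.measure_lt_top.ne
  have h2 := ENNReal.Tendsto.mul_const h1 (Or.inr hfin)
  rw [zero_mul] at h2
  refine tendsto_of_tendsto_of_tendsto_of_le_of_le tendsto_const_nhds h2 (fun _ => zero_le)
    fun t => ?_
  exact eLpNorm_le_eLpNorm_mul_rpow_measure_univ (by norm_num)
    (((Lp.aestronglyMeasurable _).sub (Lp.aestronglyMeasurable _)).restrict)

variable {u : ℝ × Sp n → St N} {C : ℝ → L2St n N} {q u₀ : Sp n → St N}

theorem continuousOn_fourierInv (hC : ContinuousOn C (Ici 0)) :
    ContinuousOn (fun t => (𝓕⁻ (C t) : L2St n N)) (Ici 0) :=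
  (FourierTransform.fourierInvCLM ℂ (L2St n N)).continuous.comp_continuousOn hC

theorem tendsto_fourierInv_nhdsGT (hC : ContinuousOn C (Ici 0)) :
    Tendsto (fun t => (𝓕⁻ (C t) : L2St n N)) (𝓝[>] 0) (𝓝 (𝓕⁻ (C 0))) :=
  (continuousOn_fourierInv hC 0 (mem_Ici.2 le_rfl)).mono_left (nhdsWithin_mono _ Ioi_subset_Ici_self)

/-- The function `q` cancels in all differences, so both limits are those of `𝓕⁻¹ C`. -/
theorem hasTrace_of_slices (hC : ContinuousOn C (Ici 0))
    (hq : ∀ K, IsCompact K → MemLp q 2 (volume.restrict K))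
    (hu : ∀ᵐ t ∂halfLine, (fun x => u (t, x)) =ᵐ[volume] ⇑(𝓕⁻ (C t) : L2St n N) + q)
    (hu₀ : LocallyIntegrable u₀) (h0 : u₀ =ᵐ[volume] ⇑(𝓕⁻ (C 0) : L2St n N) + q) :
    HasTrace u u₀ := by
  have hcont : ∀ K : Set (Sp n), IsCompact K → ∀ t : ℝ, 0 < t →
      Tendsto (fun s => eLpNorm ((⇑(𝓕⁻ (C s) : L2St n N) + q) - (⇑(𝓕⁻ (C t) : L2St n N) + q)) 2
        (volume.restrict K)) (𝓝 t) (𝓝 0) := by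
    intro K hK t ht
    have h1 : Tendsto (fun s => (𝓕⁻ (C s) : L2St n N)) (𝓝 t) (𝓝 (𝓕⁻ (C t))) :=
      (continuousOn_fourierInv hC).continuousAt (Ici_mem_nhds ht)
    refine (tendsto_eLpNorm_two_restrict h1 K).congr fun s => ?_
    rw [add_sub_add_right_eq_sub]
  have htr : ∀ K : Set (Sp n), IsCompact K →
      Tendsto (fun t => eLpNorm ((⇑(𝓕⁻ (C t) : L2St n N) + q) - u₀) 1 (volume.restrict K))
        (𝓝[>] 0) (𝓝 0) := by
    intro K hK
    refine (tendsto_eLpNorm_one_restrict (tendsto_fourierInv_nhdsGT hC) hK).congr fun t => ?_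
    refine eLpNorm_congr_ae ?_
    filter_upwards [ae_restrict_of_ae h0] with x hx
    simp only [Pi.sub_apply, Pi.add_apply, hx, add_sub_add_right_eq_sub]
  have hmem : ∀ K : Set (Sp n), IsCompact K → ∀ t : ℝ,
      MemLp (⇑(𝓕⁻ (C t) : L2St n N) + q) 2 (volume.restrict K) := fun K hK t =>
    MemLp.add ((Lp.memLp (𝓕⁻ (C t) : L2St n N)).restrict K) (hq K hK)
  have hrep : IsContinuousRep u fun t => ⇑(𝓕⁻ (C t) : L2St n N) + q := by
    refine ⟨?_, fun K hK t ht => ?_⟩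
    · filter_upwards [hu] with t ht
      exact EventuallyEq.symm ht
    · exact And.intro (hmem K hK t) (hcont K hK t ht)
  exact And.intro hu₀ (Exists.intro _ (And.intro hrep htr))

/-- The continuous representative in the trace is compared with the slices only at almost every
time. The limit is therefore taken along almost all small times, where the difference in question is
a sum of two terms tending to zero in `L¹(K)`. -/
theorem HasTrace.ae_eq (h : HasTrace u u₀) (hC : ContinuousOn C (Ici 0))
    (hq : ∀ K, IsCompact K → MemLp q 2 (volume.restrict K))
    (hu : ∀ᵐ t ∂halfLine, (fun x => u (t, x)) =ᵐ[volume] ⇑(𝓕⁻ (C t) : L2St n N) + q) :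
    u₀ =ᵐ[volume] ⇑(𝓕⁻ (C 0) : L2St n N) + q := by
  obtain ⟨hu₀, v, ⟨hv, hvK⟩, hvt⟩ := h
  have hK : ∀ K : Set (Sp n), IsCompact K →
      u₀ =ᵐ[volume.restrict K] ⇑(𝓕⁻ (C 0) : L2St n N) + q := by
    intro K hK
    have := nhdsGT_inf_ae_neBot
    have h1 := (tendsto_eLpNorm_one_restrict (tendsto_fourierInv_nhdsGT hC) hK).add (hvt K hK)
    have h2 := h1.mono_left (inf_le_left : 𝓝[>] (0 : ℝ) ⊓ ae halfLine ≤ 𝓝[>] 0)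
    have hm0 : AEStronglyMeasurable u₀ (volume.restrict K) := hu₀.aestronglyMeasurable.restrict
    have hmq : AEStronglyMeasurable q (volume.restrict K) := (hq K hK).1
    have h3 : eLpNorm (u₀ - (⇑(𝓕⁻ (C 0) : L2St n N) + q)) 1 (volume.restrict K) ≤ 0 + 0 := by
      refine ge_of_tendsto h2 ?_
      filter_upwards [(show ∀ᶠ t in 𝓝[>] (0 : ℝ) ⊓ ae halfLine, _ from
        Filter.Eventually.filter_mono inf_le_right (hv.and hu)),
        (show ∀ᶠ t in 𝓝[>] (0 : ℝ) ⊓ ae halfLine, t ∈ Ioi (0 : ℝ) from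
          Filter.Eventually.filter_mono inf_le_left self_mem_nhdsWithin)] with t ht ht0
      have hvm : AEStronglyMeasurable (v t) (volume.restrict K) := (hvK K hK t ht0).1.1
      have e1 : u₀ - (⇑(𝓕⁻ (C 0) : L2St n N) + q) =ᵐ[volume.restrict K]
          (⇑(𝓕⁻ (C t) : L2St n N) - ⇑(𝓕⁻ (C 0) : L2St n N)) - (v t - u₀) := by
        filter_upwards [ae_restrict_of_ae ht.1, ae_restrict_of_ae ht.2] with x h4 h5
        simp only [Pi.sub_apply, Pi.add_apply] at h5 ⊢
        rw [h4, h5]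
        abel
      rw [eLpNorm_congr_ae e1]
      exact eLpNorm_sub_le (((Lp.aestronglyMeasurable _).sub (Lp.aestronglyMeasurable _)).restrict)
        (hvm.sub hm0) le_rfl
    rw [add_zero, nonpos_iff_eq_zero, eLpNorm_eq_zero_iff
      (hm0.sub ((Lp.aestronglyMeasurable _).restrict.add hmq)) one_ne_zero] at h3
    filter_upwards [h3] with x hx
    exact sub_eq_zero.1 hx
  have h1 : ∀ᵐ x : Sp n, ∀ j : ℕ, x ∈ Metric.closedBall 0 (j : ℝ) →
      u₀ x = (⇑(𝓕⁻ (C 0) : L2St n N) + q) x := ae_all_iff.2 fun j =>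
    (ae_restrict_iff' measurableSet_closedBall).1 (hK _ (isCompact_closedBall 0 (j : ℝ)))
  filter_upwards [h1] with x hx
  obtain ⟨j, hj⟩ := exists_nat_ge ‖x‖
  exact hx j (mem_closedBall_zero_iff.2 hj)

end Traces

/-! ### Identification of solutions with data in `L²`, and their norms. -/

section Identification

variable {n m N : ℕ} [NeZero n] {A : Coeff n m N} {lam Lam : ℝ} {hA : IsElliptic A lam Lam}
  {hLam : 0 < Lam} {u : ℝ × Sp n → St N} {u₀ : Sp n → St N}

/-- There are no polynomials in `L²`. -/
theorem eq_zero_of_forall_integral_multiDeriv_eq_zero {f : L2St n N}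
    (h : ∀ (α : MultiIndex n m) (ψ : Sp n → ℝ), IsTestFunction univ ψ →
      ∫ x, multiDeriv (dir n) α.1 ψ x • f x = 0) : f = 0 := by
  have h1 : ∀ α : MultiIndex n m, ∀ᵐ ξ, sym α.1 ξ • (𝓕 f) ξ = (𝓕 (0 : L2St n N)) ξ := fun α =>
    (forall_integral_multiDeriv_smul_iff α.1 f 0).1 fun ψ hψ => by
      rw [h α ψ hψ]
      have : ∫ x, ψ x • (0 : L2St n N) x = 0 := by
        refine (integral_congr_ae (g := fun _ => 0) ?_).trans (integral_zero _ _)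
        filter_upwards [Lp.coeFn_zero (St N) 2 (volume : Measure (Sp n))] with x hx
        rw [hx, Pi.zero_apply, smul_zero]
      rw [this, smul_zero]
  refine (Lp.fourierTransformₗᵢ (Sp n) (St N)).injective ?_
  rw [map_zero]
  apply Lp.ext
  have h0 : 𝓕 (0 : L2St n N) = 0 := (Lp.fourierTransformₗᵢ (Sp n) (St N)).map_zero
  filter_upwards [ae_all_iff.2 h1, ae_ne_zero (n := n),
    Lp.coeFn_zero (St N) 2 (volume : Measure (Sp n))] with ξ h2 h3 h4
  rw [h4, Pi.zero_apply]
  by_contra hne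
  rw [h0, h4] at h2
  have h5 : rho m ξ ^ 2 = 0 := by
    rw [rho_sq]
    refine Finset.sum_eq_zero fun α _ => ?_
    rw [(smul_eq_zero.1 (h2 α)).resolve_right hne, norm_zero, zero_pow two_ne_zero]
  exact (pow_pos (rho_pos h3) 2).ne' h5

/-- A solution in the energy class with trace in `L²` is described by an energy solution on the
Fourier side which starts at the Fourier transform of the trace. -/
theorem SolvesCauchy.exists_isEnergySolution (hA : IsElliptic A lam Lam) (hLam : 0 < Lam)
    (h : SolvesCauchy A (energyClass n m N) u₀ u)
    (hu₀ : MemLp u₀ 2 volume) :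
    ∃ C, IsEnergySolution hA hLam (energyCurve h.2.1) C ∧ HasSlices C u ∧
      C 0 = 𝓕 (hu₀.toLp : L2St n N) := by
  obtain ⟨C, hC⟩ := h.1.exists_isEnergySolution (hA := hA) (hLam := hLam) h.2.1
  obtain ⟨q, hq1, hq2, hq3⟩ := h.1.exists_eq_add h.2.1 hC
  have h0 := h.2.2.ae_eq hC.continuousOn hq1 hq2
  -- Here the assumption on the datum enters: `q` is a difference of two `L²` functions, and a
  -- function in `L²` with vanishing derivatives of order `m` is zero.
  have hq : (hu₀.toLp - 𝓕⁻ (C 0) : L2St n N) =ᵐ[volume] q := by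
    filter_upwards [Lp.coeFn_sub hu₀.toLp (𝓕⁻ (C 0) : L2St n N), hu₀.coeFn_toLp, h0] with x e1 e2 e3
    rw [e1, Pi.sub_apply, e2, e3, Pi.add_apply, add_sub_cancel_left]
  have hz : (hu₀.toLp - 𝓕⁻ (C 0) : L2St n N) = 0 :=
    eq_zero_of_forall_integral_multiDeriv_eq_zero fun α ψ hψ => by
      rw [← hq3 α ψ hψ]
      exact integral_congr_ae (hq.mono fun x hx =>
        congrArg (fun v => multiDeriv (dir n) α.1 ψ x • v) hx)
  have hq0 : q =ᵐ[volume] 0 := by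
    rw [hz] at hq
    exact hq.symm.trans (Lp.coeFn_zero _ 2 volume)
  refine ⟨C, hC, ⟨?_, ?_⟩, ?_⟩
  · rw [← restrict_halfSpace]
    exact h.2.1.1.aestronglyMeasurable
  · filter_upwards [hq2] with t ht
    filter_upwards [ht, hq0] with x e1 e2
    rw [e1, Pi.add_apply, e2, Pi.zero_apply, add_zero]
  · rw [sub_eq_zero.1 hz, FourierTransform.fourier_fourierInv_eq]

theorem exists_solvesCauchy (hA : IsElliptic A lam Lam) (hlam : 0 < lam) (hLam : 0 < Lam)
    (hu₀ : MemLp u₀ 2 volume) : ∃ u, SolvesCauchy A (energyClass n m N) u₀ u := by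
  obtain ⟨d, C, hC, h0⟩ := exists_isEnergySolution (hA := hA) (hLam := hLam) hlam
    (𝓕 (hu₀.toLp : L2St n N))
  obtain ⟨u, hu⟩ := hC.exists_hasSlices
  refine ⟨u, hC.isGlobalWeakSolution hu, hC.mem_energyClass hu,
    hasTrace_of_slices (q := 0) hC.continuousOn (fun K _ => MemLp.zero) ?_
      (hu₀.locallyIntegrable (by norm_num)) ?_⟩
  · filter_upwards [hu.slices] with t ht
    rw [add_zero]
    exact EventuallyEq.symm ht
  · rw [h0, FourierTransform.fourierInv_fourier_eq, add_zero]
    exact hu₀.coeFn_toLp.symm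

theorem SolvesCauchy.ae_eq (hA : IsElliptic A lam Lam) (hlam : 0 < lam) (hLam : 0 < Lam)
    (hu₀ : MemLp u₀ 2 volume) {u' : ℝ × Sp n → St N}
    (h : SolvesCauchy A (energyClass n m N) u₀ u) (h' : SolvesCauchy A (energyClass n m N) u₀ u') :
    u' =ᵐ[volume.restrict (halfSpace n)] u := by
  obtain ⟨C, hC, hu, h0⟩ := h.exists_isEnergySolution hA hLam hu₀
  obtain ⟨C', hC', hu', h0'⟩ := h'.exists_isEnergySolution hA hLam hu₀
  have heq := (hC.eq_of_initial_eq hlam hC' (h0.trans h0'.symm)).2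
  rw [restrict_halfSpace]
  refine ae_eq_prod_of_slices hu'.meas hu.meas ?_
  filter_upwards [hu.slices, hu'.slices, ae_restrict_mem measurableSet_Ioi] with t h1 h2 h3
  rw [← heq t (le_of_lt h3)] at h2
  exact h2.symm.trans h1

theorem norm_energyCurve (hu : u ∈ energyClass n m N) : ‖energyCurve hu‖ = ‖gradCurve hu‖ := by
  refine (sq_eq_sq₀ (norm_nonneg _) (norm_nonneg _)).1 ?_
  rw [norm_sq_Lp_two, norm_sq_Lp_two]
  refine integral_congr_ae ?_
  filter_upwards [riesz_energyCurve hu] with t ht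
  rw [← ht, norm_riesz]

theorem normGrad_eq (hu : u ∈ energyClass n m N) :
    normGrad m u = ENNReal.ofReal ‖energyCurve hu‖ := by
  rw [norm_energyCurve, gradCurve, LinearIsometryEquiv.norm_map, ofReal_norm, Lp.enorm_toLp,
    normGrad, restrict_halfSpace]

theorem normL2_eq_of_ae_eq {f : L2St n N} {g : Sp n → St N} (h : (𝓕⁻ f : L2St n N) =ᵐ[volume] g) :
    normL2 g = ENNReal.ofReal ‖f‖ := by
  rw [normL2, ← eLpNorm_congr_ae h, ← Lp.enorm_def, ← ofReal_norm]
  congr 1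
  exact (Lp.fourierTransformₗᵢ (Sp n) (St N)).symm.norm_map f

/-- Monotonicity gives one inequality. For the other, the essential supremum sees only almost every
time, which suffices since `C` is continuous at `0`. -/
theorem IsEnergySolution.normLinftyL2_eq (hlam : 0 < lam) {d : Lp (L2St n N) 2 halfLine}
    {C : ℝ → L2St n N} (h : IsEnergySolution hA hLam d C) (hu : HasSlices C u) :
    normLinftyL2 u = ENNReal.ofReal ‖C 0‖ := by
  have h1 : ∀ᵐ t ∂halfLine, (normL2 fun x => u (t, x)) = ENNReal.ofReal ‖C t‖ := by
    filter_upwards [hu.slices] with t ht using normL2_eq_of_ae_eq ht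
  refine le_antisymm (essSup_le_of_ae_le _ ?_) ?_
  · filter_upwards [h1, ae_restrict_mem measurableSet_Ioi] with t h2 h3
    rw [h2]
    exact ENNReal.ofReal_le_ofReal (h.antitoneOn_norm hlam (mem_Ici.2 le_rfl) (mem_Ici.2 (le_of_lt h3))
      (le_of_lt h3))
  · have := nhdsGT_inf_ae_neBot
    have h2 : Tendsto (fun t => ENNReal.ofReal ‖C t‖) (𝓝[>] (0 : ℝ) ⊓ ae halfLine)
        (𝓝 (ENNReal.ofReal ‖C 0‖)) := by
      refine Tendsto.mono_left ?_ (inf_le_left : 𝓝[>] (0 : ℝ) ⊓ ae halfLine ≤ 𝓝[>] 0)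
      exact (ENNReal.tendsto_ofReal ((h.continuousOn 0 (mem_Ici.2 le_rfl)).norm)).mono_left
        (nhdsWithin_mono _ Ioi_subset_Ici_self)
    refine le_of_tendsto h2 (Filter.Eventually.filter_mono inf_le_right ?_)
    filter_upwards [h1, ENNReal.ae_le_essSup (μ := halfLine) fun t => normL2 fun x => u (t, x)]
      with t h3 h4
    rw [← h3]
    exact h4

end Identification

end

end ParabolicCauchy

end

theorem theorem4p1 (n m N : ℕ) (hn : 1 ≤ n) (hm : 1 ≤ m) (hN : 1 ≤ N)
    (A : Coeff n m N) (lam Lam : ℝ) (hlam : 0 < lam) (hLam : 0 < Lam)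
    (hA : IsElliptic A lam Lam) :
    IsWellPosed A (dataL2 n N) normL2 (energyClass n m N) (normGrad m) ∧
    ∀ u₀ ∈ dataL2 n N, ∀ u, SolvesCauchy A (energyClass n m N) u₀ u →
      (∃ U : ℝ → Lp (St N) 2 (volume : Measure (Sp n)),
        (∀ᵐ t ∂(volume.restrict (Ioi (0 : ℝ))), U t =ᵐ[volume] fun x => u (t, x)) ∧
        U 0 =ᵐ[volume] u₀ ∧
        ContinuousOn U (Ici 0) ∧
        Tendsto U atTop (𝓝 0) ∧
        AntitoneOn (fun t => ‖U t‖) (Ici 0)) ∧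
      (∀ T : ℝ, 0 < T → MemL2Hm m T u) ∧
      normL2 u₀ = normLinftyL2 u ∧
      normLinftyL2 u ≤ ENNReal.ofReal (Real.sqrt (2 * Lam)) * normGrad m u ∧
      ENNReal.ofReal (Real.sqrt (2 * Lam)) * normGrad m u ≤
        ENNReal.ofReal (Real.sqrt (Lam / lam)) * normL2 u₀ := by
  have : NeZero n := ⟨by omega⟩
  have hgrad : ∀ (u₀ : Sp n → St N) (hu₀ : MemLp u₀ 2 volume) (C : ℝ → L2St n N),
      C 0 = FourierTransform.fourier (hu₀.toLp : L2St n N) → normL2 u₀ = ENNReal.ofReal ‖C 0‖ := by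
    intro u₀ hu₀ C h0
    refine normL2_eq_of_ae_eq ?_
    rw [h0, FourierTransform.fourierInv_fourier_eq]
    exact hu₀.coeFn_toLp
  refine ⟨⟨fun u hu h => ?_, fun u₀ hu₀ => ?_, ?_⟩, fun u₀ hu₀ u h => ?_⟩
  -- Without assuming that the trace is in `L²`, the function `q` cannot be removed; the trace is
  -- `𝓕⁻¹ C(0) + q`.
  · obtain ⟨C, hC⟩ := h.exists_isEnergySolution (hA := hA) (hLam := hLam) hu
    obtain ⟨q, hq1, hq2, -⟩ := h.exists_eq_add hu hC
    have hq : LocallyIntegrable q := locallyIntegrable_iff.2 fun K hK =>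
      haveI : IsFiniteMeasure (volume.restrict K) := ⟨by simpa using hK.measure_lt_top⟩
      (hq1 K hK).integrable (by norm_num)
    exact ⟨_, hasTrace_of_slices hC.continuousOn hq1 hq2
      (((Lp.memLp _).locallyIntegrable (by norm_num)).add hq) EventuallyEq.rfl⟩
  · obtain ⟨u, hu⟩ := exists_solvesCauchy hA hlam hLam hu₀
    exact ⟨u, hu, fun u' hu' => hu.ae_eq hA hlam hLam hu₀ hu'⟩
  -- The constant comes from `2 lam ‖d‖² ≤ ‖C 0‖²`, with `‖d‖` the norm of the gradient.
  · refine ⟨(Real.sqrt (1 / (2 * lam))).toNNReal, by positivity, fun u₀ hu₀ u h => ?_⟩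
    obtain ⟨C, hC, hu, h0⟩ := h.exists_isEnergySolution hA hLam hu₀
    rw [normGrad_eq h.2.1, hgrad u₀ hu₀ C h0]
    change _ ≤ ENNReal.ofReal (Real.sqrt (1 / (2 * lam))) * _
    rw [← ENNReal.ofReal_mul (Real.sqrt_nonneg _)]
    refine ENNReal.ofReal_le_ofReal (le_sqrt_mul_of_sq_le (norm_nonneg _) (norm_nonneg _) ?_)
    rw [div_mul_eq_mul_div, one_mul, le_div_iff₀ (by positivity), mul_comm]
    exact hC.le_norm_sq
  · obtain ⟨C, hC, hu, h0⟩ := h.exists_isEnergySolution hA hLam hu₀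
    have hlower := hC.le_norm_sq
    have hupper := hC.norm_sq_le
    rw [hC.normLinftyL2_eq hlam hu, normGrad_eq h.2.1, hgrad u₀ hu₀ C h0,
      ← ENNReal.ofReal_mul (Real.sqrt_nonneg _), ← ENNReal.ofReal_mul (Real.sqrt_nonneg _)]
    refine ⟨⟨fun t => FourierTransform.fourierInv (C t), hu.slices, ?_,
      continuousOn_fourierInv hC.continuousOn, ?_, ?_⟩, fun T _ => hC.memL2Hm hu T, rfl,
      ENNReal.ofReal_le_ofReal (le_sqrt_mul_of_sq_le (norm_nonneg _) (norm_nonneg _) hupper),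
      ENNReal.ofReal_le_ofReal ?_⟩
    · dsimp only
      rw [h0, FourierTransform.fourierInv_fourier_eq]
      exact hu₀.coeFn_toLp
    · rw [← map_zero (FourierTransform.fourierInvCLM ℂ (L2St n N))]
      exact ((FourierTransform.fourierInvCLM ℂ (L2St n N)).continuous.tendsto 0).comp
        hC.tendsto_zero
    · have hnorm : ∀ f : L2St n N, ‖(FourierTransform.fourierInv f : L2St n N)‖ = ‖f‖ :=
        (Lp.fourierTransformₗᵢ (Sp n) (St N)).symm.norm_map
      simp only [hnorm]
      exact hC.antitoneOn_norm hlam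
    -- After squaring and multiplying by `lam`, this is `Lam` times the lower energy bound.
    · refine le_sqrt_mul_of_sq_le (by positivity) (norm_nonneg _) ?_
      rw [mul_pow, Real.sq_sqrt (by positivity), div_mul_eq_mul_div, le_div_iff₀ hlam]
      nlinarith [hlower, hLam]
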